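/- Let $M$ be a compact (Hausdorff, boundaryless) smooth $4$-manifold with a smooth almost Hermitian structure $(g,J,\omega)$: $g$ is a smooth Riemannian metric, $J$ is a smooth almost complex structure ($J^2=-\mathrm{Id}$) with $g(J\cdot,J\cdot)=g(\cdot,\cdot)$, and $\omega=g(J\cdot,\cdot)$. Let $\theta$ be the Lee form, i.e. the unique smooth $1$-form with $d\omega=\theta\wedge\omega$. Assume that (1) $(M,g,J,\omega)$ is of class $\mathcal{AH}_1$, i.e. the Riemann curvature tensor of $g$ satisfies $R(X,Y,Z,W)=R(X,Y,JZ,JW)$ for all tangent vectors $X,Y,Z,W$ at each point; (2) $d\theta=0$, i.e. the structure is locally conformally almost Kähler; (3) the scalar curvature of $g$ vanishes at no point of $M$. Then $(M,g,J,\omega)$ is Kähler: $J$ is integrable, in the sense that its Nijenhuis tensor $N(X,Y)=[JX,JY]-[X,Y]-J[JX,Y]-J[X,JY]$ vanishes identically, and $d\omega=0$. -/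

import Mathlib

open scoped Manifold ContDiff

noncomputable section

namespace AlmostHermitian

/-- The model space `ℝ⁴`. -/
abbrev E4 : Type := EuclideanSpace ℝ (Fin 4)

/-! ### Tensor calculus on open subsets of `ℝ⁴`

A metric is given by the matrix of its components `G y i j = g_{ij}(y)`, an endomorphism field by
`A y a i = A^a_i(y)` (that is, `A ∂_i = ∑ a, A^a_i ∂_a`). -/

/-- The partial derivative `∂_i f` at `y`. -/
def pderiv (i : Fin 4) (f : E4 → ℝ) (y : E4) : ℝ :=
  fderiv ℝ f y (EuclideanSpace.single i 1)

/-- The Christoffel symbols of the Levi-Civita connection, `∇_{∂_i} ∂_j = ∑ k, Γ^k_{ij} ∂_k`, where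
`Γ^k_{ij} = ½ ∑ l, g^{kl} (∂_i g_{jl} + ∂_j g_{il} - ∂_l g_{ij})`. -/
def christoffel (G : E4 → Matrix (Fin 4) (Fin 4) ℝ) (k i j : Fin 4) (y : E4) : ℝ :=
  (1 / 2 : ℝ) * ∑ l, (G y)⁻¹ k l *
    (pderiv i (fun z => G z j l) y + pderiv j (fun z => G z i l) y - pderiv l (fun z => G z i j) y)

/-- The components `R^l` of `R(∂_i, ∂_j) ∂_k = ∑ l, R^l ∂_l`, where
`R(X, Y) Z = ∇_X ∇_Y Z - ∇_Y ∇_X Z - ∇_{[X, Y]} Z`. -/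
def curvature (G : E4 → Matrix (Fin 4) (Fin 4) ℝ) (l i j k : Fin 4) (y : E4) : ℝ :=
  pderiv i (christoffel G l j k) y - pderiv j (christoffel G l i k) y +
    ∑ m, (christoffel G l i m y * christoffel G m j k y -
      christoffel G l j m y * christoffel G m i k y)

/-- The components `R_{ijkl} = g(R(∂_i, ∂_j) ∂_k, ∂_l)` of the Riemann curvature tensor. -/
def riemann (G : E4 → Matrix (Fin 4) (Fin 4) ℝ) (i j k l : Fin 4) (y : E4) : ℝ :=
  ∑ m, curvature G m i j k y * G y m l

/-- The components of the Ricci tensor, `Ric(Y, Z) = tr (X ↦ R(X, Y) Z)`. -/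
def ricci (G : E4 → Matrix (Fin 4) (Fin 4) ℝ) (j k : Fin 4) (y : E4) : ℝ :=
  ∑ i, curvature G i i j k y

/-- The scalar curvature `s = ∑ j k, g^{jk} Ric_{jk}`. -/
def scalarCurvature (G : E4 → Matrix (Fin 4) (Fin 4) ℝ) (y : E4) : ℝ :=
  ∑ j, ∑ k, (G y)⁻¹ j k * ricci G j k y

/-- The components `N^k` of the Nijenhuis tensor
`N(X, Y) = [AX, AY] - [X, Y] - A[AX, Y] - A[X, AY]` on `X = ∂_i`, `Y = ∂_j`
(so `[X, Y] = 0`, `[AX, Y] = -∂_j (A X)`, `[X, AY] = ∂_i (A Y)`). -/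
def nijenhuis (A : E4 → Matrix (Fin 4) (Fin 4) ℝ) (k i j : Fin 4) (y : E4) : ℝ :=
  ∑ l, (A y l i * pderiv l (fun z => A z k j) y - A y l j * pderiv l (fun z => A z k i) y)
    + ∑ l, A y k l * pderiv j (fun z => A z l i) y
    - ∑ l, A y k l * pderiv i (fun z => A z l j) y

/-- The components `(dα)_{ij} = ∂_i α_j - ∂_j α_i` of the exterior derivative of a 1-form. -/
def extDerivOne (α : E4 → Fin 4 → ℝ) (i j : Fin 4) (y : E4) : ℝ :=
  pderiv i (fun z => α z j) y - pderiv j (fun z => α z i) y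

/-- The components `(dβ)_{ijk} = ∂_i β_{jk} + ∂_j β_{ki} + ∂_k β_{ij}` of the exterior derivative
of a 2-form. -/
def extDerivTwo (β : E4 → Matrix (Fin 4) (Fin 4) ℝ) (i j k : Fin 4) (y : E4) : ℝ :=
  pderiv i (fun z => β z j k) y + pderiv j (fun z => β z k i) y + pderiv k (fun z => β z i j) y

/-- The components `(α ∧ β)_{ijk} = α_i β_{jk} + α_j β_{ki} + α_k β_{ij}` of the wedge product of
a 1-form and a 2-form. -/
def wedgeOneTwo (α : E4 → Fin 4 → ℝ) (β : E4 → Matrix (Fin 4) (Fin 4) ℝ) (i j k : Fin 4)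
    (y : E4) : ℝ :=
  α y i * β y j k + α y j * β y k i + α y k * β y i j

/-! ### Almost Hermitian structures -/

/-- A smooth almost Hermitian structure `(g, J)` on a smooth 4-manifold: a smooth Riemannian
metric `g` and a smooth `g`-orthogonal almost complex structure `J`. -/
structure AlmostHermitianStructure (M : Type*) [TopologicalSpace M] [ChartedSpace E4 M]
    [IsManifold 𝓘(ℝ, E4) ∞ M] where
  /-- the Riemannian metric -/
  g : Bundle.ContMDiffRiemannianMetric 𝓘(ℝ, E4) ∞ E4 (fun x : M => TangentSpace 𝓘(ℝ, E4) x)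
  /-- the almost complex structure -/
  J : ∀ x : M, TangentSpace 𝓘(ℝ, E4) x →L[ℝ] TangentSpace 𝓘(ℝ, E4) x
  smooth_J : ContMDiff 𝓘(ℝ, E4) (𝓘(ℝ, E4).prod 𝓘(ℝ, E4 →L[ℝ] E4)) ∞
    (fun x : M => Bundle.TotalSpace.mk' (E4 →L[ℝ] E4)
      (E := fun x : M => TangentSpace 𝓘(ℝ, E4) x →L[ℝ] TangentSpace 𝓘(ℝ, E4) x) x (J x))
  J_sq : ∀ (x : M) (v : TangentSpace 𝓘(ℝ, E4) x), J x (J x v) = -v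
  J_orthogonal : ∀ (x : M) (v w : TangentSpace 𝓘(ℝ, E4) x),
    g.inner x (J x v) (J x w) = g.inner x v w

section Charts

variable {M : Type*} [TopologicalSpace M] [ChartedSpace E4 M]

/-- The coordinate vector `∂_i` of the chart `e` at the point `e.symm y` of `M`. -/
def coordVec (e : OpenPartialHomeomorph M E4) (i : Fin 4) (y : E4) :
    TangentSpace 𝓘(ℝ, E4) (e.symm y) :=
  mfderiv 𝓘(ℝ, E4) 𝓘(ℝ, E4) e.symm y (EuclideanSpace.single i (1 : ℝ) : E4)

/-- The `a`-th component in the chart `e` of a tangent vector of `M` at `x`. -/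
def vecCoord (e : OpenPartialHomeomorph M E4) (a : Fin 4) (x : M)
    (v : TangentSpace 𝓘(ℝ, E4) x) : ℝ :=
  (show E4 from mfderiv 𝓘(ℝ, E4) 𝓘(ℝ, E4) e x v) a

/-- The components `θ_i = θ(∂_i)` of a 1-form on `M` in the chart `e`. -/
def formCoef (θ : ∀ x : M, TangentSpace 𝓘(ℝ, E4) x →L[ℝ] ℝ) (e : OpenPartialHomeomorph M E4)
    (y : E4) (i : Fin 4) : ℝ :=
  θ (e.symm y) (coordVec e i y)

/-- A 1-form on `M` is smooth: its components in every chart of the atlas are smooth. -/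
def IsSmoothForm (θ : ∀ x : M, TangentSpace 𝓘(ℝ, E4) x →L[ℝ] ℝ) : Prop :=
  ∀ e ∈ atlas E4 M, ∀ i, ContDiffOn ℝ ∞ (fun y => formCoef θ e y i) e.target

end Charts

namespace AlmostHermitianStructure

variable {M : Type*} [TopologicalSpace M] [ChartedSpace E4 M] [IsManifold 𝓘(ℝ, E4) ∞ M]

/-- The components `g_{ij} = g(∂_i, ∂_j)` of the metric in the chart `e`. -/
def metricCoef (S : AlmostHermitianStructure M) (e : OpenPartialHomeomorph M E4) (y : E4) :
    Matrix (Fin 4) (Fin 4) ℝ :=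
  Matrix.of fun i j => S.g.inner (e.symm y) (coordVec e i y) (coordVec e j y)

/-- The components `J^a_i` of `J` in the chart `e`: `J ∂_i = ∑ a, J^a_i ∂_a`. -/
def acsCoef (S : AlmostHermitianStructure M) (e : OpenPartialHomeomorph M E4) (y : E4) :
    Matrix (Fin 4) (Fin 4) ℝ :=
  Matrix.of fun a i => vecCoord e a (e.symm y) (S.J (e.symm y) (coordVec e i y))

/-- The components `ω_{ij} = g(J ∂_i, ∂_j)` of the fundamental 2-form in the chart `e`. -/
def omegaCoef (S : AlmostHermitianStructure M) (e : OpenPartialHomeomorph M E4) (y : E4) :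
    Matrix (Fin 4) (Fin 4) ℝ :=
  Matrix.of fun i j => S.g.inner (e.symm y) (S.J (e.symm y) (coordVec e i y)) (coordVec e j y)

/-- Gray's first condition `R(X, Y, Z, W) = R(X, Y, JZ, JW)`: the class `AH₁`. -/
def IsAH1 (S : AlmostHermitianStructure M) : Prop :=
  ∀ e ∈ atlas E4 M, ∀ y ∈ e.target, ∀ i j k l : Fin 4,
    riemann (S.metricCoef e) i j k l y =
      ∑ a, ∑ b, S.acsCoef e y a k * S.acsCoef e y b l * riemann (S.metricCoef e) i j a b y

/-- The scalar curvature of `g` vanishes nowhere on `M`. -/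
def ScalarCurvatureNowhereZero (S : AlmostHermitianStructure M) : Prop :=
  ∀ e ∈ atlas E4 M, ∀ y ∈ e.target, scalarCurvature (S.metricCoef e) y ≠ 0

/-- `θ` is the Lee form of the structure: the smooth 1-form with `dω = θ ∧ ω`
(there is exactly one, as wedging 1-forms with `ω` is injective and onto the 3-forms in
dimension 4). -/
def IsLeeForm (S : AlmostHermitianStructure M)
    (θ : ∀ x : M, TangentSpace 𝓘(ℝ, E4) x →L[ℝ] ℝ) : Prop :=
  IsSmoothForm θ ∧ ∀ e ∈ atlas E4 M, ∀ y ∈ e.target, ∀ i j k : Fin 4,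
    extDerivTwo (S.omegaCoef e) i j k y = wedgeOneTwo (formCoef θ e) (S.omegaCoef e) i j k y

/-- The structure is locally conformally almost Kähler: its Lee form `θ` satisfies `dθ = 0`. -/
def IsLocallyConformallyAlmostKahler (S : AlmostHermitianStructure M) : Prop :=
  ∃ θ : ∀ x : M, TangentSpace 𝓘(ℝ, E4) x →L[ℝ] ℝ, S.IsLeeForm θ ∧
    ∀ e ∈ atlas E4 M, ∀ y ∈ e.target, ∀ i j : Fin 4, extDerivOne (formCoef θ e) i j y = 0

/-- The structure is Hermitian (`J` is integrable): the Nijenhuis tensor vanishes. -/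
def IsHermitian (S : AlmostHermitianStructure M) : Prop :=
  ∀ e ∈ atlas E4 M, ∀ y ∈ e.target, ∀ k i j : Fin 4, nijenhuis (S.acsCoef e) k i j y = 0

/-- The structure is almost Kähler: `dω = 0`. -/
def IsAlmostKahler (S : AlmostHermitianStructure M) : Prop :=
  ∀ e ∈ atlas E4 M, ∀ y ∈ e.target, ∀ i j k : Fin 4, extDerivTwo (S.omegaCoef e) i j k y = 0

/-- The structure is Kähler: `J` is integrable and `ω` is symplectic. -/
def IsKahler (S : AlmostHermitianStructure M) : Prop :=
  S.IsHermitian ∧ S.IsAlmostKahler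

end AlmostHermitianStructure

end AlmostHermitian

end

/-! Write `K = ∇J`, a 1-form with values in the skew-adjoint endomorphisms anticommuting with `J`,
`ω` for the fundamental form and `ρ_ij = tr (J R_ij)`, a multiple of the Ricci form. Class `AH₁`
says that `R` commutes with `J`, so the Ricci identity makes `∇²J` symmetric (`covD_covDJ_symm`).
The Ricci identity applied to `K` then gives `ρ ∧ K = 0` (`ricciForm_wedge`). Algebraically, `AH₁`
makes `ρ` invariant under `J`, and `ρ ∧ ω` equals the scalar curvature in a unitary frame
(`IsCurvJ.wedge_ricForm`). Hence `ρ ∧ ω` vanishes nowhere.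

The first half is global. The 2-forms `ρ` and `τ_ij = tr (J K_i K_j)` are closed, and `ρ ∧ K = 0`
forces `τ = h ρ` for a function `h` (`torForm_eq`); thus `dh ∧ ρ = 0`. Let `ψ` be the 3-form
alternating `g(J K_i ·, ·)`. Then `dψ = -½ τ ∧ ω` (`extDerivThree_torForm3`), and `x ∧ ψ = 0`
whenever `x ∧ ρ = 0` (`wedge13_torForm3`). Therefore `d(h ψ) = -½ h² ρ ∧ ω`, and Stokes on the
compact manifold gives `h = 0`, that is `τ = 0`. Multiplying by the locally constant sign of `ρ ∧ ω`
turns 4-forms into densities, so the charts need not be oriented. Stokes itself is obtained from a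
partition of unity (`sum_integral_chartFlux`).

The second half is local (`quaternion_contradiction`). Since `τ = 0`, the `K_i` are pairwise
proportional. Where `K ≠ 0` one has `K = β ⊗ N` with `N² = -1`, `NJ = -JN`, and `∇N = -β ⊗ J + α ⊗
JN`. Symmetry of `∇²J` yields `dβ = 0` and `α ∧ β = 0`. With `ω_N = g(N ·, ·)`, the Lee form
satisfies `θ ∧ ω = dω = β ∧ ω_N`, which rotates to `θ ∧ ω_N = -β ∧ ω`. Taking `d` and using `dθ = 0`
leaves `θ ∧ α ∧ ω_JN = 0`, whence `α = 0`. Then `R` commutes with `N` as well as with `J`, so `ρ =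
0`, a contradiction. Hence `∇J = 0`, and the torsion-free connection gives `dω = 0` and a vanishing
Nijenhuis tensor. -/

noncomputable section

namespace AlmostHermitian

/-! ### Calculus of matrix-valued functions on `ℝ⁴` -/

/-- Square matrices of size four. -/
abbrev Mat : Type := Matrix (Fin 4) (Fin 4) ℝ

theorem contDiffAt_pderiv {f : E4 → ℝ} {y : E4} (hf : ContDiffAt ℝ ∞ f y) (i : Fin 4) :
    ContDiffAt ℝ ∞ (pderiv i f) y :=
  (hf.fderiv_right (m := ∞) (by simp)).clm_apply contDiffAt_const

theorem smooth_diff {f : E4 → ℝ} {y : E4} (hf : ContDiffAt ℝ ∞ f y) : DifferentiableAt ℝ f y :=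
  hf.differentiableAt (by simp)

theorem pderiv_congr {f g : E4 → ℝ} {y : E4} (h : f =ᶠ[nhds y] g) (i : Fin 4) :
    pderiv i f y = pderiv i g y := by
  unfold pderiv; rw [h.fderiv_eq]

theorem pderiv_congr_of_isOpen {U : Set E4} (hU : IsOpen U) {f g : E4 → ℝ}
    (h : ∀ z ∈ U, f z = g z) {y : E4} (hy : y ∈ U) (i : Fin 4) :
    pderiv i f y = pderiv i g y :=
  pderiv_congr (Filter.eventuallyEq_of_mem (hU.mem_nhds hy) h) i

@[simp] theorem pderiv_const (c : ℝ) (i : Fin 4) (y : E4) : pderiv i (fun _ => c) y = 0 := by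
  simp [pderiv]

theorem pderiv_add {f g : E4 → ℝ} {y : E4} (hf : DifferentiableAt ℝ f y)
    (hg : DifferentiableAt ℝ g y) (i : Fin 4) :
    pderiv i (fun z => f z + g z) y = pderiv i f y + pderiv i g y := by
  unfold pderiv; rw [fderiv_fun_add hf hg]; rfl

theorem pderiv_sub {f g : E4 → ℝ} {y : E4} (hf : DifferentiableAt ℝ f y)
    (hg : DifferentiableAt ℝ g y) (i : Fin 4) :
    pderiv i (fun z => f z - g z) y = pderiv i f y - pderiv i g y := by
  unfold pderiv; rw [fderiv_fun_sub hf hg]; rfl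

theorem pderiv_neg (f : E4 → ℝ) (y : E4) (i : Fin 4) :
    pderiv i (fun z => -f z) y = -pderiv i f y := by
  unfold pderiv; rw [fderiv_fun_neg]; rfl

theorem pderiv_mul {f g : E4 → ℝ} {y : E4} (hf : DifferentiableAt ℝ f y)
    (hg : DifferentiableAt ℝ g y) (i : Fin 4) :
    pderiv i (fun z => f z * g z) y = pderiv i f y * g y + f y * pderiv i g y := by
  unfold pderiv; rw [fderiv_fun_mul hf hg]; simp [mul_comm, add_comm]

theorem pderiv_sum {f : Fin 4 → E4 → ℝ} {y : E4} (hf : ∀ a, DifferentiableAt ℝ (f a) y)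
    (i : Fin 4) : pderiv i (fun z => ∑ a, f a z) y = ∑ a, pderiv i (f a) y := by
  unfold pderiv; rw [fderiv_fun_sum fun a _ => hf a]; simp

theorem pderiv_comm {f : E4 → ℝ} {y : E4} (hf : ContDiffAt ℝ ∞ f y) (i j : Fin 4) :
    pderiv i (pderiv j f) y = pderiv j (pderiv i f) y := by
  have h1 : DifferentiableAt ℝ (fderiv ℝ f) y :=
    (hf.fderiv_right (m := ∞) (by simp)).differentiableAt (by simp)
  have hs : IsSymmSndFDerivAt ℝ f y := hf.isSymmSndFDerivAt (by simp only [minSmoothness_of_isRCLikeNormedField]; exact WithTop.coe_le_coe.2 (le_top : (2 : ℕ∞) ≤ ⊤))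
  have key : ∀ i j : Fin 4, pderiv i (pderiv j f) y =
      fderiv ℝ (fderiv ℝ f) y (EuclideanSpace.single i 1) (EuclideanSpace.single j 1) := by
    intro i j
    unfold pderiv
    rw [fderiv_clm_apply h1 (differentiableAt_const _)]
    simp
  rw [key, key, hs]

/-- The chain rule in coordinates. -/
theorem pderiv_comp {f : E4 → ℝ} {φ : E4 → E4} {y : E4} (hf : DifferentiableAt ℝ f (φ y))
    (hφ : DifferentiableAt ℝ φ y) (i : Fin 4) :
    pderiv i (fun z => f (φ z)) y =
      ∑ a, pderiv i (fun z => φ z a) y * pderiv a f (φ y) := by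
  have e1 : ∀ a, pderiv i (fun z => φ z a) y = fderiv ℝ φ y (EuclideanSpace.single i 1) a := by
    intro a
    unfold pderiv
    have : (fun z => φ z a) = fun z => (EuclideanSpace.proj a : E4 →L[ℝ] ℝ) (φ z) := rfl
    rw [this, fderiv_fun_comp y (EuclideanSpace.proj a : E4 →L[ℝ] ℝ).differentiableAt hφ,
      ContinuousLinearMap.fderiv]
    rfl
  have e2 : pderiv i (fun z => f (φ z)) y =
      fderiv ℝ f (φ y) (fderiv ℝ φ y (EuclideanSpace.single i 1)) := by
    unfold pderiv
    rw [fderiv_fun_comp y hf hφ]; rfl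
  rw [e2]
  set v := fderiv ℝ φ y (EuclideanSpace.single i 1) with hv
  have hvs : v = ∑ a, v a • (EuclideanSpace.single a (1 : ℝ) : E4) := by
    ext b
    simp [Fin.sum_univ_four]
    fin_cases b <;> simp
  conv_lhs => rw [hvs]
  rw [map_sum]
  refine Finset.sum_congr rfl fun a _ => ?_
  rw [map_smul, e1 a]; rfl

/-- A matrix-valued function all of whose entries are smooth at the points of `U`. -/
def SmoothMat (U : Set E4) (M : E4 → Mat) : Prop :=
  ∀ a b, ∀ y ∈ U, ContDiffAt ℝ ∞ (fun z => M z a b) y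

/-- The entrywise partial derivative. -/
def mpd (i : Fin 4) (M : E4 → Mat) (y : E4) : Mat :=
  Matrix.of fun a b => pderiv i (fun z => M z a b) y

section
variable {U : Set E4} {M N : E4 → Mat}

theorem SmoothMat.diff (hM : SmoothMat U M) {y : E4} (hy : y ∈ U) (a b : Fin 4) :
    DifferentiableAt ℝ (fun z => M z a b) y := smooth_diff (hM a b y hy)

theorem SmoothMat.mono (hM : SmoothMat U M) {V : Set E4} (h : V ⊆ U) : SmoothMat V M :=
  fun a b y hy => hM a b y (h hy)

theorem SmoothMat.add (hM : SmoothMat U M) (hN : SmoothMat U N) :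
    SmoothMat U (fun z => M z + N z) :=
  fun a b y hy => (hM a b y hy).add (hN a b y hy)

theorem SmoothMat.sub (hM : SmoothMat U M) (hN : SmoothMat U N) :
    SmoothMat U (fun z => M z - N z) :=
  fun a b y hy => (hM a b y hy).sub (hN a b y hy)

theorem SmoothMat.mul (hM : SmoothMat U M) (hN : SmoothMat U N) :
    SmoothMat U (fun z => M z * N z) := by
  intro a b y hy
  simp only [Matrix.mul_apply]
  exact ContDiffAt.sum fun c _ => (hM a c y hy).mul (hN c b y hy)

theorem SmoothMat.transpose (hM : SmoothMat U M) : SmoothMat U (fun z => (M z).transpose) :=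
  fun a b y hy => hM b a y hy

theorem SmoothMat.smul {f : E4 → ℝ} (hf : ∀ y ∈ U, ContDiffAt ℝ ∞ f y) (hM : SmoothMat U M) :
    SmoothMat U (fun z => f z • M z) :=
  fun a b y hy => (hf y hy).mul (hM a b y hy)

theorem SmoothMat.mpd (hM : SmoothMat U M) (i : Fin 4) : SmoothMat U (mpd i M) :=
  fun a b y hy => contDiffAt_pderiv (hM a b y hy) i

theorem SmoothMat.trace (hM : SmoothMat U M) {y : E4} (hy : y ∈ U) :
    ContDiffAt ℝ ∞ (fun z => (M z).trace) y := by
  simp only [Matrix.trace, Matrix.diag]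
  exact ContDiffAt.sum fun c _ => hM c c y hy

theorem SmoothMat.sum {M : Fin 4 → E4 → Mat} (hM : ∀ a, SmoothMat U (M a)) :
    SmoothMat U (fun z => ∑ a, M a z) := by
  intro a b y hy
  simp only [Matrix.sum_apply]
  exact ContDiffAt.sum fun c _ => hM c a b y hy

theorem SmoothMat.det (hM : SmoothMat U M) {y : E4} (hy : y ∈ U) :
    ContDiffAt ℝ ∞ (fun z => (M z).det) y := by
  simp only [Matrix.det_apply']
  exact ContDiffAt.sum fun σ _ => contDiffAt_const.mul (contDiffAt_prod fun c _ => hM _ _ y hy)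

theorem SmoothMat.inv (hM : SmoothMat U M) (h : ∀ y ∈ U, (M y).det ≠ 0) :
    SmoothMat U (fun z => (M z)⁻¹) := by
  -- Cramer's rule: each cofactor is the determinant of a matrix with one row made constant.
  have hadj : SmoothMat U (fun z => (M z).adjugate) := by
    intro a b y hy
    have hu : SmoothMat U (fun z => (M z).updateRow b (Pi.single a 1)) := by
      intro c d z hz
      by_cases hc : c = b
      · simp only [hc, Matrix.updateRow_self]; exact contDiffAt_const
      · simp only [Matrix.updateRow_ne hc]; exact hM c d z hz
    simpa only [Matrix.adjugate_apply] using hu.det hy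
  have : (fun z => (M z)⁻¹) = fun z => ((M z).det)⁻¹ • (M z).adjugate := by
    ext z; rw [Matrix.inv_def, Ring.inverse_eq_inv]
  rw [this]
  exact SmoothMat.smul (fun y hy => (hM.det hy).inv (h y hy)) hadj

theorem mpd_congr_of_isOpen (hU : IsOpen U) (h : ∀ z ∈ U, M z = N z) {y : E4} (hy : y ∈ U)
    (i : Fin 4) : mpd i M y = mpd i N y := by
  ext a b
  exact pderiv_congr_of_isOpen hU (fun z hz => by rw [h z hz]) hy i

theorem SmoothMat.congr (hU : IsOpen U) (hM : SmoothMat U M) (h : ∀ z ∈ U, N z = M z) :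
    SmoothMat U N := by
  intro a b y hy
  refine (hM a b y hy).congr_of_eventuallyEq ?_
  filter_upwards [hU.mem_nhds hy] with z hz
  rw [h z hz]

@[simp] theorem mpd_const (c : Mat) (i : Fin 4) (y : E4) : mpd i (fun _ => c) y = 0 := by
  ext a b; simp [mpd]

theorem mpd_add (hM : SmoothMat U M) (hN : SmoothMat U N) {y : E4} (hy : y ∈ U) (i : Fin 4) :
    mpd i (fun z => M z + N z) y = mpd i M y + mpd i N y := by
  ext a b; exact pderiv_add (hM.diff hy a b) (hN.diff hy a b) i

theorem mpd_sub (hM : SmoothMat U M) (hN : SmoothMat U N) {y : E4} (hy : y ∈ U) (i : Fin 4) :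
    mpd i (fun z => M z - N z) y = mpd i M y - mpd i N y := by
  ext a b; exact pderiv_sub (hM.diff hy a b) (hN.diff hy a b) i

theorem mpd_neg (M : E4 → Mat) (y : E4) (i : Fin 4) :
    mpd i (fun z => -M z) y = -mpd i M y := by
  ext a b; exact pderiv_neg _ y i

theorem mpd_mul (hM : SmoothMat U M) (hN : SmoothMat U N) {y : E4} (hy : y ∈ U) (i : Fin 4) :
    mpd i (fun z => M z * N z) y = mpd i M y * N y + M y * mpd i N y := by
  ext a b
  simp only [mpd, Matrix.of_apply, Matrix.add_apply, Matrix.mul_apply]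
  rw [← Finset.sum_add_distrib]
  refine (pderiv_sum (f := fun c z => M z a c * N z c b)
    (fun c => (hM.diff hy a c).mul (hN.diff hy c b)) i).trans ?_
  exact Finset.sum_congr rfl fun c _ => pderiv_mul (hM.diff hy a c) (hN.diff hy c b) i

theorem mpd_smul {f : E4 → ℝ} {y : E4} (hf : ContDiffAt ℝ ∞ f y) (hN : SmoothMat U N)
    (hy : y ∈ U) (i : Fin 4) :
    mpd i (fun z => f z • N z) y = pderiv i f y • N y + f y • mpd i N y := by
  ext a b
  exact pderiv_mul (smooth_diff hf) (hN.diff hy a b) i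

theorem mpd_sum {M : Fin 4 → E4 → Mat} (hM : ∀ a, SmoothMat U (M a)) {y : E4} (hy : y ∈ U)
    (i : Fin 4) : mpd i (fun z => ∑ a, M a z) y = ∑ a, mpd i (M a) y := by
  ext a b
  simp only [mpd, Matrix.of_apply, Matrix.sum_apply]
  exact pderiv_sum (fun c => (hM c).diff hy a b) i

theorem mpd_transpose (M : E4 → Mat) (y : E4) (i : Fin 4) :
    mpd i (fun z => (M z).transpose) y = (mpd i M y).transpose := rfl

theorem pderiv_trace (hM : SmoothMat U M) {y : E4} (hy : y ∈ U) (i : Fin 4) :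
    pderiv i (fun z => (M z).trace) y = (mpd i M y).trace := by
  simp only [Matrix.trace, Matrix.diag]
  exact pderiv_sum (fun c => hM.diff hy c c) i

theorem mpd_comm (hM : SmoothMat U M) {y : E4} (hy : y ∈ U) (i j : Fin 4) :
    mpd i (mpd j M) y = mpd j (mpd i M) y := by
  ext a b; exact pderiv_comm (hM a b y hy) i j

end

/-! ### The Levi-Civita connection in coordinates -/

/-- The matrix `(Γ_i)^k_j` of Christoffel symbols. -/
def chrMat (G : E4 → Mat) (i : Fin 4) (y : E4) : Mat :=
  Matrix.of fun k j => christoffel G k i j y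

/-- The covariant derivative of an endomorphism field. -/
def covD (G : E4 → Mat) (i : Fin 4) (M : E4 → Mat) (y : E4) : Mat :=
  mpd i M y + chrMat G i y * M y - M y * chrMat G i y

/-- The curvature endomorphism `R(∂_i, ∂_j)`. -/
def curvMat (G : E4 → Mat) (i j : Fin 4) (y : E4) : Mat :=
  Matrix.of fun l k => curvature G l i j k y

/-- Smooth symmetric invertible matrices of metric components on an open set. -/
structure IsMetricOn (U : Set E4) (G : E4 → Mat) : Prop where
  isOpen : IsOpen U
  smooth : SmoothMat U G
  symm : ∀ y ∈ U, (G y).transpose = G y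
  det_ne : ∀ y ∈ U, (G y).det ≠ 0

section
variable {U : Set E4} {G : E4 → Mat}

theorem curvMat_eq (i j : Fin 4) (y : E4) :
    curvMat G i j y = mpd i (chrMat G j) y - mpd j (chrMat G i) y +
      (chrMat G i y * chrMat G j y - chrMat G j y * chrMat G i y) := by
  ext l k
  simp [curvMat, curvature, mpd, chrMat, Matrix.mul_apply, Finset.sum_sub_distrib]

theorem IsMetricOn.smooth_chrMat (h : IsMetricOn U G) (i : Fin 4) : SmoothMat U (chrMat G i) := by
  intro k j y hy
  have hinv := h.smooth.inv h.det_ne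
  simp only [chrMat, Matrix.of_apply, christoffel]
  refine contDiffAt_const.mul (ContDiffAt.sum fun l _ => (hinv k l y hy).mul ?_)
  exact ((contDiffAt_pderiv (h.smooth _ _ y hy) _).add
    (contDiffAt_pderiv (h.smooth _ _ y hy) _)).sub (contDiffAt_pderiv (h.smooth _ _ y hy) _)

theorem IsMetricOn.smooth_curvMat (h : IsMetricOn U G) (i j : Fin 4) :
    SmoothMat U (curvMat G i j) := by
  have e : curvMat G i j = fun y => mpd i (chrMat G j) y - mpd j (chrMat G i) y +
      (chrMat G i y * chrMat G j y - chrMat G j y * chrMat G i y) := by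
    ext1 y; exact curvMat_eq i j y
  have hi := h.smooth_chrMat i
  have hj := h.smooth_chrMat j
  rw [e]
  exact ((hj.mpd i).sub (hi.mpd j)).add ((hi.mul hj).sub (hj.mul hi))

theorem IsMetricOn.smooth_covD (h : IsMetricOn U G) {M : E4 → Mat} (hM : SmoothMat U M)
    (i : Fin 4) : SmoothMat U (covD G i M) :=
  ((hM.mpd i).add ((h.smooth_chrMat i).mul hM)).sub (hM.mul (h.smooth_chrMat i))

theorem IsMetricOn.pderiv_symm (h : IsMetricOn U G) {y : E4} (hy : y ∈ U) (i a b : Fin 4) :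
    pderiv i (fun z => G z a b) y = pderiv i (fun z => G z b a) y :=
  pderiv_congr_of_isOpen h.isOpen (fun z hz => by
    conv_lhs => rw [← h.symm z hz, Matrix.transpose_apply]) hy i

theorem IsMetricOn.chrMat_symm (h : IsMetricOn U G) {y : E4} (hy : y ∈ U) (i j k : Fin 4) :
    chrMat G i y k j = chrMat G j y k i := by
  simp only [chrMat, Matrix.of_apply, christoffel]
  congr 1
  refine Finset.sum_congr rfl fun l _ => ?_
  rw [h.pderiv_symm hy l i j]; ring

/-- Koszul's formula: lowering the index cancels the inverse metric in the definition of the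
Christoffel symbols. -/
theorem IsMetricOn.lower_chrMat (h : IsMetricOn U G) {y : E4} (hy : y ∈ U) (i j k : Fin 4) :
    ((chrMat G i y).transpose * G y) j k = (1 / 2 : ℝ) * (pderiv i (fun z => G z j k) y +
      pderiv j (fun z => G z i k) y - pderiv k (fun z => G z i j) y) := by
  set v : Fin 4 → ℝ := fun l => (1 / 2 : ℝ) * (pderiv i (fun z => G z j l) y +
      pderiv j (fun z => G z i l) y - pderiv l (fun z => G z i j) y) with hv
  have h1 : ∀ m, chrMat G i y m j = ((G y)⁻¹.mulVec v) m := by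
    intro m
    simp only [chrMat, Matrix.of_apply, christoffel, Matrix.mulVec, dotProduct, hv,
      Finset.mul_sum]
    exact Finset.sum_congr rfl fun l _ => by ring
  have h2 : (G y).mulVec ((G y)⁻¹.mulVec v) = v := by
    rw [Matrix.mulVec_mulVec, Matrix.mul_nonsing_inv _ (h.det_ne y hy).isUnit, Matrix.one_mulVec]
  have h3 := congrFun h2 k
  refine Eq.trans ?_ h3
  rw [Matrix.mul_apply, Matrix.mulVec, dotProduct]
  refine Finset.sum_congr rfl fun m _ => ?_
  rw [Matrix.transpose_apply, h1 m, mul_comm]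
  congr 1
  conv_lhs => rw [← h.symm y hy, Matrix.transpose_apply]

/-- The Levi-Civita connection is metric. -/
theorem IsMetricOn.mpd_metric (h : IsMetricOn U G) {y : E4} (hy : y ∈ U) (i : Fin 4) :
    mpd i G y = (chrMat G i y).transpose * G y + G y * chrMat G i y := by
  ext j k
  have e : (G y * chrMat G i y) j k = ((chrMat G i y).transpose * G y) k j := by
    conv_lhs => rw [← h.symm y hy]
    simp only [Matrix.mul_apply, Matrix.transpose_apply]
    exact Finset.sum_congr rfl fun m _ => mul_comm _ _
  rw [Matrix.add_apply, e, h.lower_chrMat hy, h.lower_chrMat hy, h.pderiv_symm hy i k j]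
  simp only [mpd, Matrix.of_apply]; ring

/-- A symmetric metric connection is the Levi-Civita connection. -/
theorem IsMetricOn.chrMat_unique (h : IsMetricOn U G) {y : E4} (hy : y ∈ U) (C : Fin 4 → Mat)
    (hsymm : ∀ i j k, C i k j = C j k i)
    (hC : ∀ i, mpd i G y = (C i).transpose * G y + G y * C i) (i : Fin 4) :
    chrMat G i y = C i := by
  have hD : ∀ i j k, ((C i).transpose * G y) j k = ((C j).transpose * G y) i k := by
    intro i j k
    simp only [Matrix.mul_apply, Matrix.transpose_apply]
    exact Finset.sum_congr rfl fun m _ => by rw [hsymm]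
  have e : ∀ i j k, (G y * C i) j k = ((C i).transpose * G y) k j := by
    intro i j k
    conv_lhs => rw [← h.symm y hy]
    simp only [Matrix.mul_apply, Matrix.transpose_apply]
    exact Finset.sum_congr rfl fun m _ => mul_comm _ _
  have hp : ∀ i j k, pderiv i (fun z => G z j k) y =
      ((C i).transpose * G y) j k + ((C i).transpose * G y) k j := by
    intro i j k
    have := congrFun (congrFun (hC i) j) k
    rw [Matrix.add_apply, e] at this
    exact this
  -- The Koszul argument: in the alternating combination of derivatives of the metric, expressed
  -- through `C`, symmetry in the lower indices leaves twice the lowered `C i`.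
  have hl : (chrMat G i y).transpose * G y = (C i).transpose * G y := by
    ext j k
    rw [h.lower_chrMat hy, hp, hp, hp, hD j i k, hD k i j, hD j k i]
    ring
  have h3 : (chrMat G i y).transpose = (C i).transpose := by
    have := congrArg (· * (G y)⁻¹) hl
    simpa only [Matrix.mul_assoc, Matrix.mul_nonsing_inv _ (h.det_ne y hy).isUnit,
      Matrix.mul_one] using this
  exact Matrix.transpose_injective h3

theorem covD_congr {M N : E4 → Mat} (hU : IsOpen U) (h : ∀ z ∈ U, M z = N z) {y : E4}
    (hy : y ∈ U) (i : Fin 4) : covD G i M y = covD G i N y := by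
  unfold covD; rw [mpd_congr_of_isOpen hU h hy, h y hy]

theorem covD_mul {M N : E4 → Mat} (hM : SmoothMat U M) (hN : SmoothMat U N) {y : E4}
    (hy : y ∈ U) (i : Fin 4) :
    covD G i (fun z => M z * N z) y = covD G i M y * N y + M y * covD G i N y := by
  unfold covD; rw [mpd_mul hM hN hy]; noncomm_ring

theorem covD_add {M N : E4 → Mat} (hM : SmoothMat U M) (hN : SmoothMat U N) {y : E4}
    (hy : y ∈ U) (i : Fin 4) :
    covD G i (fun z => M z + N z) y = covD G i M y + covD G i N y := by
  unfold covD; rw [mpd_add hM hN hy]; noncomm_ring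

theorem covD_neg (M : E4 → Mat) (y : E4) (i : Fin 4) :
    covD G i (fun z => -M z) y = -covD G i M y := by
  unfold covD; rw [mpd_neg]; noncomm_ring

theorem covD_smul {f : E4 → ℝ} {N : E4 → Mat} {y : E4} (hf : ContDiffAt ℝ ∞ f y)
    (hN : SmoothMat U N) (hy : y ∈ U) (i : Fin 4) :
    covD G i (fun z => f z • N z) y = pderiv i f y • N y + f y • covD G i N y := by
  unfold covD; rw [mpd_smul hf hN hy]
  simp only [Matrix.mul_smul, Matrix.smul_mul, smul_add, smul_sub]; abel

theorem pderiv_trace_covD {M : E4 → Mat} (hM : SmoothMat U M) {y : E4} (hy : y ∈ U)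
    (i : Fin 4) : pderiv i (fun z => (M z).trace) y = (covD G i M y).trace := by
  rw [pderiv_trace hM hy, covD, Matrix.trace_sub, Matrix.trace_add, Matrix.trace_mul_comm (M y)]
  ring

/-- The Ricci identity. -/
theorem IsMetricOn.covD_comm (h : IsMetricOn U G) {M : E4 → Mat} (hM : SmoothMat U M) {y : E4}
    (hy : y ∈ U) (i j : Fin 4) :
    covD G i (covD G j M) y - covD G j (covD G i M) y =
      curvMat G i j y * M y - M y * curvMat G i j y := by
  have key : ∀ i j, covD G i (covD G j M) y =
      mpd i (mpd j M) y + (mpd i (chrMat G j) y * M y + chrMat G j y * mpd i M y)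
        - (mpd i M y * chrMat G j y + M y * mpd i (chrMat G j) y)
        + chrMat G i y * covD G j M y - covD G j M y * chrMat G i y := by
    intro i j
    have hj := h.smooth_chrMat j
    have e : mpd i (covD G j M) y =
        mpd i (mpd j M) y + (mpd i (chrMat G j) y * M y + chrMat G j y * mpd i M y)
        - (mpd i M y * chrMat G j y + M y * mpd i (chrMat G j) y) := by
      rw [← mpd_mul hM hj hy, ← mpd_mul hj hM hy, ← mpd_add (hM.mpd j) (hj.mul hM) hy,
        ← mpd_sub ((hM.mpd j).add (hj.mul hM)) (hM.mul hj) hy]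
      rfl
    rw [covD, e]
  rw [key, key, curvMat_eq, mpd_comm hM hy i j]
  simp only [covD]
  noncomm_ring

/-- The second Bianchi identity. -/
theorem IsMetricOn.bianchi_two (h : IsMetricOn U G) {y : E4} (hy : y ∈ U) (i j k : Fin 4) :
    covD G i (curvMat G j k) y + covD G j (curvMat G k i) y + covD G k (curvMat G i j) y = 0 := by
  have hΓ := h.smooth_chrMat
  have key : ∀ i j k, covD G i (curvMat G j k) y =
      mpd i (mpd j (chrMat G k)) y - mpd i (mpd k (chrMat G j)) y +
      (mpd i (chrMat G j) y * chrMat G k y + chrMat G j y * mpd i (chrMat G k) y -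
        (mpd i (chrMat G k) y * chrMat G j y + chrMat G k y * mpd i (chrMat G j) y)) +
      chrMat G i y * curvMat G j k y - curvMat G j k y * chrMat G i y := by
    intro i j k
    have e : curvMat G j k = fun y => mpd j (chrMat G k) y - mpd k (chrMat G j) y +
      (chrMat G j y * chrMat G k y - chrMat G k y * chrMat G j y) := by
      ext1 y; exact curvMat_eq j k y
    have hj := hΓ j
    have hk := hΓ k
    rw [covD]
    congr 2
    conv_lhs => rw [e]
    rw [mpd_add ((hk.mpd j).sub (hj.mpd k)) ((hj.mul hk).sub (hk.mul hj)) hy,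
      mpd_sub (hk.mpd j) (hj.mpd k) hy, mpd_sub (hj.mul hk) (hk.mul hj) hy, mpd_mul hj hk hy,
      mpd_mul hk hj hy]
  rw [key, key, key, curvMat_eq, curvMat_eq, curvMat_eq, mpd_comm (hΓ k) hy j i,
    mpd_comm (hΓ j) hy k i, mpd_comm (hΓ i) hy k j]
  noncomm_ring

theorem curvMat_antisymm (i j : Fin 4) (y : E4) : curvMat G i j y = -curvMat G j i y := by
  rw [curvMat_eq, curvMat_eq]; noncomm_ring

/-- The first Bianchi identity. -/
theorem IsMetricOn.bianchi_one (h : IsMetricOn U G) {y : E4} (hy : y ∈ U) (i j k l : Fin 4) :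
    curvMat G i j y l k + curvMat G j k y l i + curvMat G k i y l j = 0 := by
  have hs : ∀ a i j k, pderiv a (fun z => chrMat G i z k j) y =
      pderiv a (fun z => chrMat G j z k i) y := fun a i j k =>
    pderiv_congr_of_isOpen h.isOpen (fun z hz => h.chrMat_symm hz i j k) hy a
  have hm : ∀ i j k, (chrMat G i y * chrMat G j y) l k = (chrMat G i y * chrMat G k y) l j := by
    intro i j k
    simp only [Matrix.mul_apply]
    exact Finset.sum_congr rfl fun m _ => by rw [h.chrMat_symm hy j k m]
  simp only [curvMat_eq, Matrix.add_apply, Matrix.sub_apply, mpd, Matrix.of_apply]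
  rw [hm i j k, hm j i k, hm k i j, hs i j k l, hs j i k l, hs k i j l]
  ring

/-- The curvature endomorphisms are skew-adjoint. -/
theorem IsMetricOn.curvMat_skew (h : IsMetricOn U G) {y : E4} (hy : y ∈ U) (i j : Fin 4) :
    (curvMat G i j y).transpose * G y + G y * curvMat G i j y = 0 := by
  have hΓ := h.smooth_chrMat
  have key : ∀ i j, mpd i (mpd j G) y =
      ((mpd i (chrMat G j) y).transpose * G y + (chrMat G j y).transpose * mpd i G y) +
      (mpd i G y * chrMat G j y + G y * mpd i (chrMat G j) y) := by
    intro i j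
    rw [mpd_congr_of_isOpen h.isOpen (fun z hz => h.mpd_metric hz j) hy i,
      mpd_add ((hΓ j).transpose.mul h.smooth) (h.smooth.mul (hΓ j)) hy,
      mpd_mul (hΓ j).transpose h.smooth hy, mpd_mul h.smooth (hΓ j) hy, mpd_transpose]
  -- Differentiating metric compatibility once more, the equality of mixed partials of `G` is
  -- exactly the skewness of the curvature.
  have e := mpd_comm h.smooth hy i j
  rw [key, key, h.mpd_metric hy, h.mpd_metric hy] at e
  rw [curvMat_eq]
  simp only [Matrix.transpose_add, Matrix.transpose_sub, Matrix.transpose_mul]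
  rw [← sub_eq_zero] at e
  rw [← e]
  noncomm_ring

end

/-! ### Forms on `ℝ⁴` in components -/

/-- The wedge product of two 2-forms, as the coefficient of the coordinate volume form. -/
def wedge22 (η ζ : Mat) : ℝ :=
  η 0 1 * ζ 2 3 - η 0 2 * ζ 1 3 + η 0 3 * ζ 1 2 + η 1 2 * ζ 0 3 - η 1 3 * ζ 0 2 + η 2 3 * ζ 0 1

/-- The wedge product of a 1-form and a 3-form, as the coefficient of the coordinate volume
form. -/
def wedge13 (x : Fin 4 → ℝ) (ψ : Fin 4 → Fin 4 → Fin 4 → ℝ) : ℝ :=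
  x 0 * ψ 1 2 3 - x 1 * ψ 0 2 3 + x 2 * ψ 0 1 3 - x 3 * ψ 0 1 2

/-- The wedge product of a 1-form and a 2-form at a point. -/
def wedge12 (x : Fin 4 → ℝ) (η : Mat) (i j k : Fin 4) : ℝ :=
  x i * η j k + x j * η k i + x k * η i j

theorem det_four (E : Mat) : E.det =
    E 0 0 * (E 1 1 * (E 2 2 * E 3 3 - E 2 3 * E 3 2) - E 1 2 * (E 2 1 * E 3 3 - E 2 3 * E 3 1)
      + E 1 3 * (E 2 1 * E 3 2 - E 2 2 * E 3 1))
    - E 0 1 * (E 1 0 * (E 2 2 * E 3 3 - E 2 3 * E 3 2) - E 1 2 * (E 2 0 * E 3 3 - E 2 3 * E 3 0)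
      + E 1 3 * (E 2 0 * E 3 2 - E 2 2 * E 3 0))
    + E 0 2 * (E 1 0 * (E 2 1 * E 3 3 - E 2 3 * E 3 1) - E 1 1 * (E 2 0 * E 3 3 - E 2 3 * E 3 0)
      + E 1 3 * (E 2 0 * E 3 1 - E 2 1 * E 3 0))
    - E 0 3 * (E 1 0 * (E 2 1 * E 3 2 - E 2 2 * E 3 1) - E 1 1 * (E 2 0 * E 3 2 - E 2 2 * E 3 0)
      + E 1 2 * (E 2 0 * E 3 1 - E 2 1 * E 3 0)) := by
  rw [Matrix.det_succ_row_zero]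
  simp [Fin.sum_univ_four, Matrix.det_fin_three, Fin.succAbove, Matrix.submatrix]
  ring

theorem skew_apply {η : Mat} (h : η.transpose = -η) (i j : Fin 4) : η i j = -η j i := by
  have := congrFun (congrFun h j) i
  simpa using this

theorem skew_diag {η : Mat} (h : η.transpose = -η) (i : Fin 4) : η i i = 0 := by
  have := skew_apply h i i
  linarith

/-- A linear map acts on 4-forms by its determinant. This makes ratios of 4-forms independent of the
frame or chart. -/
theorem wedge22_pull (E : Mat) {η ζ : Mat} (hη : η.transpose = -η) (hζ : ζ.transpose = -ζ) :
    wedge22 (E.transpose * η * E) (E.transpose * ζ * E) = E.det * wedge22 η ζ := by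
  have e : ∀ {η : Mat}, η.transpose = -η → ∀ a b, (E.transpose * η * E) a b =
      η 0 1 * (E 0 a * E 1 b - E 1 a * E 0 b) + η 0 2 * (E 0 a * E 2 b - E 2 a * E 0 b) +
      η 0 3 * (E 0 a * E 3 b - E 3 a * E 0 b) + η 1 2 * (E 1 a * E 2 b - E 2 a * E 1 b) +
      η 1 3 * (E 1 a * E 3 b - E 3 a * E 1 b) + η 2 3 * (E 2 a * E 3 b - E 3 a * E 2 b) := by
    intro η h a b
    simp only [Matrix.mul_apply, Matrix.transpose_apply, Fin.sum_univ_four, skew_diag h,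
      skew_apply h 1 0, skew_apply h 2 0, skew_apply h 3 0, skew_apply h 2 1, skew_apply h 3 1,
      skew_apply h 3 2]
    ring
  rw [det_four]
  simp only [wedge22, e hη, e hζ]
  generalize η 0 1 = a1; generalize η 0 2 = a2; generalize η 0 3 = a3
  generalize η 1 2 = a4; generalize η 1 3 = a5; generalize η 2 3 = a6
  ring

/-- Three-index components are alternating. -/
structure IsAlt3 (ψ : Fin 4 → Fin 4 → Fin 4 → ℝ) : Prop where
  swap : ∀ i j k, ψ j i k = -ψ i j k
  rot : ∀ i j k, ψ j k i = ψ i j k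

/-- The pullback of a 3-form by a linear map. -/
def pull3 (E : Mat) (ψ : Fin 4 → Fin 4 → Fin 4 → ℝ) (a b c : Fin 4) : ℝ :=
  ∑ i, ∑ j, ∑ k, E i a * E j b * E k c * ψ i j k

theorem IsAlt3.diag {ψ : Fin 4 → Fin 4 → Fin 4 → ℝ} (h : IsAlt3 ψ) (i j : Fin 4) :
    ψ i i j = 0 := by
  have := h.swap i i j; linarith

theorem IsAlt3.diag' {ψ : Fin 4 → Fin 4 → Fin 4 → ℝ} (h : IsAlt3 ψ) (i j : Fin 4) :
    ψ i j j = 0 := by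
  rw [← h.rot, h.diag]

theorem IsAlt3.diag'' {ψ : Fin 4 → Fin 4 → Fin 4 → ℝ} (h : IsAlt3 ψ) (i j : Fin 4) :
    ψ i j i = 0 := by
  rw [← h.rot, h.diag']

theorem IsAlt3.swap' {ψ : Fin 4 → Fin 4 → Fin 4 → ℝ} (h : IsAlt3 ψ) (i j k : Fin 4) :
    ψ i k j = -ψ i j k := by
  rw [← h.rot, h.swap, h.rot, h.rot]

theorem wedge13_pull (E : Mat) (x : Fin 4 → ℝ) {ψ : Fin 4 → Fin 4 → Fin 4 → ℝ} (h : IsAlt3 ψ) :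
    wedge13 (E.transpose.mulVec x) (pull3 E ψ) = E.det * wedge13 x ψ := by
  have e : ∀ a b c, pull3 E ψ a b c =
      ψ 0 1 2 * (E 0 a * (E 1 b * E 2 c - E 2 b * E 1 c) - E 1 a * (E 0 b * E 2 c - E 2 b * E 0 c)
        + E 2 a * (E 0 b * E 1 c - E 1 b * E 0 c)) +
      ψ 0 1 3 * (E 0 a * (E 1 b * E 3 c - E 3 b * E 1 c) - E 1 a * (E 0 b * E 3 c - E 3 b * E 0 c)
        + E 3 a * (E 0 b * E 1 c - E 1 b * E 0 c)) +
      ψ 0 2 3 * (E 0 a * (E 2 b * E 3 c - E 3 b * E 2 c) - E 2 a * (E 0 b * E 3 c - E 3 b * E 0 c)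
        + E 3 a * (E 0 b * E 2 c - E 2 b * E 0 c)) +
      ψ 1 2 3 * (E 1 a * (E 2 b * E 3 c - E 3 b * E 2 c) - E 2 a * (E 1 b * E 3 c - E 3 b * E 1 c)
        + E 3 a * (E 1 b * E 2 c - E 2 b * E 1 c)) := by
    intro a b c
    simp only [pull3, Fin.sum_univ_four, h.diag, h.diag', h.diag'',
      h.swap 0 1, h.swap 0 2, h.swap 0 3, h.swap 1 2, h.swap 1 3, h.swap 2 3,
      h.swap' 0 1 2, h.swap' 0 1 3, h.swap' 0 2 3, h.swap' 1 2 3,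
      h.rot 0 1 2, h.rot 0 1 3, h.rot 0 2 3, h.rot 1 2 3]
    ring
  rw [det_four]
  simp only [wedge13, e, Matrix.mulVec, dotProduct, Matrix.transpose_apply, Fin.sum_univ_four]
  generalize ψ 0 1 2 = a1; generalize ψ 0 1 3 = a2; generalize ψ 0 2 3 = a3
  generalize ψ 1 2 3 = a4
  ring

/-! ### Linear algebra of Hermitian structures on `ℝ⁴` -/

/-- The standard complex structure. -/
def J0 : Mat := !![0, -1, 0, 0; 1, 0, 0, 0; 0, 0, 0, -1; 0, 0, 1, 0]

/-- A unit quaternion structure anticommuting with `J0`. -/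
def N0 : Mat := !![0, 0, -1, 0; 0, 0, 0, 1; 1, 0, 0, 0; 0, -1, 0, 0]

/-- A Hermitian inner product `g` with complex structure `j`. -/
structure IsHerm (g j : Mat) : Prop where
  symm : g.transpose = g
  pos : ∀ v : Fin 4 → ℝ, v ≠ 0 → 0 < v ⬝ᵥ g.mulVec v
  sq : j * j = -1
  orth : j.transpose * g * j = g

/-- `k` is skew-adjoint for `g`. -/
def SkewAdj (g k : Mat) : Prop := k.transpose * g + g * k = 0

section
variable {g j : Mat}

theorem IsHerm.form_symm (h : IsHerm g j) (v w : Fin 4 → ℝ) :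
    v ⬝ᵥ g.mulVec w = w ⬝ᵥ g.mulVec v := by
  conv_lhs => rw [Matrix.dotProduct_mulVec, ← Matrix.mulVec_transpose, h.symm, dotProduct_comm]

theorem IsHerm.skew (h : IsHerm g j) : SkewAdj g j := by
  have := congrArg (· * j) h.orth
  simp only [Matrix.mul_assoc, h.sq] at this
  unfold SkewAdj
  rw [← this]; noncomm_ring

theorem SkewAdj.form {k : Mat} (h : SkewAdj g k) (v w : Fin 4 → ℝ) :
    k.mulVec v ⬝ᵥ g.mulVec w = -(v ⬝ᵥ g.mulVec (k.mulVec w)) := by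
  have e : k.transpose * g = -(g * k) := eq_neg_of_add_eq_zero_left h
  rw [Matrix.mulVec_mulVec, ← Matrix.vecMul_transpose, ← Matrix.dotProduct_mulVec,
    Matrix.mulVec_mulVec, e, Matrix.neg_mulVec, dotProduct_neg]

theorem SkewAdj.form_self (hg : IsHerm g j) {k : Mat} (h : SkewAdj g k) (v : Fin 4 → ℝ) :
    v ⬝ᵥ g.mulVec (k.mulVec v) = 0 := by
  have := h.form v v
  rw [hg.form_symm] at this
  linarith

/-- The matrix with the given columns. -/
def colMat (v : Fin 4 → Fin 4 → ℝ) : Mat := Matrix.of fun i a => v a i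

theorem colMat_gram (g : Mat) (v : Fin 4 → Fin 4 → ℝ) (a b : Fin 4) :
    ((colMat v).transpose * g * colMat v) a b = v a ⬝ᵥ g.mulVec (v b) := by
  rw [Matrix.mul_assoc]
  simp only [Matrix.mul_apply, colMat, Matrix.transpose_apply, Matrix.of_apply, dotProduct,
    Matrix.mulVec]

theorem mul_colMat (k : Mat) (v : Fin 4 → Fin 4 → ℝ) :
    k * colMat v = colMat fun a => k.mulVec (v a) := by
  ext i a; simp [colMat, Matrix.mul_apply, Matrix.mulVec, dotProduct]

/-- The Gram matrix is computed from `j` being skew and orthogonal: only the orthogonality of `w` to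
`v` and to `j v` has to be supplied. -/
theorem IsHerm.frame_of (h : IsHerm g j) {v w : Fin 4 → ℝ} (hv : v ⬝ᵥ g.mulVec v = 1)
    (hw : w ⬝ᵥ g.mulVec w = 1) (hvw : v ⬝ᵥ g.mulVec w = 0)
    (hjvw : j.mulVec v ⬝ᵥ g.mulVec w = 0) :
    (colMat ![v, j.mulVec v, w, j.mulVec w]).transpose * g *
      colMat ![v, j.mulVec v, w, j.mulVec w] = 1 ∧
    j * colMat ![v, j.mulVec v, w, j.mulVec w] = colMat ![v, j.mulVec v, w, j.mulVec w] * J0 := by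
  have hjj : ∀ u, j.mulVec (j.mulVec u) = -u := by
    intro u; rw [Matrix.mulVec_mulVec, h.sq, Matrix.neg_mulVec, Matrix.one_mulVec]
  have s := h.skew
  have e1 : j.mulVec v ⬝ᵥ g.mulVec (j.mulVec v) = 1 := by
    rw [s.form, hjj, Matrix.mulVec_neg, dotProduct_neg, neg_neg, hv]
  have e2 : j.mulVec w ⬝ᵥ g.mulVec (j.mulVec w) = 1 := by
    rw [s.form, hjj, Matrix.mulVec_neg, dotProduct_neg, neg_neg, hw]
  have e3 : j.mulVec v ⬝ᵥ g.mulVec (j.mulVec w) = 0 := by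
    rw [s.form, hjj, Matrix.mulVec_neg, dotProduct_neg, neg_neg, hvw]
  have e4 : v ⬝ᵥ g.mulVec (j.mulVec w) = 0 := by
    have := s.form v w; linarith
  constructor
  · ext a b
    rw [colMat_gram]
    fin_cases a <;> fin_cases b <;>
      simp [-Matrix.mulVec_mulVec, hv, hw, hvw, hjvw, e1, e2, e3, e4, s.form_self h,
        h.form_symm (j.mulVec v) v, h.form_symm (j.mulVec w) v, h.form_symm (j.mulVec w) w,
        h.form_symm (j.mulVec w) (j.mulVec v), h.form_symm w v, h.form_symm w (j.mulVec v)]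
  · rw [mul_colMat]
    ext i a
    fin_cases a <;> simp [colMat, Matrix.mul_apply, Fin.sum_univ_four, J0, hjj,
      -Matrix.mulVec_mulVec]

theorem IsHerm.exists_unit (h : IsHerm g j) {v : Fin 4 → ℝ} (hv : v ≠ 0) :
    ∃ c : ℝ, (c • v) ⬝ᵥ g.mulVec (c • v) = 1 := by
  have hp := h.pos v hv
  refine ⟨(Real.sqrt (v ⬝ᵥ g.mulVec v))⁻¹, ?_⟩
  have hs := Real.mul_self_sqrt hp.le
  have hs0 : Real.sqrt (v ⬝ᵥ g.mulVec v) ≠ 0 := (Real.sqrt_pos.2 hp).ne'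
  rw [Matrix.mulVec_smul, smul_dotProduct, dotProduct_smul, smul_eq_mul, smul_eq_mul]
  field_simp
  nlinarith

theorem IsHerm.exists_frame (h : IsHerm g j) :
    ∃ E : Mat, E.transpose * g * E = 1 ∧ j * E = E * J0 := by
  obtain ⟨c, hc⟩ := h.exists_unit (v := Pi.single 0 1) (by
    intro h0; have := congrFun h0 0; simp at this)
  set v : Fin 4 → ℝ := c • Pi.single 0 1
  obtain ⟨w, hw0, hw⟩ : ∃ w : Fin 4 → ℝ, w ≠ 0 ∧
      v ⬝ᵥ g.mulVec w = 0 ∧ j.mulVec v ⬝ᵥ g.mulVec w = 0 := by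
    let f : (Fin 4 → ℝ) →ₗ[ℝ] (Fin 2 → ℝ) :=
      Matrix.mulVecLin (Matrix.of ![Matrix.vecMul v g, Matrix.vecMul (j.mulVec v) g])
    -- Two linear conditions on a space of dimension four have a nonzero common solution.
    have hk : LinearMap.ker f ≠ ⊥ := LinearMap.ker_ne_bot_of_finrank_lt (by simp)
    obtain ⟨w, hw, hw0⟩ := Submodule.exists_mem_ne_zero_of_ne_bot hk
    refine ⟨w, hw0, ?_, ?_⟩
    · have := congrFun (LinearMap.mem_ker.1 hw) 0
      rw [Matrix.dotProduct_mulVec]; exact this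
    · have := congrFun (LinearMap.mem_ker.1 hw) 1
      rw [Matrix.dotProduct_mulVec]; exact this
  obtain ⟨d, hd⟩ := h.exists_unit hw0
  refine ⟨_, h.frame_of hc hd ?_ ?_⟩
  · rw [Matrix.mulVec_smul g d w, dotProduct_smul, hw.1, smul_zero]
  · rw [Matrix.mulVec_smul g d w, dotProduct_smul, hw.2, smul_zero]

/-- The second unit vector of the unitary frame can be taken to be `n v`: it is orthogonal to `v`
since `n` is skew, and to `j v` since `j n` is skew. In the resulting basis `n` has the matrix `N0`.
-/
theorem IsHerm.exists_frame_quaternion (h : IsHerm g j) {n : Mat} (hn : SkewAdj g n)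
    (hnj : n * j = -(j * n)) (hnn : n * n = -1) :
    ∃ E : Mat, E.transpose * g * E = 1 ∧ j * E = E * J0 ∧ n * E = E * N0 := by
  obtain ⟨c, hc⟩ := h.exists_unit (v := Pi.single 0 1) (by
    intro h0; have := congrFun h0 0; simp at this)
  set v : Fin 4 → ℝ := c • Pi.single 0 1
  have hnn' : ∀ u, n.mulVec (n.mulVec u) = -u := by
    intro u; rw [Matrix.mulVec_mulVec, hnn, Matrix.neg_mulVec, Matrix.one_mulVec]
  have hnj' : ∀ u, n.mulVec (j.mulVec u) = -j.mulVec (n.mulVec u) := by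
    intro u
    rw [Matrix.mulVec_mulVec, hnj, Matrix.neg_mulVec, Matrix.mulVec_mulVec]
  have hnw : n.mulVec v ⬝ᵥ g.mulVec (n.mulVec v) = 1 := by
    rw [hn.form, hnn', Matrix.mulVec_neg, dotProduct_neg, neg_neg, hc]
  have hjn : SkewAdj g (j * n) := by
    have a : j.transpose * g = -(g * j) := eq_neg_of_add_eq_zero_left h.skew
    have b : n.transpose * g = -(g * n) := eq_neg_of_add_eq_zero_left hn
    unfold SkewAdj
    rw [Matrix.transpose_mul, Matrix.mul_assoc, a, Matrix.mul_neg, ← Matrix.mul_assoc, b,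
      Matrix.neg_mul, Matrix.mul_assoc, hnj]
    simp
  have h4 : j.mulVec v ⬝ᵥ g.mulVec (n.mulVec v) = 0 := by
    rw [h.skew.form, Matrix.mulVec_mulVec v j n, hjn.form_self h, neg_zero]
  obtain ⟨h1, h2⟩ := h.frame_of hc hnw (hn.form_self h v) h4
  refine ⟨_, h1, h2, ?_⟩
  rw [mul_colMat]
  ext i a
  fin_cases a <;>
    simp [colMat, Matrix.mul_apply, Fin.sum_univ_four, N0, hnn', hnj',
      -Matrix.mulVec_mulVec, Matrix.mulVec_neg]

end

/-- A quaternionic companion of `j`. -/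
structure IsQuat (g j n : Mat) : Prop where
  skew : SkewAdj g n
  anti : n * j = -(j * n)
  sq : n * n = -1

/-! ### The plane of skew-adjoint endomorphisms anticommuting with `j` -/

section
variable {g j : Mat}

theorem frame_inv {E : Mat} (hE : E.transpose * g * E = 1) :
    E * (E.transpose * g) = 1 ∧ E.det ≠ 0 := by
  have h1 : E * (E.transpose * g) = 1 := mul_eq_one_comm.1 hE
  refine ⟨h1, fun h0 => ?_⟩
  have := congrArg Matrix.det h1
  rw [Matrix.det_mul, h0, Matrix.det_one] at this
  simp at this

/-- In a unitary frame the skew matrices anticommuting with `J0` form the plane spanned by `N0` and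
`J0 N0`. Being two-dimensional is the special feature of real dimension four behind all the
commutator formulas below. -/
theorem IsHerm.exists_companion (h : IsHerm g j) : ∃ n, IsQuat g j n ∧
    ∀ k, SkewAdj g k → k * j = -(j * k) → ∃ x y : ℝ, k = x • n + y • (j * n) := by
  obtain ⟨E, hE, hj⟩ := h.exists_frame
  obtain ⟨hE', -⟩ := frame_inv hE
  obtain ⟨F, hF⟩ : ∃ F, F = E.transpose * g := ⟨_, rfl⟩
  rw [← hF] at hE hE'
  have hN0 : N0 * N0 = -1 := by
    ext a b; fin_cases a <;> fin_cases b <;> simp [N0, Matrix.mul_apply, Fin.sum_univ_four]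
  have hNJ : N0 * J0 = -(J0 * N0) := by
    ext a b; fin_cases a <;> fin_cases b <;> simp [N0, J0, Matrix.mul_apply, Fin.sum_univ_four]
  have hNt : N0.transpose = -N0 := by
    ext a b; fin_cases a <;> fin_cases b <;> simp [N0]
  have hj' : F * j = J0 * F := by
    calc F * j = F * j * (E * F) := by rw [hE', Matrix.mul_one]
      _ = F * (j * E) * F := by noncomm_ring
      _ = F * E * J0 * F := by rw [hj]; noncomm_ring
      _ = J0 * F := by rw [hE, Matrix.one_mul]
  have hFt : F.transpose = g * E := by
    rw [hF, Matrix.transpose_mul, Matrix.transpose_transpose, h.symm]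
  have hgE : g * E * F = g := by rw [Matrix.mul_assoc, hE', Matrix.mul_one]
  have hFF : F.transpose * E.transpose = 1 := by
    rw [← Matrix.transpose_mul, hE', Matrix.transpose_one]
  refine ⟨E * N0 * F, ⟨?_, ?_, ?_⟩, ?_⟩
  · unfold SkewAdj
    have e1 : (E * N0 * F).transpose * g = g * E * N0.transpose * (E.transpose * g) := by
      rw [Matrix.transpose_mul, Matrix.transpose_mul, hFt]; noncomm_ring
    rw [e1, hNt, ← hF]; noncomm_ring
  · calc E * N0 * F * j = E * N0 * (F * j) := by noncomm_ring
      _ = E * (N0 * J0) * F := by rw [hj']; noncomm_ring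
      _ = -(E * J0 * (N0 * F)) := by rw [hNJ]; noncomm_ring
      _ = -(j * (E * N0 * F)) := by rw [← hj]; noncomm_ring
  · calc E * N0 * F * (E * N0 * F) = E * N0 * (F * E) * (N0 * F) := by noncomm_ring
      _ = E * (N0 * N0) * F := by rw [hE]; noncomm_ring
      _ = -(E * F) := by rw [hN0]; noncomm_ring
      _ = -1 := by rw [hE']
  · intro k hk hkj
    set k' := F * k * E with hk'
    have hkk : k = E * k' * F := by
      calc k = E * F * k * (E * F) := by rw [hE']; simp
        _ = _ := by rw [hk']; noncomm_ring
    have hskew : k'.transpose = -k' := by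
      have e : k.transpose * g = -(g * k) := eq_neg_of_add_eq_zero_left hk
      calc k'.transpose = E.transpose * (k.transpose * g) * E := by
            rw [hk', Matrix.transpose_mul, Matrix.transpose_mul, hFt]; noncomm_ring
        _ = -k' := by rw [e, hk', hF]; noncomm_ring
    have hanti : k' * J0 = -(J0 * k') := by
      calc k' * J0 = F * k * (E * J0) := by rw [hk']; noncomm_ring
        _ = F * (k * j) * E := by rw [← hj]; noncomm_ring
        _ = -(F * j * k * E) := by rw [hkj]; noncomm_ring
        _ = _ := by rw [hj', hk']; noncomm_ring
    have hform : k' = k' 2 0 • N0 + k' 3 0 • (J0 * N0) := by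
      have s := fun a b => skew_apply hskew a b
      have d := fun a => skew_diag hskew a
      have A := fun a b => congrFun (congrFun hanti a) b
      have a01 := A 1 1
      have a1 := A 2 0
      have a2 := A 3 0
      have a3 := A 3 3
      have a4 := A 2 1
      simp only [Matrix.mul_apply, Matrix.neg_apply, Fin.sum_univ_four] at a01 a1 a2 a3 a4
      simp [J0, d] at a01 a1 a2 a3 a4
      have s01 := s 0 1
      have s02 := s 0 2
      have s03 := s 0 3
      have s12 := s 1 2
      have s13 := s 1 3
      have s23 := s 2 3
      ext a b
      fin_cases a <;> fin_cases b <;>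
        simp only [Matrix.mul_apply, Matrix.add_apply, Matrix.smul_apply, Fin.sum_univ_four] <;>
        simp [N0, J0, d] <;> linarith
    refine ⟨k' 2 0, k' 3 0, ?_⟩
    conv_lhs => rw [hkk, hform]
    calc E * (k' 2 0 • N0 + k' 3 0 • (J0 * N0)) * F
        = k' 2 0 • (E * N0 * F) + k' 3 0 • (E * J0 * N0 * F) := by
          simp only [Matrix.mul_add, Matrix.add_mul, Matrix.mul_smul, Matrix.smul_mul,
            Matrix.mul_assoc]
      _ = _ := by rw [← hj]; simp only [Matrix.mul_assoc]

theorem trace_skewAdj (hg : IsHerm g j) {k : Mat} (hk : SkewAdj g k) : k.trace = 0 := by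
  obtain ⟨E, hE, -⟩ := hg.exists_frame
  obtain ⟨hE', -⟩ := frame_inv hE
  have e : k.transpose * g = -(g * k) := eq_neg_of_add_eq_zero_left hk
  have h1 : k.trace = (E.transpose * (g * k) * E).trace := by
    rw [Matrix.trace_mul_comm, ← Matrix.mul_assoc, ← Matrix.mul_assoc, Matrix.mul_assoc E, hE',
      Matrix.one_mul]
  have h2 : k.trace = (E.transpose * (k.transpose * g) * E).trace := by
    rw [h1, ← Matrix.trace_transpose]
    simp only [Matrix.transpose_mul, Matrix.transpose_transpose, hg.symm, Matrix.mul_assoc]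
  rw [e, Matrix.mul_neg, Matrix.neg_mul, Matrix.trace_neg, ← h1] at h2
  linarith

theorem trace_anti (hg : IsHerm g j) {k : Mat} (hkj : k * j = -(j * k)) : k.trace = 0 := by
  have h1 : k = j * k * j := by
    rw [Matrix.mul_assoc, hkj, Matrix.mul_neg, ← Matrix.mul_assoc, hg.sq]; simp
  have h2 : (j * k * j).trace = -k.trace := by
    rw [Matrix.trace_mul_comm, ← Matrix.mul_assoc, hg.sq]; simp
  rw [← h1] at h2; linarith

theorem IsQuat.jn_sq (hg : IsHerm g j) {n : Mat} (hn : IsQuat g j n) :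
    (j * n) * (j * n) = -1 := by
  calc (j * n) * (j * n) = j * (n * j) * n := by noncomm_ring
    _ = -(j * j) * (n * n) := by rw [hn.anti]; noncomm_ring
    _ = -1 := by rw [hg.sq, hn.sq]; noncomm_ring

theorem trace_neg_one : (-1 : Mat).trace = -4 := by simp [Matrix.trace]

theorem trace_one_four : (1 : Mat).trace = 4 := by simp [Matrix.trace]

/-- Skew-adjoint endomorphisms anticommuting with `j` in terms of a companion. -/
theorem IsQuat.decomp (hg : IsHerm g j) {n : Mat} (hn : IsQuat g j n) {k : Mat}
    (hk : SkewAdj g k) (hkj : k * j = -(j * k)) :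
    k = (-(1 / 4 : ℝ) * (k * n).trace) • n + (-(1 / 4 : ℝ) * (k * (j * n)).trace) • (j * n) := by
  obtain ⟨m, hm, H⟩ := hg.exists_companion
  obtain ⟨a, b, hab⟩ := H n hn.skew hn.anti
  obtain ⟨x, y, hxy⟩ := H k hk hkj
  have jm2 := hm.jn_sq hg
  have mjm : m * (j * m) = j := by
    rw [← Matrix.mul_assoc, hm.anti, Matrix.neg_mul, Matrix.mul_assoc, hm.sq]; simp
  have jmm : j * m * m = -j := by rw [Matrix.mul_assoc, hm.sq]; simp
  have jjm : j * (j * m) = -m := by rw [← Matrix.mul_assoc, hg.sq]; simp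
  have tj : j.trace = 0 := trace_skewAdj hg hg.skew
  have hjn : j * n = a • (j * m) - b • m := by
    rw [hab, Matrix.mul_add, Matrix.mul_smul, Matrix.mul_smul, jjm, smul_neg, sub_eq_add_neg]
  -- The condition `n² = -1` puts `n` on the unit circle of the plane, so `(n, j n)` arises from
  -- `(m, j m)` by a rotation.
  have hsum : a * a + b * b = 1 := by
    have h1 : (n * n).trace = -4 := by rw [hn.sq, trace_neg_one]
    rw [hab] at h1
    simp only [Matrix.mul_add, Matrix.add_mul, Matrix.mul_smul, Matrix.smul_mul, hm.sq, mjm, jmm,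
      jm2, Matrix.trace_add, Matrix.trace_smul, Matrix.trace_neg, tj, trace_one_four,
      smul_eq_mul] at h1
    linarith
  have t1 : (k * n).trace = -4 * (x * a + y * b) := by
    rw [hab, hxy]
    simp only [Matrix.mul_add, Matrix.add_mul, Matrix.mul_smul, Matrix.smul_mul, hm.sq, mjm, jmm,
      jm2, Matrix.trace_add, Matrix.trace_smul, Matrix.trace_neg, tj, trace_one_four,
      smul_eq_mul]
    ring
  have t2 : (k * (j * n)).trace = -4 * (y * a - x * b) := by
    rw [hjn, hxy]
    simp only [Matrix.mul_sub, Matrix.add_mul, Matrix.mul_smul, Matrix.smul_mul, hm.sq, mjm, jmm,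
      jm2, Matrix.trace_add, Matrix.trace_sub, Matrix.trace_smul, Matrix.trace_neg, tj,
      trace_one_four, smul_eq_mul]
    ring
  rw [t1, t2, hjn, hab, hxy]
  have h1 : x = (x * a + y * b) * a - (y * a - x * b) * b := by
    linear_combination (-x) * hsum
  have h2 : y = (x * a + y * b) * b + (y * a - x * b) * a := by
    linear_combination (-y) * hsum
  conv_lhs => rw [h1, h2]
  module

/-- The commutator of two skew-adjoint endomorphisms anticommuting with `j`. -/
theorem IsHerm.commutator (hg : IsHerm g j) {k l : Mat} (hk : SkewAdj g k)
    (hkj : k * j = -(j * k)) (hl : SkewAdj g l) (hlj : l * j = -(j * l)) :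
    k * l - l * k = (-(1 / 2 : ℝ) * (j * k * l).trace) • j := by
  obtain ⟨m, hm, H⟩ := hg.exists_companion
  obtain ⟨a, b, rfl⟩ := H l hl hlj
  obtain ⟨x, y, rfl⟩ := H k hk hkj
  have jm2 := hm.jn_sq hg
  have mjm : m * (j * m) = j := by
    rw [← Matrix.mul_assoc, hm.anti, Matrix.neg_mul, Matrix.mul_assoc, hm.sq]; simp
  have jmm : j * m * m = -j := by rw [Matrix.mul_assoc, hm.sq]; simp
  have jjm : j * (j * m) = -m := by rw [← Matrix.mul_assoc, hg.sq]; simp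
  have tj : j.trace = 0 := trace_skewAdj hg hg.skew
  have e : ∀ x y a b : ℝ, (x • m + y • (j * m)) * (a • m + b • (j * m)) =
      (-(x * a + y * b)) • (1 : Mat) + (x * b - y * a) • j := by
    intro x y a b
    simp only [Matrix.mul_add, Matrix.add_mul, Matrix.mul_smul, Matrix.smul_mul, hm.sq, mjm, jmm,
      jm2]
    module
  rw [Matrix.mul_assoc, e, e, Matrix.mul_add, Matrix.mul_smul, Matrix.mul_smul, hg.sq,
    Matrix.mul_one, Matrix.trace_add, Matrix.trace_smul, Matrix.trace_smul, tj, Matrix.trace_neg, trace_one_four]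
  simp only [smul_eq_mul]
  module

/-- The square of a skew-adjoint endomorphism anticommuting with `j`. -/
theorem IsHerm.sq_anti (hg : IsHerm g j) {k : Mat} (hk : SkewAdj g k)
    (hkj : k * j = -(j * k)) :
    k * k = ((1 / 4 : ℝ) * (k * k).trace) • (1 : Mat) ∧ (k * k).trace ≤ 0 ∧
      ((k * k).trace = 0 → k = 0) := by
  obtain ⟨m, hm, H⟩ := hg.exists_companion
  obtain ⟨x, y, rfl⟩ := H k hk hkj
  have jm2 := hm.jn_sq hg
  have mjm : m * (j * m) = j := by
    rw [← Matrix.mul_assoc, hm.anti, Matrix.neg_mul, Matrix.mul_assoc, hm.sq]; simp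
  have jmm : j * m * m = -j := by rw [Matrix.mul_assoc, hm.sq]; simp
  have e : (x • m + y • (j * m)) * (x • m + y • (j * m)) =
      (x * x + y * y) • (-1 : Mat) := by
    simp only [Matrix.mul_add, Matrix.add_mul, Matrix.mul_smul, Matrix.smul_mul, hm.sq, mjm, jmm,
      jm2]
    module
  rw [e, Matrix.trace_smul, trace_neg_one, smul_eq_mul]
  refine ⟨by module, by nlinarith [mul_self_nonneg x, mul_self_nonneg y], fun h => ?_⟩
  have hx : x = 0 := by nlinarith [mul_self_nonneg x, mul_self_nonneg y]
  have hy : y = 0 := by nlinarith [mul_self_nonneg x, mul_self_nonneg y]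
  rw [hx, hy]; simp

/-- The commutator of a skew-adjoint endomorphism commuting with `j` and one anticommuting
with `j`. -/
theorem IsHerm.commutator_mixed (hg : IsHerm g j) {r k : Mat} (hr : SkewAdj g r)
    (hrj : r * j = j * r) (hk : SkewAdj g k) (hkj : k * j = -(j * k)) :
    r * k - k * r = (-(1 / 2 : ℝ) * (j * r).trace) • (j * k) := by
  -- The commutator `[r, n]` lies in the same plane, and `tr ([r, n] n) = 0` leaves only its `j n`
  -- component, read off from a second trace. The general `k` follows because `r` commutes with `j`.
  have main : ∀ n, IsQuat g j n →
      r * n - n * r = (-(1 / 2 : ℝ) * (j * r).trace) • (j * n) := by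
    intro n hn
    have a : r.transpose * g = -(g * r) := eq_neg_of_add_eq_zero_left hr
    have b : n.transpose * g = -(g * n) := eq_neg_of_add_eq_zero_left hn.skew
    have hs : SkewAdj g (r * n - n * r) := by
      unfold SkewAdj
      rw [Matrix.transpose_sub, Matrix.transpose_mul, Matrix.transpose_mul, Matrix.sub_mul,
        Matrix.mul_assoc, Matrix.mul_assoc, a, b, Matrix.mul_neg, Matrix.mul_neg,
        ← Matrix.mul_assoc, ← Matrix.mul_assoc, a, b]
      noncomm_ring
    have ha : (r * n - n * r) * j = -(j * (r * n - n * r)) := by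
      calc (r * n - n * r) * j = r * (n * j) - n * (r * j) := by noncomm_ring
        _ = -(r * j * n) - n * j * r := by
          rw [Matrix.mul_assoc n j r, ← hrj, hn.anti, Matrix.mul_neg, Matrix.mul_assoc r j n]
        _ = -(j * (r * n - n * r)) := by rw [hn.anti, hrj]; noncomm_ring
    have t1 : ((r * n - n * r) * n).trace = 0 := by
      rw [Matrix.sub_mul, Matrix.trace_sub, Matrix.mul_assoc n, Matrix.trace_mul_comm n, sub_self]
    have t2 : ((r * n - n * r) * (j * n)).trace = 2 * (j * r).trace := by
      have u1 : r * n * (j * n) = r * j := by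
        calc r * n * (j * n) = r * (n * j) * n := by noncomm_ring
          _ = -(r * j * (n * n)) := by rw [hn.anti]; noncomm_ring
          _ = _ := by rw [hn.sq]; noncomm_ring
      have u2 : (n * r * (j * n)).trace = -(r * j).trace := by
        rw [Matrix.mul_assoc, Matrix.trace_mul_comm n, ← Matrix.mul_assoc, Matrix.mul_assoc _ n n,
          hn.sq, Matrix.mul_neg, Matrix.mul_one, Matrix.trace_neg]
      rw [Matrix.sub_mul, Matrix.trace_sub, u1, u2, Matrix.trace_mul_comm r]; ring
    have := hn.decomp hg hs ha
    rw [t1, t2] at this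
    rw [this]; module
  obtain ⟨m, hm, H⟩ := hg.exists_companion
  obtain ⟨x, y, rfl⟩ := H k hk hkj
  have h1 := main m hm
  calc r * (x • m + y • (j * m)) - (x • m + y • (j * m)) * r
      = x • (r * m - m * r) + y • (r * j * m - j * (m * r)) := by
        simp only [Matrix.mul_add, Matrix.add_mul, Matrix.mul_smul, Matrix.smul_mul,
          Matrix.mul_assoc, smul_sub]; abel
    _ = x • (r * m - m * r) + y • (j * (r * m - m * r)) := by
        rw [hrj, Matrix.mul_sub, Matrix.mul_assoc]
    _ = _ := by
        rw [h1, Matrix.mul_smul, Matrix.mul_add, Matrix.mul_smul, Matrix.mul_smul]; module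

end

/-- An algebraic curvature tensor commuting with `j`, in mixed components
`R(∂_i, ∂_j) = R i j`. -/
structure IsCurvJ (g j : Mat) (R : Fin 4 → Fin 4 → Mat) : Prop where
  antisymm : ∀ a b, R a b = -R b a
  skew : ∀ a b, SkewAdj g (R a b)
  bianchi : ∀ a b c d, R a b d c + R b c d a + R c a d b = 0
  comm : ∀ a b, R a b * j = j * R a b

/-- The form `tr (j R(X, Y))`, a multiple of the Ricci form. -/
def ricForm (j : Mat) (R : Fin 4 → Fin 4 → Mat) : Mat := Matrix.of fun a b => (j * R a b).trace

/-- The scalar curvature of an algebraic curvature tensor. -/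
def scalAlg (g : Mat) (R : Fin 4 → Fin 4 → Mat) : ℝ :=
  ∑ j, ∑ k, g⁻¹ j k * ∑ i, R i j i k

/-- The components of a curvature tensor in another basis. -/
def pullCurv (F E : Mat) (R : Fin 4 → Fin 4 → Mat) (a b : Fin 4) : Mat :=
  F * (∑ i, ∑ l, (E i a * E l b) • R i l) * E

/-! ### Algebraic curvature tensors commuting with `j` and their Ricci form -/

section
variable {g j : Mat} {R : Fin 4 → Fin 4 → Mat}

theorem ricForm_pull {F E j' : Mat} (hj : j' * F = F * j) (hE : E * F = 1) :
    ricForm j' (pullCurv F E R) = E.transpose * ricForm j R * E := by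
  ext a b
  have e : (j' * pullCurv F E R a b).trace = ∑ i, ∑ l, (E i a * E l b) * (j * R i l).trace := by
    have : j' * pullCurv F E R a b = F * (j * (∑ i, ∑ l, (E i a * E l b) • R i l) * E) := by
      rw [pullCurv, ← Matrix.mul_assoc, ← Matrix.mul_assoc, hj]; noncomm_ring
    rw [this, Matrix.trace_mul_comm, Matrix.mul_assoc _ E, hE, Matrix.mul_one, Finset.mul_sum,
      Matrix.trace_sum]
    refine Finset.sum_congr rfl fun i _ => ?_
    rw [Finset.mul_sum, Matrix.trace_sum]
    refine Finset.sum_congr rfl fun l _ => ?_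
    rw [Matrix.mul_smul, Matrix.trace_smul, smul_eq_mul]
  simp only [ricForm, Matrix.of_apply, e, Matrix.mul_apply, Matrix.transpose_apply,
    Finset.sum_mul]
  rw [Finset.sum_comm]
  exact Finset.sum_congr rfl fun _ _ => Finset.sum_congr rfl fun _ _ => by ring

/-- For an orthonormal frame `g⁻¹ = E Eᵀ`, so contraction with the inverse metric becomes a plain
trace. -/
theorem scalAlg_pull {F E : Mat} (hF : F = E.transpose * g) (hE : E * F = 1) :
    scalAlg g R = ∑ a, ∑ c, pullCurv F E R a c a c := by
  have hg : g⁻¹ = E * E.transpose := by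
    refine Matrix.inv_eq_left_inv ?_
    rw [Matrix.mul_assoc, ← hF, hE]
  have h1 : ∀ c, ∑ a, pullCurv F E R a c a c = ∑ l, ∑ i, ∑ n, E l c * (R i l i n * E n c) := by
    intro c
    have e1 : ∀ a, pullCurv F E R a c a c =
        ∑ l, ∑ i, E l c * (E i a * (F * (R i l * E)) a c) := by
      intro a
      simp only [pullCurv, Finset.mul_sum, Finset.sum_mul, Matrix.sum_apply, Matrix.mul_smul,
        Matrix.smul_mul, Matrix.smul_apply, smul_eq_mul, ← Matrix.mul_assoc]
      rw [Finset.sum_comm]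
      exact Finset.sum_congr rfl fun _ _ => Finset.sum_congr rfl fun _ _ => by ring
    simp only [e1]
    rw [Finset.sum_comm]
    refine Finset.sum_congr rfl fun l _ => ?_
    rw [Finset.sum_comm]
    refine Finset.sum_congr rfl fun i _ => ?_
    rw [← Finset.mul_sum, ← Finset.mul_sum]
    congr 1
    rw [← Matrix.mul_apply (M := R i l), ← Matrix.mul_apply (M := E), ← Matrix.mul_assoc, hE,
      Matrix.one_mul]
  calc scalAlg g R = ∑ l, ∑ n, ∑ c, ∑ i, E l c * (R i l i n * E n c) := by
        simp only [scalAlg, hg, Matrix.mul_apply, Matrix.transpose_apply, Finset.sum_mul,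
          Finset.mul_sum]
        refine Finset.sum_congr rfl fun _ _ => Finset.sum_congr rfl fun _ _ => ?_
        rw [Finset.sum_comm]
        exact Finset.sum_congr rfl fun _ _ => Finset.sum_congr rfl fun _ _ => by ring
    _ = ∑ c, ∑ a, pullCurv F E R a c a c := by
        simp only [h1]
        rw [Finset.sum_comm_cycle]
        refine Finset.sum_congr rfl fun c _ => Finset.sum_congr rfl fun l _ => ?_
        rw [Finset.sum_comm]
    _ = _ := Finset.sum_comm

theorem IsCurvJ.pull {F E j' g' : Mat} (h : IsCurvJ g j R) (hE : E * F = 1)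
    (hj : j' * F = F * j) (hg : E.transpose * g * E = g') :
    IsCurvJ g' j' (pullCurv F E R) := by
  have hFE : F * E = 1 := mul_eq_one_comm.1 hE
  set S : Fin 4 → Fin 4 → Mat := fun a b => ∑ i, ∑ l, (E i a * E l b) • R i l with hS
  have hP : ∀ a b, pullCurv F E R a b = F * S a b * E := fun a b => rfl
  have hjE : E * j' = j * E := by
    calc E * j' = E * (j' * F) * E := by
          rw [Matrix.mul_assoc, Matrix.mul_assoc, hFE, Matrix.mul_one]
      _ = E * F * j * E := by rw [hj, ← Matrix.mul_assoc]
      _ = _ := by rw [hE, Matrix.one_mul]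
  refine ⟨?_, ?_, ?_, ?_⟩
  · intro a b
    have : S a b = -S b a := by
      simp only [hS, ← Finset.sum_neg_distrib]
      rw [Finset.sum_comm]
      refine Finset.sum_congr rfl fun _ _ => Finset.sum_congr rfl fun _ _ => ?_
      rw [h.antisymm, smul_neg, mul_comm]
    rw [hP, hP, this]; noncomm_ring
  · intro a b
    have hs : SkewAdj g (S a b) := by
      simp only [SkewAdj, hS, Matrix.transpose_sum, Finset.sum_mul, Finset.mul_sum,
        Matrix.transpose_smul, Matrix.smul_mul, Matrix.mul_smul, ← Finset.sum_add_distrib,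
        ← smul_add]
      refine Finset.sum_eq_zero fun _ _ => Finset.sum_eq_zero fun _ _ => ?_
      rw [h.skew, smul_zero]
    have hFg : F.transpose * g' = g * E := by
      rw [← hg, ← Matrix.mul_assoc, ← Matrix.mul_assoc, ← Matrix.transpose_mul, hE]; simp
    have hgF : g' * F = E.transpose * g := by
      rw [← hg, Matrix.mul_assoc, hE]; simp
    unfold SkewAdj at hs ⊢
    calc (pullCurv F E R a b).transpose * g' + g' * pullCurv F E R a b
        = E.transpose * (S a b).transpose * (F.transpose * g') + g' * F * S a b * E := by
          rw [hP, Matrix.transpose_mul, Matrix.transpose_mul]; noncomm_ring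
      _ = E.transpose * ((S a b).transpose * g + g * S a b) * E := by
          rw [hFg, hgF]; noncomm_ring
      _ = 0 := by rw [hs]; simp
  · intro a b c d
    have hT : ∀ a b c m, (S a b * E) m c =
        ∑ i, ∑ l, ∑ n, E i a * E l b * E n c * R i l m n := by
      intro a b c m
      simp only [hS, Matrix.mul_apply, Matrix.sum_apply, Matrix.smul_apply, smul_eq_mul,
        Finset.sum_mul]
      rw [Finset.sum_comm]
      refine Finset.sum_congr rfl fun _ _ => ?_
      rw [Finset.sum_comm]
      exact Finset.sum_congr rfl fun _ _ => Finset.sum_congr rfl fun _ _ => by ring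
    have hz : ∀ m, (S a b * E) m c + (S b c * E) m a + (S c a * E) m b = 0 := by
      intro m
      have e2 : (S b c * E) m a = ∑ i, ∑ l, ∑ n, E i a * E l b * E n c * R l n m i := by
        rw [hT, Finset.sum_comm_cycle]
        exact Finset.sum_congr rfl fun _ _ => Finset.sum_congr rfl fun _ _ =>
          Finset.sum_congr rfl fun _ _ => by ring
      have e3 : (S c a * E) m b = ∑ i, ∑ l, ∑ n, E i a * E l b * E n c * R n i m l := by
        rw [hT, ← Finset.sum_comm_cycle]
        exact Finset.sum_congr rfl fun _ _ => Finset.sum_congr rfl fun _ _ =>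
          Finset.sum_congr rfl fun _ _ => by ring
      rw [hT, e2, e3]
      simp only [← Finset.sum_add_distrib, ← mul_add, h.bianchi, mul_zero, Finset.sum_const_zero]
    simp only [hP, Matrix.mul_assoc]
    rw [Matrix.mul_apply, Matrix.mul_apply (M := F) (N := S b c * E),
      Matrix.mul_apply (M := F) (N := S c a * E), ← Finset.sum_add_distrib,
      ← Finset.sum_add_distrib]
    exact Finset.sum_eq_zero fun m _ => by rw [← mul_add, ← mul_add, hz, mul_zero]
  · intro a b
    have hs : S a b * j = j * S a b := by
      simp only [hS, Finset.sum_mul, Finset.mul_sum, Matrix.smul_mul, Matrix.mul_smul, h.comm]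
    rw [hP]
    calc F * S a b * E * j' = F * (S a b * j) * E := by
          rw [Matrix.mul_assoc _ E, hjE]; noncomm_ring
      _ = F * j * S a b * E := by rw [hs]; noncomm_ring
      _ = _ := by rw [← hj]; noncomm_ring

/-- Commuting with `J0` makes `R` invariant in its last two slots, and the pair symmetry carries
this over to the first two; hence the Ricci form is `J0`-invariant. The first Bianchi identity
disposes of the remaining mixed component in the scalar curvature. -/
theorem IsCurvJ.standard (h : IsCurvJ 1 J0 R) :
    ricForm J0 R 0 2 = ricForm J0 R 1 3 ∧ ricForm J0 R 0 3 = -ricForm J0 R 1 2 ∧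
      ∑ a, ∑ c, R a c a c = ricForm J0 R 0 1 + ricForm J0 R 2 3 := by
  have sk : ∀ a b c d, R a b c d = -R a b d c := by
    intro a b c d
    have := congrFun (congrFun (h.skew a b) d) c
    simp at this
    linarith
  have an : ∀ a b c d, R a b c d = -R b a c d := by
    intro a b c d
    rw [h.antisymm a b]; rfl
  -- The classical octahedron argument: the pair symmetry is a combination of four first Bianchi
  -- identities.
  have ps : ∀ a b c d, R a b c d = R c d a b := by
    intro a b c d
    have b1 := h.bianchi a b c d
    have b2 := h.bianchi b c d a
    have b3 := h.bianchi c d a b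
    have b4 := h.bianchi d a b c
    have := sk a b c d
    have := sk b c a d
    have := sk c a b d
    have := sk c d a b
    have := sk d b a c
    have := sk b c d a
    have := sk d a b c
    have := sk a c b d
    have := sk c d b a
    have := sk a b d c
    have := sk b d c a
    have := sk d a c b
    have := an c a b d
    have := an a c b d
    have := an d b a c
    have := an b d c a
    have := an b d a c
    have := an a c d b
    linarith
  have q1 : ∀ a b, R a b 0 2 = R a b 1 3 := by
    intro a b
    have := congrFun (congrFun (h.comm a b) 0) 3
    simp only [Matrix.mul_apply, Fin.sum_univ_four] at this
    simp [J0] at this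
    linarith
  have q2 : ∀ a b, R a b 0 3 = -R a b 1 2 := by
    intro a b
    have := congrFun (congrFun (h.comm a b) 0) 2
    simp only [Matrix.mul_apply, Fin.sum_univ_four] at this
    simp [J0] at this
    linarith
  have tr : ∀ a b, ricForm J0 R a b = 2 * (R a b 0 1 + R a b 2 3) := by
    intro a b
    have h1 := sk a b 1 0
    have h2 := sk a b 3 2
    simp only [ricForm, Matrix.of_apply, Matrix.trace, Matrix.diag, Matrix.mul_apply,
      Fin.sum_univ_four]
    simp [J0]
    linarith
  refine ⟨?_, ?_, ?_⟩
  · rw [tr, tr, ps 0 2 0 1, ps 0 2 2 3, ps 1 3 0 1, ps 1 3 2 3, q1, q1]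
  · rw [tr, tr, ps 0 3 0 1, ps 0 3 2 3, ps 1 2 0 1, ps 1 2 2 3, q2, q2]; ring
  · rw [tr, tr]
    have d : ∀ a c, R a a a c = 0 := fun a c => by have := an a a a c; linarith
    have b := h.bianchi 0 1 2 3
    simp only [Fin.sum_univ_four, d]
    have := sk 1 0 1 0
    have := an 1 0 0 1
    have := sk 2 0 2 0
    have := an 2 0 0 2
    have := sk 3 0 3 0
    have := an 3 0 0 3
    have := sk 2 1 2 1
    have := an 2 1 1 2
    have := sk 3 1 3 1
    have := an 3 1 1 3
    have := sk 3 2 3 2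
    have := an 3 2 2 3
    have := sk 0 1 3 2
    have := ps 2 3 0 1
    have := ps 0 2 1 3
    have := ps 0 3 1 2
    have := q1 0 2
    have := q1 1 3
    have := q2 0 3
    have := q2 1 2
    have := sk 1 2 3 0
    have := ps 1 2 0 3
    have := an 2 0 3 1
    have := sk 0 2 3 1
    linarith

/-- The Ricci form of an algebraic curvature tensor commuting with `j` has self-dual part a
multiple of the fundamental form, determined by the scalar curvature. -/
theorem IsCurvJ.wedge_ricForm (hg : IsHerm g j) (h : IsCurvJ g j R) :
    (∀ k, SkewAdj g k → k * j = -(j * k) → wedge22 (ricForm j R) (k.transpose * g) = 0) ∧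
    (scalAlg g R ≠ 0 → wedge22 (ricForm j R) (j.transpose * g) ≠ 0) := by
  obtain ⟨E, hE, hj⟩ := hg.exists_frame
  obtain ⟨hEF, hdet⟩ := frame_inv hE
  obtain ⟨F, hF⟩ : ∃ F, F = E.transpose * g := ⟨_, rfl⟩
  have hjF : J0 * F = F * j := by
    calc J0 * F = F * E * J0 * F := by rw [hF, hE, Matrix.one_mul]
      _ = F * (j * E) * F := by rw [hj]; noncomm_ring
      _ = F * j * (E * F) := by noncomm_ring
      _ = F * j := by rw [hF, hEF, Matrix.mul_one]
  rw [← hF] at hEF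
  have hFE : F * E = 1 := mul_eq_one_comm.1 hEF
  have hp := h.pull hEF hjF hE
  obtain ⟨s1, s2, s3⟩ := hp.standard
  rw [← scalAlg_pull hF hEF] at s3
  rw [ricForm_pull hjF hEF] at s1 s2 s3
  have hρ : (ricForm j R).transpose = -ricForm j R := by
    ext a b
    simp [ricForm, h.antisymm b a]
  have hform : ∀ k, SkewAdj g k → (k.transpose * g).transpose = -(k.transpose * g) := by
    intro k hk
    rw [Matrix.transpose_mul, Matrix.transpose_transpose, hg.symm]
    exact (neg_eq_of_add_eq_zero_right hk).symm
  have hpull : ∀ k, E.transpose * (k.transpose * g) * E = (F * k * E).transpose := by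
    intro k
    rw [Matrix.transpose_mul, Matrix.transpose_mul, hF, Matrix.transpose_mul, hg.symm,
      Matrix.transpose_transpose]
    noncomm_ring
  constructor
  · intro k hk hkj
    have w := wedge22_pull E hρ (hform k hk)
    suffices h0 : wedge22 (E.transpose * ricForm j R * E)
        (E.transpose * (k.transpose * g) * E) = 0 by
      rw [h0] at w
      exact (mul_eq_zero.1 w.symm).resolve_left hdet
    have hk't : (F * k * E).transpose.transpose = -(F * k * E).transpose := by
      rw [← hpull, Matrix.transpose_mul, Matrix.transpose_mul, Matrix.transpose_transpose,
        hform k hk]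
      noncomm_ring
    rw [Matrix.transpose_transpose] at hk't
    have hanti : F * k * E * J0 = -(J0 * (F * k * E)) := by
      calc F * k * E * J0 = F * (k * j) * E := by
            rw [Matrix.mul_assoc _ E, ← hj]; noncomm_ring
        _ = -(F * j * k * E) := by rw [hkj]; noncomm_ring
        _ = _ := by rw [← hjF]; noncomm_ring
    rw [hpull]
    set ρ := E.transpose * ricForm j R * E
    set k' := F * k * E
    have sk : k'.transpose = -k' := by rw [eq_neg_iff_add_eq_zero, add_comm, ← eq_neg_iff_add_eq_zero]; exact hk't
    have d := fun a => skew_diag sk a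
    -- Skewness and anticommutation with `J0` leave two free entries. The form of `k'` is of type
    -- (2,0)+(0,2), and its wedge with the `J0`-invariant `ρ` vanishes.
    have a1 := congrFun (congrFun hanti 1) 1
    have a2 := congrFun (congrFun hanti 2) 0
    have a3 := congrFun (congrFun hanti 3) 0
    have a4 := congrFun (congrFun hanti 3) 3
    simp only [Matrix.mul_apply, Matrix.neg_apply, Fin.sum_univ_four] at a1 a2 a3 a4
    simp [J0, d] at a1 a2 a3 a4
    have t01 := skew_apply sk 0 1
    have t02 := skew_apply sk 0 2
    have t03 := skew_apply sk 0 3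
    have t12 := skew_apply sk 1 2
    have t13 := skew_apply sk 1 3
    have t23 := skew_apply sk 2 3
    have u1 : k' 0 1 = 0 := by linarith
    have u2 : k' 2 3 = 0 := by linarith
    have u3 : k' 1 3 = -k' 0 2 := by linarith
    have u4 : k' 1 2 = k' 0 3 := by linarith
    rw [sk]
    simp only [wedge22, Matrix.neg_apply, u1, u2, u3, u4, s1, s2]
    ring
  · intro hs h0
    -- In the unitary frame `ρ ∧ ω` is `ρ_01 + ρ_23`, which is the scalar curvature.
    have w := wedge22_pull E hρ (hform j hg.skew)
    rw [h0, mul_zero, hpull, ← hjF, Matrix.mul_assoc J0, hFE, Matrix.mul_one] at w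
    simp [wedge22, J0] at w
    exact hs (by linarith)

end

/-! ### Almost Hermitian structures of class `AH₁` on open subsets of `ℝ⁴` -/

/-- A smooth almost Hermitian structure on an open subset of `ℝ⁴` whose curvature endomorphisms
commute with the almost complex structure. -/
structure IsChartAH (U : Set E4) (G J : E4 → Mat) : Prop where
  isOpen : IsOpen U
  smoothG : SmoothMat U G
  smoothJ : SmoothMat U J
  herm : ∀ y ∈ U, IsHerm (G y) (J y)
  comm : ∀ y ∈ U, ∀ i j, curvMat G i j y * J y = J y * curvMat G i j y

/-- The components `tr (J ∇_i J ∇_j J)`. -/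
def torForm (G J : E4 → Mat) (y : E4) : Mat :=
  Matrix.of fun i j => (J y * covD G i J y * covD G j J y).trace

/-- The components of a multiple of the Ricci form. -/
def ricciForm (G J : E4 → Mat) (y : E4) : Mat := ricForm (J y) fun a b => curvMat G a b y

/-- The fundamental form. -/
def fundForm (G J : E4 → Mat) (y : E4) : Mat := (J y).transpose * G y

/-- The 2-forms `g(J (∇_i J) ·, ·)`. -/
def twistForm (G J : E4 → Mat) (i : Fin 4) (y : E4) : Mat :=
  (J y * covD G i J y).transpose * G y

/-- The 3-form obtained by alternating `g(J (∇_i J) ·, ·)`. -/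
def torForm3 (G J : E4 → Mat) (y : E4) (i j k : Fin 4) : ℝ :=
  twistForm G J i y j k + twistForm G J j y k i + twistForm G J k y i j

/-- The exterior derivative of a 3-form, as the coefficient of the coordinate volume form. -/
def extDerivThree (ψ : E4 → Fin 4 → Fin 4 → Fin 4 → ℝ) (y : E4) : ℝ :=
  pderiv 0 (fun z => ψ z 1 2 3) y - pderiv 1 (fun z => ψ z 0 2 3) y
    + pderiv 2 (fun z => ψ z 0 1 3) y - pderiv 3 (fun z => ψ z 0 1 2) y

/-- If `x` and `b` are independent and both wedge to zero with `ρ`, then `ρ` is a multiple of `x ∧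
b`. The proportionality is stated as a symmetry of the tensor product, which needs no case
distinction. -/
theorem wedge12_swap {x b : Fin 4 → ℝ} {ρ : Mat} (hρ : ρ.transpose = -ρ)
    (hx : ∀ i j k, wedge12 x ρ i j k = 0) (hb : ∀ i j k, wedge12 b ρ i j k = 0)
    (i j k l : Fin 4) : (x i * b j - x j * b i) * ρ k l = (x k * b l - x l * b k) * ρ i j := by
  have h1 := hb j k l
  have h2 := hb i k l
  have h3 := hx i j l
  have h4 := hx i j k
  simp only [wedge12] at h1 h2 h3 h4
  have a1 := skew_apply hρ l i
  have a2 := skew_apply hρ l j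
  rw [a1] at h2 h3
  rw [a2] at h1
  rw [skew_apply hρ k i] at h4
  linear_combination x i * h1 - x j * h2 + b k * h3 - b l * h4

theorem SkewAdj.form_skew {g k : Mat} (hg : g.transpose = g) (hk : SkewAdj g k) :
    (k.transpose * g).transpose = -(k.transpose * g) := by
  rw [Matrix.transpose_mul, Matrix.transpose_transpose, hg]
  exact (neg_eq_of_add_eq_zero_right hk).symm

theorem SkewAdj.mul_anti {g j k : Mat} (hg : IsHerm g j) (hk : SkewAdj g k)
    (hkj : k * j = -(j * k)) : SkewAdj g (j * k) := by
  have a : j.transpose * g = -(g * j) := eq_neg_of_add_eq_zero_left hg.skew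
  have b : k.transpose * g = -(g * k) := eq_neg_of_add_eq_zero_left hk
  unfold SkewAdj
  rw [Matrix.transpose_mul, Matrix.mul_assoc, a, Matrix.mul_neg, ← Matrix.mul_assoc, b,
    Matrix.neg_mul, Matrix.mul_assoc, hkj]
  simp

theorem IsHerm.det_ne {g j : Mat} (h : IsHerm g j) : g.det ≠ 0 := by
  intro h0
  obtain ⟨E, hE, -⟩ := h.exists_frame
  have := congrArg Matrix.det hE
  rw [Matrix.det_mul, Matrix.det_mul, h0, Matrix.det_one] at this
  simp at this

/-! ### Identities for `∇J`, the Ricci form and the torsion form -/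

namespace IsChartAH

variable {U : Set E4} {G J : E4 → Mat}

theorem isMetricOn (h : IsChartAH U G J) : IsMetricOn U G where
  isOpen := h.isOpen
  smooth := h.smoothG
  symm := fun y hy => (h.herm y hy).symm
  det_ne := fun y hy => (h.herm y hy).det_ne

theorem smooth_covDJ (h : IsChartAH U G J) (i : Fin 4) : SmoothMat U (covD G i J) :=
  h.isMetricOn.smooth_covD h.smoothJ i

theorem anti (h : IsChartAH U G J) {y : E4} (hy : y ∈ U) (i : Fin 4) :
    covD G i J y * J y = -(J y * covD G i J y) := by
  have e : covD G i (fun z => J z * J z) y = covD G i (fun _ => -1) y :=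
    covD_congr h.isOpen (fun z hz => (h.herm z hz).sq) hy i
  rw [covD_mul h.smoothJ h.smoothJ hy] at e
  have : covD G i (fun _ => (-1 : Mat)) y = 0 := by simp [covD]
  rw [this] at e
  exact eq_neg_of_add_eq_zero_left e

/-- Covariant derivatives of skew-adjoint endomorphism fields are skew-adjoint. -/
theorem skewAdj_covD (h : IsChartAH U G J) {V : Set E4} (hV : IsOpen V) (hVU : V ⊆ U)
    {M : E4 → Mat} (hM : SmoothMat V M) (hs : ∀ z ∈ V, SkewAdj (G z) (M z)) {y : E4}
    (hy : y ∈ V) (i : Fin 4) : SkewAdj (G y) (covD G i M y) := by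
  have hG := h.smoothG.mono hVU
  have e : mpd i (fun z => (M z).transpose * G z + G z * M z) y = mpd i (fun _ => 0) y :=
    mpd_congr_of_isOpen hV hs hy i
  rw [mpd_add (hM.transpose.mul hG) (hG.mul hM) hy, mpd_mul hM.transpose hG hy,
    mpd_mul hG hM hy, mpd_const, mpd_transpose, h.isMetricOn.mpd_metric (hVU hy) i] at e
  have s := hs y hy
  unfold SkewAdj at s ⊢
  unfold covD
  simp only [Matrix.transpose_add, Matrix.transpose_sub, Matrix.transpose_mul]
  set Γ := chrMat G i y
  -- The Christoffel terms separating the differentiated skewness relation from its covariant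
  -- version are multiples of the relation itself.
  have s1 : Γ.transpose * ((M y).transpose * G y + G y * M y) = 0 := by rw [s, Matrix.mul_zero]
  have s2 : ((M y).transpose * G y + G y * M y) * Γ = 0 := by rw [s, Matrix.zero_mul]
  rw [← sub_zero (0 : Mat)]
  nth_rewrite 1 [← e]
  rw [← add_zero (0 : Mat)]
  nth_rewrite 1 [← s1]
  rw [← s2]
  noncomm_ring

theorem skewAdj (h : IsChartAH U G J) {y : E4} (hy : y ∈ U) (i : Fin 4) :
    SkewAdj (G y) (covD G i J y) :=
  h.skewAdj_covD h.isOpen subset_rfl h.smoothJ (fun z hz => (h.herm z hz).skew) hy i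

/-- By the Ricci identity the difference is `[R_ij, J]`, which vanishes in class `AH₁`. The index of
`covD G j J` is only a label, not differentiated covariantly; the omitted correction `Γ^k_ij ∇_k J`
is symmetric in `i, j`. -/
theorem covD_covDJ_symm (h : IsChartAH U G J) {y : E4} (hy : y ∈ U) (i j : Fin 4) :
    covD G i (covD G j J) y = covD G j (covD G i J) y := by
  rw [← sub_eq_zero, h.isMetricOn.covD_comm h.smoothJ hy, h.comm y hy, sub_self]

theorem isCurvJ (h : IsChartAH U G J) {y : E4} (hy : y ∈ U) :
    IsCurvJ (G y) (J y) fun a b => curvMat G a b y where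
  antisymm := fun a b => curvMat_antisymm a b y
  skew := fun a b => h.isMetricOn.curvMat_skew hy a b
  bianchi := fun a b c d => h.isMetricOn.bianchi_one hy a b c d
  comm := h.comm y hy

theorem ricciForm_skew (y : E4) :
    (ricciForm G J y).transpose = -ricciForm G J y := by
  ext a b
  simp [ricciForm, ricForm, curvMat_antisymm b a]

/-- The Ricci identity for `∇_k J` gives `[R_ij, ∇_k J] = -½ ρ_ij J ∇_k J`. Third derivatives of `J`
are symmetric in their last two indices, so the cyclic sum of the commutators on the left telescopes
to zero. -/
theorem ricciForm_wedge (h : IsChartAH U G J) {y : E4} (hy : y ∈ U) (i j k : Fin 4) :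
    ricciForm G J y i j • covD G k J y + ricciForm G J y j k • covD G i J y +
      ricciForm G J y k i • covD G j J y = 0 := by
  have hm := h.isMetricOn
  have hc : ∀ i j k, curvMat G i j y * covD G k J y - covD G k J y * curvMat G i j y =
      (-(1 / 2 : ℝ) * ricciForm G J y i j) • (J y * covD G k J y) := fun i j k =>
    (h.herm y hy).commutator_mixed (hm.curvMat_skew hy i j) (h.comm y hy i j) (h.skewAdj hy k)
      (h.anti hy k)
  have hR : ∀ i j k, covD G i (covD G j (covD G k J)) y - covD G j (covD G i (covD G k J)) y =
      (-(1 / 2 : ℝ) * ricciForm G J y i j) • (J y * covD G k J y) := fun i j k => by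
    rw [← hc, hm.covD_comm (h.smooth_covDJ k) hy]
  have hS : ∀ i j k, covD G i (covD G j (covD G k J)) y = covD G i (covD G k (covD G j J)) y :=
    fun i j k => covD_congr h.isOpen (fun z hz => h.covD_covDJ_symm hz j k) hy i
  have e : J y * (ricciForm G J y i j • covD G k J y + ricciForm G J y j k • covD G i J y +
      ricciForm G J y k i • covD G j J y) = 0 := by
    have h1 := hR i j k
    have h2 := hR j k i
    have h3 := hR k i j
    rw [hS j i k] at h1
    rw [hS k j i, hS j k i] at h2
    rw [hS i k j] at h3
    have e2 : (-(1 / 2 : ℝ) * ricciForm G J y i j) • (J y * covD G k J y) +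
        (-(1 / 2 : ℝ) * ricciForm G J y j k) • (J y * covD G i J y) +
        (-(1 / 2 : ℝ) * ricciForm G J y k i) • (J y * covD G j J y) = 0 := by
      rw [← h1, ← h2, ← h3, hS j k i]; abel
    simp only [Matrix.mul_add, Matrix.mul_smul]
    have e3 := congrArg ((-2 : ℝ) • ·) e2
    simp only [smul_add, smul_smul, smul_zero] at e3
    rw [← e3]
    congr 2 <;> [congr 2; skip; skip] <;> congr 1 <;> ring
  have e4 := congrArg ((-J y) * ·) e
  simpa [← Matrix.mul_assoc, (h.herm y hy).sq] using e4

theorem ricciForm_wedge_entry (h : IsChartAH U G J) {y : E4} (hy : y ∈ U) (a b i j k : Fin 4) :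
    wedge12 (fun m => covD G m J y a b) (ricciForm G J y) i j k = 0 := by
  have := congrFun (congrFun (h.ricciForm_wedge hy i j k) a) b
  simp only [Matrix.add_apply, Matrix.smul_apply, smul_eq_mul, Matrix.zero_apply] at this
  simp only [wedge12]; linarith

theorem torForm_skew (h : IsChartAH U G J) {y : E4} (hy : y ∈ U) :
    (torForm G J y).transpose = -torForm G J y := by
  ext a b
  simp only [torForm, Matrix.transpose_apply, Matrix.of_apply, Matrix.neg_apply]
  rw [Matrix.trace_mul_comm, ← Matrix.mul_assoc, h.anti hy, Matrix.neg_mul, Matrix.trace_neg]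

/-- Being skew, `tr (J K_i K_j)` is a combination of 2×2 minors of pairs of entries of `K`. Each
minor is a wedge of two real 1-forms annihilated by `ρ ∧`, so `wedge12_swap` applies term by term.
-/
theorem torForm_mul_ricciForm (h : IsChartAH U G J) {y : E4} (hy : y ∈ U) (i j k l : Fin 4) :
    torForm G J y i j * ricciForm G J y k l = torForm G J y k l * ricciForm G J y i j := by
  have key : ∀ i j, 2 * torForm G J y i j = ∑ a, ∑ b, ∑ c, J y a b *
      (covD G i J y b c * covD G j J y c a - covD G j J y b c * covD G i J y c a) := by
    intro i j
    have e : ∀ i j, torForm G J y i j =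
        ∑ a, ∑ b, ∑ c, J y a b * (covD G i J y b c * covD G j J y c a) := by
      intro i j
      simp only [torForm, Matrix.of_apply, Matrix.trace, Matrix.diag, Matrix.mul_assoc,
        Matrix.mul_apply (M := J y), Matrix.mul_apply (M := covD G i J y), Finset.mul_sum]
    have s := skew_apply (h.torForm_skew hy) i j
    simp only [mul_sub, Finset.sum_sub_distrib, ← e]
    linarith
  have : 2 * torForm G J y i j * ricciForm G J y k l =
      2 * torForm G J y k l * ricciForm G J y i j := by
    rw [key, key]
    simp only [Finset.sum_mul]
    refine Finset.sum_congr rfl fun a _ => Finset.sum_congr rfl fun b _ =>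
      Finset.sum_congr rfl fun c _ => ?_
    rw [mul_assoc, mul_assoc]
    congr 1
    exact wedge12_swap (ricciForm_skew y) (h.ricciForm_wedge_entry hy b c)
      (h.ricciForm_wedge_entry hy c a) i j k l
  linarith

theorem trace_mul_anti (h : IsChartAH U G J) {y : E4} (hy : y ∈ U) {r : Mat}
    (hr : r * J y = J y * r) (i : Fin 4) : (covD G i J y * r).trace = 0 := by
  refine trace_anti (h.herm y hy) ?_
  rw [Matrix.mul_assoc, hr, ← Matrix.mul_assoc, h.anti hy, Matrix.neg_mul, Matrix.mul_assoc]

/-- In `∂_i tr (J R_jk)` the term `tr (K_i R_jk)` vanishes because `K_i R_jk` anticommutes with `J`;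
the cyclic sum of the rest is zero by the second Bianchi identity. -/
theorem extDerivTwo_ricciForm (h : IsChartAH U G J) {y : E4} (hy : y ∈ U) (i j k : Fin 4) :
    extDerivTwo (ricciForm G J) i j k y = 0 := by
  have hm := h.isMetricOn
  have key : ∀ i j k, pderiv i (fun z => ricciForm G J z j k) y =
      (J y * covD G i (curvMat G j k) y).trace := by
    intro i j k
    have e := pderiv_trace_covD (G := G) (h.smoothJ.mul (hm.smooth_curvMat j k)) hy i
    rw [covD_mul h.smoothJ (hm.smooth_curvMat j k) hy, Matrix.trace_add,
      h.trace_mul_anti hy (h.comm y hy j k), zero_add] at e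
    exact e
  rw [extDerivTwo, key, key, key, ← Matrix.trace_add, ← Matrix.trace_add, ← Matrix.mul_add,
    ← Matrix.mul_add, hm.bianchi_two hy, Matrix.mul_zero, Matrix.trace_zero]

/-- The cubic term `tr (K_i K_j K_k)` is the trace of an endomorphism anticommuting with `J`. The
terms with second derivatives of `J` cancel in pairs, by the symmetry of `∇²J` and the rule `tr (J S
K) = -tr (J K S)`. -/
theorem extDerivTwo_torForm (h : IsChartAH U G J) {y : E4} (hy : y ∈ U) (i j k : Fin 4) :
    extDerivTwo (torForm G J) i j k y = 0 := by
  have hK := h.smooth_covDJ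
  have key : ∀ i j k, pderiv i (fun z => torForm G J z j k) y =
      (J y * covD G i (covD G j J) y * covD G k J y).trace +
      (J y * covD G j J y * covD G i (covD G k J) y).trace := by
    intro i j k
    have e := pderiv_trace_covD (G := G) ((h.smoothJ.mul (hK j)).mul (hK k)) hy i
    rw [covD_mul (h.smoothJ.mul (hK j)) (hK k) hy, covD_mul h.smoothJ (hK j) hy,
      Matrix.add_mul, Matrix.trace_add, Matrix.trace_add] at e
    have z : (covD G i J y * covD G j J y * covD G k J y).trace = 0 := by
      rw [Matrix.mul_assoc]
      refine h.trace_mul_anti hy ?_ i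
      rw [Matrix.mul_assoc, h.anti hy, Matrix.mul_neg, ← Matrix.mul_assoc, h.anti hy,
        Matrix.neg_mul, neg_neg, Matrix.mul_assoc]
    rw [z, zero_add] at e
    exact e
  have c : ∀ (S : Mat) k, (J y * S * covD G k J y).trace = -(J y * covD G k J y * S).trace := by
    intro S k
    rw [Matrix.trace_mul_comm, ← Matrix.mul_assoc, h.anti hy, Matrix.neg_mul, Matrix.trace_neg]
  rw [extDerivTwo, key, key, key, c, c, c, h.covD_covDJ_symm hy i k, h.covD_covDJ_symm hy j i,
    h.covD_covDJ_symm hy k j]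
  ring

theorem smooth_torForm (h : IsChartAH U G J) : SmoothMat U (torForm G J) := fun i j _ hy =>
  ((h.smoothJ.mul (h.smooth_covDJ i)).mul (h.smooth_covDJ j)).trace hy

theorem smooth_ricciForm (h : IsChartAH U G J) : SmoothMat U (ricciForm G J) := fun i j _ hy =>
  (h.smoothJ.mul (h.isMetricOn.smooth_curvMat i j)).trace hy

theorem smooth_fundForm (h : IsChartAH U G J) : SmoothMat U (fundForm G J) :=
  h.smoothJ.transpose.mul h.smoothG

theorem smooth_twistForm (h : IsChartAH U G J) (i : Fin 4) : SmoothMat U (twistForm G J i) :=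
  (h.smoothJ.mul (h.smooth_covDJ i)).transpose.mul h.smoothG

theorem fundForm_skew (h : IsChartAH U G J) {y : E4} (hy : y ∈ U) :
    (fundForm G J y).transpose = -fundForm G J y :=
  (h.herm y hy).skew.form_skew (h.herm y hy).symm

theorem twistForm_skew (h : IsChartAH U G J) {y : E4} (hy : y ∈ U) (i : Fin 4) :
    (twistForm G J i y).transpose = -twistForm G J i y :=
  ((h.skewAdj hy i).mul_anti (h.herm y hy) (h.anti hy i)).form_skew (h.herm y hy).symm

theorem isAlt3_torForm3 (h : IsChartAH U G J) {y : E4} (hy : y ∈ U) :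
    IsAlt3 (torForm3 G J y) where
  swap := fun i j k => by
    simp only [torForm3]
    rw [skew_apply (h.twistForm_skew hy j) i k, skew_apply (h.twistForm_skew hy i) k j,
      skew_apply (h.twistForm_skew hy k) j i]
    ring
  rot := fun i j k => by simp only [torForm3]; ring

theorem smooth_torForm3 (h : IsChartAH U G J) {y : E4} (hy : y ∈ U) (i j k : Fin 4) :
    ContDiffAt ℝ ∞ (fun z => torForm3 G J z i j k) y :=
  ((h.smooth_twistForm i j k y hy).add (h.smooth_twistForm j k i y hy)).add
    (h.smooth_twistForm k i j y hy)

end IsChartAH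

/-- The combinatorics of `dψ`: full alternation kills the terms `Y` (second derivatives of `J`) and
`V` (Christoffel symbols), each symmetric in two of the alternated indices. Only the terms `W`,
quadratic in `∇J`, survive. -/
theorem alternate_four (T W Y V : Fin 4 → Fin 4 → Fin 4 → Fin 4 → ℝ)
    (hskew : ∀ l i j k, T l i j k = -T l i k j)
    (hT : ∀ l i j k, T l i j k = W l i j k + Y l i j k + V l j i k - V l k i j)
    (hY : ∀ l i j k, Y l i j k = Y i l j k) (hV : ∀ l j i k, V l j i k = V j l i k) :
    (T 0 1 2 3 + T 0 2 3 1 + T 0 3 1 2) - (T 1 0 2 3 + T 1 2 3 0 + T 1 3 0 2) +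
      (T 2 0 1 3 + T 2 1 3 0 + T 2 3 0 1) - (T 3 0 1 2 + T 3 1 2 0 + T 3 2 0 1) =
    (W 0 1 2 3 - W 1 0 2 3) - (W 0 2 1 3 - W 2 0 1 3) + (W 0 3 1 2 - W 3 0 1 2) +
      (W 1 2 0 3 - W 2 1 0 3) - (W 1 3 0 2 - W 3 1 0 2) + (W 2 3 0 1 - W 3 2 0 1) := by
  rw [hskew 0 2 3 1, hskew 1 2 3 0, hskew 1 3 0 2, hskew 2 1 3 0, hskew 3 1 2 0,
    ← neg_eq_iff_eq_neg.2 (hskew 1 3 0 2), neg_neg]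
  simp only [hT]
  rw [hY 1 0, hY 2 0, hY 3 0, hY 2 1, hY 3 1, hY 3 2]
  simp only [hV 1 0, hV 2 0, hV 3 0, hV 2 1, hV 3 1, hV 3 2]
  ring

/-! ### The 3-form `torForm3` and the proportionality factor `torRatio` -/

namespace IsChartAH

variable {U : Set E4} {G J : E4 → Mat}

theorem mpd_twistForm (h : IsChartAH U G J) {y : E4} (hy : y ∈ U) (l i : Fin 4) :
    mpd l (twistForm G J i) y = (covD G l J y * covD G i J y).transpose * G y +
      (J y * covD G l (covD G i J) y).transpose * G y +
      (chrMat G l y).transpose * twistForm G J i y + twistForm G J i y * chrMat G l y := by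
  have hQ := h.smoothJ.mul (h.smooth_covDJ i)
  have e : mpd l (twistForm G J i) y =
      (mpd l (fun z => J z * covD G i J z) y).transpose * G y +
      (J y * covD G i J y).transpose * mpd l G y := by
    have := mpd_mul hQ.transpose h.smoothG hy l
    rw [mpd_transpose] at this
    exact this
  have e2 : mpd l (fun z => J z * covD G i J z) y =
      covD G l J y * covD G i J y + J y * covD G l (covD G i J) y
      - chrMat G l y * (J y * covD G i J y) + J y * covD G i J y * chrMat G l y := by
    rw [← covD_mul h.smoothJ (h.smooth_covDJ i) hy, covD]
    abel
  rw [e, e2, h.isMetricOn.mpd_metric hy]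
  simp only [twistForm, Matrix.transpose_add, Matrix.transpose_sub, Matrix.transpose_mul]
  noncomm_ring

/-- The exterior derivative of the 3-form `torForm3`. -/
theorem extDerivThree_torForm3 (h : IsChartAH U G J) {y : E4} (hy : y ∈ U) :
    extDerivThree (torForm3 G J) y =
      -(1 / 2 : ℝ) * wedge22 (torForm G J y) (fundForm G J y) := by
  have hd : ∀ l i j k, pderiv l (fun z => torForm3 G J z i j k) y =
      mpd l (twistForm G J i) y j k + mpd l (twistForm G J j) y k i +
      mpd l (twistForm G J k) y i j := by
    intro l i j k
    have a := h.smooth_twistForm i j k y hy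
    have b := h.smooth_twistForm j k i y hy
    have c := h.smooth_twistForm k i j y hy
    simp only [torForm3]
    rw [pderiv_add (smooth_diff (a.add b)) (smooth_diff c), pderiv_add (smooth_diff a)
      (smooth_diff b)]
    rfl
  -- The commutator `[K_l, K_i]` is a multiple of `J` with coefficient `-½ τ_li`, which produces `-½
  -- τ ∧ ω` after alternation.
  have hW : ∀ l i j k, ((covD G l J y * covD G i J y).transpose * G y) j k -
      ((covD G i J y * covD G l J y).transpose * G y) j k =
      -(1 / 2 : ℝ) * (torForm G J y l i * fundForm G J y j k) := by
    intro l i j k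
    have c := (h.herm y hy).commutator (h.skewAdj hy l) (h.anti hy l) (h.skewAdj hy i)
      (h.anti hy i)
    rw [← Matrix.sub_apply, ← Matrix.sub_mul, ← Matrix.transpose_sub, c, Matrix.transpose_smul,
      Matrix.smul_mul, Matrix.smul_apply, smul_eq_mul, mul_assoc]
    rfl
  have main := alternate_four (fun l i j k => mpd l (twistForm G J i) y j k)
    (fun l i j k => ((covD G l J y * covD G i J y).transpose * G y) j k)
    (fun l i j k => ((J y * covD G l (covD G i J) y).transpose * G y) j k)
    (fun l j i k => ((chrMat G l y).transpose * twistForm G J i y) j k)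
    ?_ ?_ ?_ ?_
  · rw [hW, hW, hW, hW, hW, hW] at main
    rw [extDerivThree, hd, hd, hd, hd, main, wedge22]
    ring
  · intro l i j k
    have e : mpd l (fun z => (twistForm G J i z).transpose) y =
        mpd l (fun z => -twistForm G J i z) y :=
      mpd_congr_of_isOpen h.isOpen (fun z hz => h.twistForm_skew hz i) hy l
    rw [mpd_neg, mpd_transpose] at e
    exact skew_apply e j k
  · intro l i j k
    have e : (twistForm G J i y * chrMat G l y) j k =
        -((chrMat G l y).transpose * twistForm G J i y) k j := by
      rw [← Matrix.transpose_apply (twistForm G J i y * chrMat G l y), Matrix.transpose_mul,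
        h.twistForm_skew hy, Matrix.mul_neg]
      rfl
    simp only [h.mpd_twistForm hy, Matrix.add_apply, e]
    ring
  · intro l i j k
    simp only [h.covD_covDJ_symm hy l i]
  · intro l j i k
    simp only [Matrix.mul_apply, Matrix.transpose_apply]
    exact Finset.sum_congr rfl fun m _ => by rw [h.isMetricOn.chrMat_symm hy]

/-- The density `ρ ∧ ω`. -/
def _root_.AlmostHermitian.ricciDensity (G J : E4 → Mat) (y : E4) : ℝ :=
  wedge22 (ricciForm G J y) (fundForm G J y)

/-- Both `x` and the entries of `K` are annihilated by `ρ ∧`, so the endomorphism-valued 2-form `x ∧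
K` equals `ρ ⊗ M`, up to the nonzero factor `ρ ∧ ω`, for one `M` anticommuting with `J`. Then `x ∧
ψ` is a multiple of `ρ ∧ g(J M ·, ·)`, which vanishes because `ρ` is `J`-invariant. -/
theorem wedge13_torForm3 (h : IsChartAH U G J) {y : E4} (hy : y ∈ U)
    (h0 : ricciDensity G J y ≠ 0) {x : Fin 4 → ℝ}
    (hx : ∀ i j k, wedge12 x (ricciForm G J y) i j k = 0) :
    wedge13 x (torForm3 G J y) = 0 := by
  set ρ := ricciForm G J y with hρ
  set w := fundForm G J y with hw0
  set K : Fin 4 → Mat := fun i => covD G i J y with hK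
  set Z : Fin 4 → Fin 4 → Mat := fun l i => x l • K i - x i • K l with hZ
  -- `M` is `Z ∧ ω`, the result of pairing the relation `Z ⊗ ρ = ρ ⊗ Z` with `ω`.
  set M : Mat := w 2 3 • Z 0 1 - w 1 3 • Z 0 2 + w 1 2 • Z 0 3 + w 0 3 • Z 1 2 - w 0 2 • Z 1 3
    + w 0 1 • Z 2 3 with hM
  have hsw : ∀ i j k l a b, Z i j a b * ρ k l = Z k l a b * ρ i j := by
    intro i j k l a b
    simp only [hZ, Matrix.sub_apply, Matrix.smul_apply, smul_eq_mul]
    exact wedge12_swap (b := fun m => K m a b) (ricciForm_skew y) hx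
      (h.ricciForm_wedge_entry hy a b) i j k l
  have hZM : ∀ l i, ricciDensity G J y • Z l i = ρ l i • M := by
    intro l i
    ext a b
    simp only [hM, ricciDensity, wedge22, Matrix.smul_apply, Matrix.add_apply, Matrix.sub_apply,
      smul_eq_mul]
    linear_combination w 2 3 * hsw l i 0 1 a b - w 1 3 * hsw l i 0 2 a b +
      w 1 2 * hsw l i 0 3 a b + w 0 3 * hsw l i 1 2 a b - w 0 2 * hsw l i 1 3 a b +
      w 0 1 * hsw l i 2 3 a b
  have hZs : ∀ l i, SkewAdj (G y) (Z l i) ∧ Z l i * J y = -(J y * Z l i) := by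
    intro l i
    constructor
    · have a := h.skewAdj hy l
      have b := h.skewAdj hy i
      unfold SkewAdj at a b ⊢
      have : (Z l i).transpose * G y + G y * Z l i =
          x l • ((K i).transpose * G y + G y * K i) - x i • ((K l).transpose * G y + G y * K l) := by
        simp only [hZ, Matrix.transpose_sub, Matrix.transpose_smul, Matrix.sub_mul,
          Matrix.smul_mul, Matrix.mul_sub, Matrix.mul_smul, smul_add]
        abel
      rw [this, a, b]; simp
    · simp only [hZ, Matrix.sub_mul, Matrix.smul_mul, Matrix.mul_sub, Matrix.mul_smul]
      rw [hK]
      simp only [h.anti hy]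
      simp only [smul_neg]; abel
  have hMs : SkewAdj (G y) M := by
    unfold SkewAdj
    have hz := fun l i => (hZs l i).1
    unfold SkewAdj at hz
    have : M.transpose * G y + G y * M =
        w 2 3 • ((Z 0 1).transpose * G y + G y * Z 0 1)
        - w 1 3 • ((Z 0 2).transpose * G y + G y * Z 0 2)
        + w 1 2 • ((Z 0 3).transpose * G y + G y * Z 0 3)
        + w 0 3 • ((Z 1 2).transpose * G y + G y * Z 1 2)
        - w 0 2 • ((Z 1 3).transpose * G y + G y * Z 1 3)
        + w 0 1 • ((Z 2 3).transpose * G y + G y * Z 2 3) := by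
      rw [hM]
      simp only [Matrix.transpose_add, Matrix.transpose_sub, Matrix.transpose_smul,
        Matrix.sub_mul, Matrix.add_mul, Matrix.mul_add, Matrix.smul_mul, Matrix.mul_sub,
        Matrix.mul_smul, smul_add]
      abel
    rw [this]; simp only [hz]; simp
  have hMa : M * J y = -(J y * M) := by
    rw [hM]
    simp only [Matrix.sub_mul, Matrix.add_mul, Matrix.mul_add, Matrix.smul_mul, Matrix.mul_sub,
        Matrix.mul_smul, (hZs _ _).2, smul_neg]
    abel
  have hJM : (J y * M) * J y = -(J y * (J y * M)) := by
    rw [Matrix.mul_assoc, hMa, Matrix.mul_neg]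
  have hw := ((h.isCurvJ hy).wedge_ricForm (h.herm y hy)).1 (J y * M)
    (hMs.mul_anti (h.herm y hy) hMa) hJM
  have hq : ∀ l i j k, ricciDensity G J y * (x l * twistForm G J i y j k -
      x i * twistForm G J l y j k) = ρ l i * ((J y * M).transpose * G y) j k := by
    intro l i j k
    have e1 : (x l * twistForm G J i y j k - x i * twistForm G J l y j k) =
        ((J y * Z l i).transpose * G y) j k := by
      simp only [twistForm, hZ, Matrix.mul_sub, Matrix.mul_smul, Matrix.transpose_sub,
        Matrix.transpose_smul, Matrix.sub_mul, Matrix.smul_mul, Matrix.sub_apply,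
        Matrix.smul_apply, smul_eq_mul, hK]
    have e2 := congrArg (fun A : Mat => ((J y * A).transpose * G y) j k) (hZM l i)
    simp only [Matrix.mul_smul, Matrix.transpose_smul, Matrix.smul_mul, Matrix.smul_apply,
      smul_eq_mul] at e2
    rw [e1, e2]
  have hs := fun i => skew_apply (h.twistForm_skew hy i)
  have : ricciDensity G J y * wedge13 x (torForm3 G J y) =
      wedge22 ρ ((J y * M).transpose * G y) := by
    simp only [wedge13, torForm3, wedge22]
    rw [← hq, ← hq, ← hq, ← hq, ← hq, ← hq, hs 2 3 1, hs 2 3 0, hs 1 3 0, hs 1 2 0]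
    ring
  rw [show wedge22 ρ ((J y * M).transpose * G y) = 0 from hw] at this
  exact (mul_eq_zero.1 this).resolve_left h0

theorem ricciDensity_ne (h : IsChartAH U G J) {y : E4} (hy : y ∈ U)
    (hs : scalarCurvature G y ≠ 0) : ricciDensity G J y ≠ 0 :=
  ((h.isCurvJ hy).wedge_ricForm (h.herm y hy)).2 hs

/-- The ratio of `torForm` and `ricciForm`. -/
def _root_.AlmostHermitian.torRatio (G J : E4 → Mat) (y : E4) : ℝ :=
  wedge22 (torForm G J y) (fundForm G J y) / ricciDensity G J y

theorem smooth_wedge22 {η ζ : E4 → Mat} (hη : SmoothMat U η) (hζ : SmoothMat U ζ) {y : E4}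
    (hy : y ∈ U) : ContDiffAt ℝ ∞ (fun z => wedge22 (η z) (ζ z)) y := by
  have a := fun i j => hη i j y hy
  have b := fun i j => hζ i j y hy
  simp only [wedge22]
  exact ((((((a 0 1).mul (b 2 3)).sub ((a 0 2).mul (b 1 3))).add ((a 0 3).mul (b 1 2))).add
    ((a 1 2).mul (b 0 3))).sub ((a 1 3).mul (b 0 2))).add ((a 2 3).mul (b 0 1))

theorem smooth_ricciDensity (h : IsChartAH U G J) {y : E4} (hy : y ∈ U) :
    ContDiffAt ℝ ∞ (ricciDensity G J) y :=
  smooth_wedge22 h.smooth_ricciForm h.smooth_fundForm hy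

theorem smooth_torRatio (h : IsChartAH U G J) {y : E4} (hy : y ∈ U)
    (hs : ricciDensity G J y ≠ 0) : ContDiffAt ℝ ∞ (torRatio G J) y :=
  (smooth_wedge22 h.smooth_torForm h.smooth_fundForm hy).div (h.smooth_ricciDensity hy) hs

/-- The relation `τ ⊗ ρ = ρ ⊗ τ`, wedged with `ω` in the second factor, divided by `ρ ∧ ω`. -/
theorem torForm_eq (h : IsChartAH U G J) {y : E4} (hy : y ∈ U)
    (hs : ricciDensity G J y ≠ 0) (i j : Fin 4) :
    torForm G J y i j = torRatio G J y * ricciForm G J y i j := by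
  rw [torRatio, div_mul_eq_mul_div, eq_div_iff hs]
  have e := h.torForm_mul_ricciForm hy
  simp only [ricciDensity, wedge22]
  linear_combination fundForm G J y 2 3 * e i j 0 1 - fundForm G J y 1 3 * e i j 0 2 +
      fundForm G J y 1 2 * e i j 0 3 + fundForm G J y 0 3 * e i j 1 2 -
      fundForm G J y 0 2 * e i j 1 3 + fundForm G J y 0 1 * e i j 2 3

/-- Since `τ = h ρ` with both forms closed, `dh ∧ ρ = 0`, and `dh` qualifies as the 1-form `x` of
`wedge13_torForm3`. -/
theorem wedge13_dRatio (h : IsChartAH U G J) (hs : ∀ z ∈ U, ricciDensity G J z ≠ 0) {y : E4}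
    (hy : y ∈ U) :
    wedge13 (fun i => pderiv i (torRatio G J) y) (torForm3 G J y) = 0 := by
  refine h.wedge13_torForm3 hy (hs y hy) fun i j k => ?_
  have hR := smooth_diff (h.smooth_torRatio hy (hs y hy))
  have key : ∀ i j k, pderiv i (fun z => torForm G J z j k) y =
      pderiv i (torRatio G J) y * ricciForm G J y j k +
      torRatio G J y * pderiv i (fun z => ricciForm G J z j k) y := by
    intro i j k
    rw [pderiv_congr_of_isOpen h.isOpen (fun z hz => h.torForm_eq hz (hs z hz) j k) hy i]
    exact pderiv_mul hR (h.smooth_ricciForm.diff hy j k) i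
  have e1 := h.extDerivTwo_torForm hy i j k
  have e2 := h.extDerivTwo_ricciForm hy i j k
  rw [extDerivTwo] at e1 e2
  rw [key, key, key] at e1
  simp only [wedge12]
  linear_combination e1 - torRatio G J y * e2

theorem extDerivThree_eq (h : IsChartAH U G J) (hs : ∀ z ∈ U, ricciDensity G J z ≠ 0) {y : E4}
    (hy : y ∈ U) : extDerivThree (torForm3 G J) y =
      -(1 / 2 : ℝ) * (torRatio G J y * ricciDensity G J y) := by
  rw [h.extDerivThree_torForm3 hy, torRatio, div_mul_cancel₀ _ (hs y hy)]

end IsChartAH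

/-! ### Locally conformally almost Kähler structures -/

theorem wedge12_pull (E : Mat) (x : Fin 4 → ℝ) (η : Mat) :
    wedge12 (E.transpose.mulVec x) (E.transpose * η * E) = pull3 E (wedge12 x η) := by
  have hη : ∀ a b, (E.transpose * η * E) a b = ∑ i, ∑ j, E i a * E j b * η i j := by
    intro a b
    simp only [Matrix.mul_apply, Matrix.transpose_apply, Finset.sum_mul]
    rw [Finset.sum_comm]
    exact Finset.sum_congr rfl fun _ _ => Finset.sum_congr rfl fun _ _ => by ring
  have hx : ∀ a, E.transpose.mulVec x a = ∑ i, E i a * x i := fun a => rfl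
  funext a b c
  have h1 : E.transpose.mulVec x a * (E.transpose * η * E) b c =
      ∑ i, ∑ j, ∑ k, E i a * E j b * E k c * (x i * η j k) := by
    rw [hx, hη]
    simp only [Finset.sum_mul, Finset.mul_sum]
    rw [Finset.sum_comm_cycle]
    exact Finset.sum_congr rfl fun _ _ => Finset.sum_congr rfl fun _ _ =>
      Finset.sum_congr rfl fun _ _ => by ring
  have h2 : E.transpose.mulVec x b * (E.transpose * η * E) c a =
      ∑ i, ∑ j, ∑ k, E i a * E j b * E k c * (x j * η k i) := by
    rw [hx, hη]
    simp only [Finset.sum_mul, Finset.mul_sum]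
    rw [Finset.sum_comm_cycle, Finset.sum_comm_cycle]
    exact Finset.sum_congr rfl fun _ _ => Finset.sum_congr rfl fun _ _ =>
      Finset.sum_congr rfl fun _ _ => by ring
  have h3 : E.transpose.mulVec x c * (E.transpose * η * E) a b =
      ∑ i, ∑ j, ∑ k, E i a * E j b * E k c * (x k * η i j) := by
    rw [hx, hη]
    simp only [Finset.sum_mul, Finset.mul_sum]
    exact Finset.sum_congr rfl fun _ _ => Finset.sum_congr rfl fun _ _ =>
      Finset.sum_congr rfl fun _ _ => by ring
  simp only [wedge12, pull3] at h1 h2 h3 ⊢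
  rw [h1, h2, h3]
  simp only [← Finset.sum_add_distrib, ← mul_add]

theorem isAlt3_wedge12 (x : Fin 4 → ℝ) {η : Mat} (hη : η.transpose = -η) :
    IsAlt3 (wedge12 x η) where
  swap := fun i j k => by
    simp only [wedge12]
    rw [skew_apply hη i k, skew_apply hη k j, skew_apply hη j i]; ring
  rot := fun i j k => by simp only [wedge12]; ring

/-! ### Quaternionic frames and the Lee form -/

section
variable {g j n : Mat}

theorem IsQuat.exists_frame (hg : IsHerm g j) (hn : IsQuat g j n) :
    ∃ E F : Mat, F * E = 1 ∧ E * F = 1 ∧ E.det ≠ 0 ∧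
      E.transpose * (j.transpose * g) * E = J0.transpose ∧
      E.transpose * (n.transpose * g) * E = N0.transpose ∧
      E.transpose * ((j * n).transpose * g) * E = (J0 * N0).transpose := by
  obtain ⟨E, hE, hj, hn'⟩ := hg.exists_frame_quaternion hn.skew hn.anti hn.sq
  obtain ⟨hEF, hdet⟩ := frame_inv hE
  have key : ∀ k k0 : Mat, k * E = E * k0 → E.transpose * (k.transpose * g) * E =
      k0.transpose := by
    intro k k0 hk
    calc E.transpose * (k.transpose * g) * E = (k * E).transpose * g * E := by
          rw [Matrix.transpose_mul]; noncomm_ring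
      _ = k0.transpose * (E.transpose * g * E) := by
          rw [hk, Matrix.transpose_mul]; noncomm_ring
      _ = _ := by rw [hE, Matrix.mul_one]
  refine ⟨E, E.transpose * g, hE, hEF, hdet, key _ _ hj, key _ _ hn', key _ _ ?_⟩
  rw [Matrix.mul_assoc, hn', ← Matrix.mul_assoc, hj, Matrix.mul_assoc]

/-- Wedging with a nondegenerate 2-form is injective on 1-forms in dimension four. The solution
found here is `x = b ∘ (J0 N0)`. -/
theorem frame_lee {x b : Fin 4 → ℝ}
    (h : wedge12 x J0.transpose = wedge12 b N0.transpose) :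
    x 0 = b 3 ∧ x 1 = b 2 ∧ x 2 = -b 1 ∧ x 3 = -b 0 := by
  have h1 := congrFun (congrFun (congrFun h 0) 1) 2
  have h2 := congrFun (congrFun (congrFun h 0) 1) 3
  have h3 := congrFun (congrFun (congrFun h 0) 2) 3
  have h4 := congrFun (congrFun (congrFun h 1) 2) 3
  simp [wedge12, J0, N0] at h1 h2 h3 h4
  exact ⟨h3, h4, h1, h2⟩

/-- The hypothesis amounts to `x = b ∘ (j n)` in an adapted frame, and the conclusion is then an
identity between quaternion units, checked on components and carried back. -/
theorem IsQuat.lee_rotate (hg : IsHerm g j) (hn : IsQuat g j n) {x b : Fin 4 → ℝ}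
    (h : wedge12 x (j.transpose * g) = wedge12 b (n.transpose * g)) (i k l : Fin 4) :
    wedge12 x (n.transpose * g) i k l = -wedge12 b (j.transpose * g) i k l := by
  obtain ⟨E, F, hFE, hEF, -, e1, e2, -⟩ := hn.exists_frame hg
  have h' := congrArg (pull3 E) h
  rw [← wedge12_pull, ← wedge12_pull, e1, e2] at h'
  obtain ⟨a0, a1, a2, a3⟩ := frame_lee h'
  have hF : ∀ y : Fin 4 → ℝ, F.transpose.mulVec (E.transpose.mulVec y) = y := by
    intro y
    rw [Matrix.mulVec_mulVec, ← Matrix.transpose_mul, hEF, Matrix.transpose_one, Matrix.one_mulVec]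
  have hF2 : ∀ η : Mat, F.transpose * (E.transpose * η * E) * F = η := by
    intro η
    calc F.transpose * (E.transpose * η * E) * F = (E * F).transpose * η * (E * F) := by
          rw [Matrix.transpose_mul]; noncomm_ring
      _ = η := by rw [hEF]; simp
  set x' := E.transpose.mulVec x
  set b' := E.transpose.mulVec b
  have main : wedge12 x' N0.transpose = wedge12 (-b') J0.transpose := by
    funext p q r
    simp only [wedge12, Matrix.transpose_apply, Pi.neg_apply]
    fin_cases p <;> fin_cases q <;> fin_cases r <;> simp [J0, N0, a0, a1, a2, a3]
  rw [← e1, ← e2] at main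
  have := congrArg (pull3 F) main
  rw [← wedge12_pull, ← wedge12_pull, hF2, hF2, hF, Matrix.mulVec_neg, hF] at this
  rw [this]
  simp [wedge12]; ring

/-- Here `a = t b`, and in an adapted frame the 4-form `x ∧ b ∧ g(j n ·, ·)` is, up to sign, the
squared length of `b` times the volume form; hence `t = 0`. -/
theorem IsQuat.lee_nondegenerate (hg : IsHerm g j) (hn : IsQuat g j n) {x a b : Fin 4 → ℝ}
    (h : wedge12 x (j.transpose * g) = wedge12 b (n.transpose * g))
    (hab : ∀ i k, a i * b k = a k * b i) (hb : b ≠ 0)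
    (h0 : wedge13 x (wedge12 a ((j * n).transpose * g)) = 0) : a = 0 := by
  obtain ⟨E, F, hFE, hEF, -, e1, e2, e3⟩ := hn.exists_frame hg
  have hF : ∀ y : Fin 4 → ℝ, F.transpose.mulVec (E.transpose.mulVec y) = y := by
    intro y
    rw [Matrix.mulVec_mulVec, ← Matrix.transpose_mul, hEF, Matrix.transpose_one, Matrix.one_mulVec]
  obtain ⟨k, hk⟩ := Function.ne_iff.1 hb
  have hat : a = (a k / b k) • b := by
    funext i
    have := hab i k
    have hk' : b k ≠ 0 := hk
    simp only [Pi.smul_apply, smul_eq_mul]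
    field_simp
    linarith
  set t := a k / b k
  have h' := congrArg (pull3 E) h
  rw [← wedge12_pull, ← wedge12_pull, e1, e2] at h'
  obtain ⟨a0, a1, a2, a3⟩ := frame_lee h'
  have hjn : SkewAdj g (j * n) := hn.skew.mul_anti hg hn.anti
  have w := wedge13_pull E x (isAlt3_wedge12 a (hjn.form_skew hg.symm))
  rw [h0, mul_zero, ← wedge12_pull, e3, hat, Matrix.mulVec_smul] at w
  set x' := E.transpose.mulVec x
  set b' := E.transpose.mulVec b with hb'
  have hb0 : b' ≠ 0 := by
    intro hz
    apply hb
    rw [← hF b, ← hb', hz, Matrix.mulVec_zero]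
  simp only [wedge13, wedge12, Matrix.transpose_apply, Pi.smul_apply, smul_eq_mul,
    Matrix.mul_apply, Fin.sum_univ_four] at w
  simp [J0, N0, a0, a1, a2, a3] at w
  have w' : t * (b' 0 * b' 0 + b' 1 * b' 1 + b' 2 * b' 2 + b' 3 * b' 3) = 0 := by
    linear_combination w
  rcases mul_eq_zero.1 w' with ht | hs
  · rw [hat, ht, zero_smul]
  · exfalso
    apply hb0
    have p := fun i => mul_self_nonneg (b' i)
    have p0 := p 0
    have p1 := p 1
    have p2 := p 2
    have p3 := p 3
    funext i
    fin_cases i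
    · exact mul_self_eq_zero.1 (by linarith : b' 0 * b' 0 = 0)
    · exact mul_self_eq_zero.1 (by linarith : b' 1 * b' 1 = 0)
    · exact mul_self_eq_zero.1 (by linarith : b' 2 * b' 2 = 0)
    · exact mul_self_eq_zero.1 (by linarith : b' 3 * b' 3 = 0)

end

theorem extDerivThree_congr {U : Set E4} (hU : IsOpen U)
    {ψ φ : E4 → Fin 4 → Fin 4 → Fin 4 → ℝ} (h : ∀ z ∈ U, ψ z = φ z) {y : E4} (hy : y ∈ U) :
    extDerivThree ψ y = extDerivThree φ y := by
  have e : ∀ l i j k, pderiv l (fun z => ψ z i j k) y = pderiv l (fun z => φ z i j k) y :=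
    fun l i j k => pderiv_congr_of_isOpen hU (fun z hz => by rw [h z hz]) hy l
  simp only [extDerivThree, e]

theorem extDerivThree_wedge12 {U : Set E4} (hU : IsOpen U) {x : E4 → Fin 4 → ℝ} {η : E4 → Mat}
    (hx : ∀ i, ∀ z ∈ U, ContDiffAt ℝ ∞ (fun w => x w i) z) (hη : SmoothMat U η)
    (hs : ∀ z ∈ U, (η z).transpose = -η z) {y : E4} (hy : y ∈ U) :
    extDerivThree (fun z => wedge12 (x z) (η z)) y =
      wedge22 (Matrix.of fun i j => extDerivOne x i j y) (η y) -
        wedge13 (x y) (fun i j k => extDerivTwo η i j k y) := by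
  have hd : ∀ l i j k, pderiv l (fun z => wedge12 (x z) (η z) i j k) y =
      (pderiv l (fun z => x z i) y * η y j k + x y i * pderiv l (fun z => η z j k) y) +
      (pderiv l (fun z => x z j) y * η y k i + x y j * pderiv l (fun z => η z k i) y) +
      (pderiv l (fun z => x z k) y * η y i j + x y k * pderiv l (fun z => η z i j) y) := by
    intro l i j k
    have p : ∀ i j k, ContDiffAt ℝ ∞ (fun z => x z i * η z j k) y := fun i j k =>
      (hx i y hy).mul (hη j k y hy)
    have q : ∀ i j k, pderiv l (fun z => x z i * η z j k) y =
        pderiv l (fun z => x z i) y * η y j k + x y i * pderiv l (fun z => η z j k) y :=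
      fun i j k => pderiv_mul (smooth_diff (hx i y hy)) (hη.diff hy j k) l
    simp only [wedge12]
    rw [pderiv_add (smooth_diff ((p i j k).add (p j k i))) (smooth_diff (p k i j)),
      pderiv_add (smooth_diff (p i j k)) (smooth_diff (p j k i)), q, q, q]
  have hsd : ∀ l i j, pderiv l (fun z => η z i j) y = -pderiv l (fun z => η z j i) y := by
    intro l i j
    rw [← pderiv_neg]
    exact pderiv_congr_of_isOpen hU (fun z hz => skew_apply (hs z hz) i j) hy l
  have s := skew_apply (hs y hy)
  simp only [extDerivThree, hd, wedge22, wedge13, extDerivTwo, extDerivOne, Matrix.of_apply]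
  rw [s 2 0, s 3 0, s 3 1]
  simp only [hsd _ 2 0, hsd _ 3 0, hsd _ 3 1]
  ring

/-! ### Excluding a nonzero `∇J` when `torForm` vanishes -/

namespace IsChartAH

variable {U : Set E4} {G J : E4 → Mat}

theorem mono (h : IsChartAH U G J) {V : Set E4} (hV : IsOpen V) (hVU : V ⊆ U) :
    IsChartAH V G J where
  isOpen := hV
  smoothG := h.smoothG.mono hVU
  smoothJ := h.smoothJ.mono hVU
  herm := fun y hy => h.herm y (hVU hy)
  comm := fun y hy => h.comm y (hVU hy)

/-- The exterior derivative of the 2-form associated with a skew-adjoint endomorphism field. -/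
theorem extDerivTwo_form (h : IsChartAH U G J) {M : E4 → Mat} (hM : SmoothMat U M)
    (hs : ∀ z ∈ U, SkewAdj (G z) (M z)) {y : E4} (hy : y ∈ U) (i j k : Fin 4) :
    extDerivTwo (fun z => (M z).transpose * G z) i j k y =
      ((covD G i M y).transpose * G y) j k + ((covD G j M y).transpose * G y) k i +
      ((covD G k M y).transpose * G y) i j := by
  have hd : ∀ i, mpd i (fun z => (M z).transpose * G z) y = (covD G i M y).transpose * G y +
      (chrMat G i y).transpose * ((M y).transpose * G y) +
      ((M y).transpose * G y) * chrMat G i y := by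
    intro i
    rw [mpd_mul hM.transpose h.smoothG hy, mpd_transpose, h.isMetricOn.mpd_metric hy, covD]
    simp only [Matrix.transpose_add, Matrix.transpose_sub, Matrix.transpose_mul]
    noncomm_ring
  have hsk := (hs y hy).form_skew (h.herm y hy).symm
  have e : ∀ i j k, (((M y).transpose * G y) * chrMat G i y) j k =
      -((chrMat G i y).transpose * ((M y).transpose * G y)) k j := by
    intro i j k
    rw [← Matrix.transpose_apply (_ * chrMat G i y), Matrix.transpose_mul, hsk, Matrix.mul_neg]
    rfl
  -- The connection is torsion-free, so the Christoffel terms cancel in the cyclic sum.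
  have c : ∀ i j k, ((chrMat G i y).transpose * ((M y).transpose * G y)) j k =
      ((chrMat G j y).transpose * ((M y).transpose * G y)) i k := by
    intro i j k
    rw [Matrix.mul_apply, Matrix.mul_apply]
    exact Finset.sum_congr rfl fun m _ => by
      rw [Matrix.transpose_apply, Matrix.transpose_apply, h.isMetricOn.chrMat_symm hy]
  have hd' : ∀ i j k, pderiv i (fun z => ((M z).transpose * G z) j k) y =
      ((covD G i M y).transpose * G y) j k +
      ((chrMat G i y).transpose * ((M y).transpose * G y)) j k -
      ((chrMat G i y).transpose * ((M y).transpose * G y)) k j := by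
    intro i j k
    have := congrFun (congrFun (hd i) j) k
    simp only [Matrix.add_apply, e] at this
    exact this.trans (by ring)
  rw [extDerivTwo, hd', hd', hd', c j i k, c k i j, c k j i]
  ring

/-- With `∇J = β ⊗ N` and `β ≠ 0`, closedness of `θ` forces `∇N = -β ⊗ J`. The curvature then
commutes with both `J` and `N`, which kills the Ricci form. -/
theorem quaternion_contradiction (h : IsChartAH U G J)
    (hs : ∀ z ∈ U, ricciDensity G J z ≠ 0) {N : E4 → Mat} (hN : SmoothMat U N)
    (hq : ∀ z ∈ U, IsQuat (G z) (J z) (N z)) {β θ : E4 → Fin 4 → ℝ}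
    (hβ : ∀ i, ∀ z ∈ U, ContDiffAt ℝ ∞ (fun w => β w i) z)
    (hK : ∀ i, ∀ z ∈ U, covD G i J z = β z i • N z) (hβ0 : ∀ z ∈ U, β z ≠ 0)
    (hθ : ∀ i, ∀ z ∈ U, ContDiffAt ℝ ∞ (fun w => θ w i) z)
    (hdθ : ∀ z ∈ U, ∀ i j, extDerivOne θ i j z = 0)
    (hlee : ∀ z ∈ U, ∀ i j k, extDerivTwo (fundForm G J) i j k z =
      wedge12 (θ z) (fundForm G J z) i j k) {y : E4} (hy : y ∈ U) : False := by
  have trN : ∀ z ∈ U, (N z * N z).trace = -4 := fun z hz => by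
    rw [(hq z hz).sq, trace_neg_one]
  have trJ : ∀ z ∈ U, (J z).trace = 0 := fun z hz => trace_skewAdj (h.herm z hz) (h.herm z hz).skew
  have jnn : ∀ z ∈ U, J z * N z * N z = -J z := fun z hz => by
    rw [Matrix.mul_assoc, (hq z hz).sq]; simp
  have hJNt : ∀ z ∈ U, (J z * N z).trace = 0 := fun z hz =>
    trace_skewAdj (h.herm z hz) ((hq z hz).skew.mul_anti (h.herm z hz) (hq z hz).anti)
  -- The field `T_i = ∇_i N + β_i J` is skew-adjoint. It anticommutes with `J`, by differentiating
  -- `NJ + JN = 0`, and satisfies `tr (T_i N) = 0`, by differentiating `tr N² = -4`. Only a `JN`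
  -- component remains.
  obtain ⟨α, hα⟩ : ∃ α : E4 → Fin 4 → ℝ, ∀ z ∈ U, ∀ i,
      covD G i N z = -(β z i • J z) + α z i • (J z * N z) := by
    refine ⟨fun z i => -(1 / 4 : ℝ) * ((covD G i N z + β z i • J z) * (J z * N z)).trace,
      fun z hz i => ?_⟩
    have a1 : SkewAdj (G z) (covD G i N z) :=
      h.skewAdj_covD h.isOpen subset_rfl hN (fun w hw => (hq w hw).skew) hz i
    have a2 := (h.herm z hz).skew
    have hT : SkewAdj (G z) (covD G i N z + β z i • J z) := by
      unfold SkewAdj at a1 a2 ⊢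
      have : (covD G i N z + β z i • J z).transpose * G z + G z * (covD G i N z + β z i • J z) =
          ((covD G i N z).transpose * G z + G z * covD G i N z) +
          β z i • ((J z).transpose * G z + G z * J z) := by
        simp only [Matrix.transpose_add, Matrix.transpose_smul, Matrix.add_mul, Matrix.mul_add,
          Matrix.smul_mul, Matrix.mul_smul, smul_add]
        abel
      rw [this, a1, a2]; simp
    have hD : covD G i N z * J z + N z * covD G i J z + (covD G i J z * N z +
        J z * covD G i N z) = 0 := by
      rw [← covD_mul hN h.smoothJ hz, ← covD_mul h.smoothJ hN hz,
        ← covD_add (hN.mul h.smoothJ) (h.smoothJ.mul hN) hz,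
        covD_congr (N := fun _ => 0) h.isOpen (fun w hw => by
          rw [(hq w hw).anti]; simp) hz i]
      simp [covD]
    have hTa : (covD G i N z + β z i • J z) * J z = -(J z * (covD G i N z + β z i • J z)) := by
      rw [hK i z hz, Matrix.mul_smul, Matrix.smul_mul, (hq z hz).sq] at hD
      rw [Matrix.add_mul, Matrix.mul_add, Matrix.mul_smul, Matrix.smul_mul, (h.herm z hz).sq,
        eq_neg_iff_add_eq_zero, ← hD]
      abel
    have hT1 : ((covD G i N z + β z i • J z) * N z).trace = 0 := by
      have e1 : 2 * (covD G i N z * N z).trace = 0 := by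
        have := pderiv_trace_covD (G := G) (hN.mul hN) hz i
        rw [covD_mul hN hN hz, Matrix.trace_add, Matrix.trace_mul_comm (N z),
          pderiv_congr_of_isOpen (g := fun _ => -4) h.isOpen trN hz i, pderiv_const] at this
        linarith
      rw [Matrix.add_mul, Matrix.trace_add, Matrix.smul_mul, Matrix.trace_smul, hJNt z hz,
        smul_zero]
      linarith
    have := (hq z hz).decomp (h.herm z hz) hT hTa
    rw [hT1, mul_zero, zero_smul, zero_add] at this
    rw [← this]; abel
  -- The symmetry of `∇²J` for `∇J = β ⊗ N`; the `J` terms `β_i β_j` cancel. The components along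
  -- `N` and `JN` give `dβ = 0` and `α ∧ β = 0`.
  have hsym : ∀ z ∈ U, ∀ i j, (pderiv i (fun w => β w j) z - pderiv j (fun w => β w i) z) • N z +
      (β z j * α z i - β z i * α z j) • (J z * N z) = 0 := by
    intro z hz i j
    have e := h.covD_covDJ_symm hz i j
    have c : ∀ i j, covD G i (covD G j J) z = pderiv i (fun w => β w j) z • N z +
        β z j • (-(β z i • J z) + α z i • (J z * N z)) := by
      intro i j
      rw [covD_congr h.isOpen (fun w hw => hK j w hw) hz i, covD_smul (hβ j z hz) hN hz,
        hα z hz]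
    rw [c, c, ← sub_eq_zero] at e
    rw [← e]
    module
  have hdβ : ∀ z ∈ U, ∀ i j, extDerivOne β i j z = 0 := by
    intro z hz i j
    have e := congrArg (fun A : Mat => (A * N z).trace) (hsym z hz i j)
    simp only [Matrix.add_mul, Matrix.smul_mul, Matrix.trace_add, Matrix.trace_smul, trN z hz,
      jnn z hz, Matrix.trace_neg, trJ z hz, Matrix.zero_mul, Matrix.trace_zero, smul_eq_mul] at e
    rw [extDerivOne]; linarith
  have hαβ : ∀ z ∈ U, ∀ i j, α z i * β z j = α z j * β z i := by
    intro z hz i j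
    have d := hdβ z hz i j
    rw [extDerivOne] at d
    have e := hsym z hz i j
    rw [d, zero_smul, zero_add] at e
    have e2 := congrArg (fun A : Mat => (A * (J z * N z)).trace) e
    simp only [Matrix.smul_mul, (hq z hz).jn_sq (h.herm z hz), Matrix.trace_smul, trace_neg_one,
      Matrix.zero_mul, Matrix.trace_zero, smul_eq_mul] at e2
    linarith
  have hlee' : ∀ z ∈ U, wedge12 (θ z) ((J z).transpose * G z) =
      wedge12 (β z) ((N z).transpose * G z) := by
    intro z hz
    funext i j k
    have e := h.extDerivTwo_form h.smoothJ (fun w hw => (h.herm w hw).skew) hz i j k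
    rw [hK i z hz, hK j z hz, hK k z hz] at e
    rw [← show fundForm G J z = (J z).transpose * G z from rfl, ← hlee z hz i j k]
    refine e.trans ?_
    simp only [Matrix.transpose_smul, Matrix.smul_mul, Matrix.smul_apply, smul_eq_mul, wedge12]
  have hα0 : ∀ z ∈ U, ∀ i, α z i = 0 := by
    intro z hz
    have hnsm : SmoothMat U fun w => (N w).transpose * G w := hN.transpose.mul h.smoothG
    have w1 := extDerivThree_wedge12 h.isOpen hθ hnsm
      (fun w hw => (hq w hw).skew.form_skew (h.herm w hw).symm) hz
    have w2 := extDerivThree_wedge12 h.isOpen (x := fun w i => -β w i)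
      (fun i w hw => (hβ i w hw).neg) h.smooth_fundForm (fun w hw => h.fundForm_skew hw) hz
    -- Both sides of `θ ∧ ω_N = -β ∧ ω` are now differentiated. As `dθ = dβ = 0`, there remain `θ ∧
    -- dω_N` and `β ∧ dω`; everything but `θ ∧ α ∧ ω_JN` contains `β` twice after `θ ∧ ω = β ∧ ω_N`
    -- is substituted.
    have hrot : ∀ w ∈ U, wedge12 (θ w) ((N w).transpose * G w) =
        wedge12 (fun i => -β w i) (fundForm G J w) := by
      intro w hw
      funext i j k
      rw [(hq w hw).lee_rotate (h.herm w hw) (hlee' w hw)]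
      simp only [wedge12, fundForm]; ring
    rw [extDerivThree_congr h.isOpen hrot hz, w2] at w1
    have z1 : (Matrix.of fun i j => extDerivOne (fun w i => -β w i) i j z) = 0 := by
      ext i j
      have := hdβ z hz i j
      simp only [extDerivOne] at this
      simp only [extDerivOne, Matrix.of_apply, pderiv_neg, Matrix.zero_apply]
      linarith
    have z2 : (Matrix.of fun i j => extDerivOne θ i j z) = 0 := by
      ext i j; exact hdθ z hz i j
    have z3 : (fun i j k => extDerivTwo (fundForm G J) i j k z) =
        wedge12 (β z) ((N z).transpose * G z) := by
      funext i j k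
      rw [hlee z hz, ← hlee' z hz]; rfl
    have z4 : (fun i j k => extDerivTwo (fun w => (N w).transpose * G w) i j k z) =
        fun i j k => -wedge12 (β z) (fundForm G J z) i j k +
          wedge12 (α z) ((J z * N z).transpose * G z) i j k := by
      funext i j k
      rw [h.extDerivTwo_form hN (fun w hw => (hq w hw).skew) hz, hα z hz, hα z hz, hα z hz]
      simp only [Matrix.transpose_add, Matrix.transpose_neg, Matrix.transpose_smul,
        Matrix.add_mul, Matrix.neg_mul, Matrix.smul_mul, Matrix.add_apply, Matrix.neg_apply,
        Matrix.smul_apply, smul_eq_mul, wedge12, fundForm]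
      ring
    rw [z1, z2, z3, z4] at w1
    have sn := skew_apply ((hq z hz).skew.form_skew (h.herm z hz).symm)
    have so := skew_apply (h.fundForm_skew hz)
    have y1 : wedge13 (fun i => -β z i) (wedge12 (β z) ((N z).transpose * G z)) = 0 := by
      simp only [wedge13, wedge12]
      rw [sn 2 0, sn 3 0, sn 3 1]; ring
    have y2 : wedge13 (θ z) (wedge12 (β z) (fundForm G J z)) =
        -wedge13 (β z) (wedge12 (θ z) (fundForm G J z)) := by
      simp only [wedge13, wedge12]
      rw [so 2 0, so 3 0, so 3 1]; ring
    have y3 : wedge13 (β z) (wedge12 (θ z) (fundForm G J z)) = 0 := by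
      rw [show fundForm G J z = (J z).transpose * G z from rfl, hlee' z hz]
      simp only [wedge13, wedge12]
      rw [sn 2 0, sn 3 0, sn 3 1]; ring
    rw [y3, neg_zero] at y2
    have y4 : wedge13 (θ z) (wedge12 (α z) ((J z * N z).transpose * G z)) = 0 := by
      simp only [wedge22, Matrix.zero_apply, zero_mul, y1] at w1
      simp only [wedge13] at w1 y2 ⊢
      linarith
    have := (hq z hz).lee_nondegenerate (h.herm z hz) (hlee' z hz) (hαβ z hz) (hβ0 z hz) y4
    intro i
    rw [this]; rfl
  have hDN : ∀ i, ∀ z ∈ U, covD G i N z = -(β z i • J z) := by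
    intro i z hz
    rw [hα z hz, hα0 z hz, zero_smul, add_zero]
  -- From `∇N = -β ⊗ J`, `∇J = β ⊗ N` and `dβ = 0` the second derivatives of `N` are symmetric, so
  -- `[R_ij, N] = 0`. This commutator is also `-½ ρ_ij JN`.
  have hρ : ricciForm G J y = 0 := by
    ext i j
    have c := h.isMetricOn.covD_comm hN hy i j
    have d : ∀ i j, covD G i (covD G j N) y = -(pderiv i (fun w => β w j) y • J y +
        β y j • (β y i • N y)) := by
      intro i j
      rw [covD_congr h.isOpen (hDN j) hy i, covD_neg, covD_smul (hβ j y hy) h.smoothJ hy,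
        hK i y hy]
    rw [d, d, (h.herm y hy).commutator_mixed (h.isMetricOn.curvMat_skew hy i j) (h.comm y hy i j)
      (hq y hy).skew (hq y hy).anti] at c
    have hd := hdβ y hy i j
    rw [extDerivOne, sub_eq_zero] at hd
    have c' : (-(1 / 2 : ℝ) * (J y * curvMat G i j y).trace) • (J y * N y) = 0 := by
      rw [← c, hd]; module
    have c2 := congrArg (fun A : Mat => (A * (J y * N y)).trace) c'
    simp only [Matrix.smul_mul, (hq y hy).jn_sq (h.herm y hy), Matrix.trace_smul, trace_neg_one,
      Matrix.zero_mul, Matrix.trace_zero, smul_eq_mul] at c2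
    change (J y * curvMat G i j y).trace = 0
    linarith
  apply hs y hy
  rw [ricciDensity, hρ]; simp [wedge22]

/-- A locally conformally almost Kähler structure of class `AH₁` with `torForm = 0` and
nondegenerate Ricci density has parallel almost complex structure. -/
theorem parallel (h : IsChartAH U G J) (hs : ∀ z ∈ U, ricciDensity G J z ≠ 0)
    (hb : ∀ z ∈ U, torForm G J z = 0) {θ : E4 → Fin 4 → ℝ}
    (hθ : ∀ i, ∀ z ∈ U, ContDiffAt ℝ ∞ (fun w => θ w i) z)
    (hdθ : ∀ z ∈ U, ∀ i j, extDerivOne θ i j z = 0)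
    (hlee : ∀ z ∈ U, ∀ i j k, extDerivTwo (fundForm G J) i j k z =
      wedge12 (θ z) (fundForm G J z) i j k) {y : E4} (hy : y ∈ U) (m : Fin 4) :
    covD G m J y = 0 := by
  by_contra hne
  -- Normalised so that `(∇_m J)² = -ν`. On the open set `ν > 0`, dividing `∇_m J` by `√ν` gives a
  -- smooth quaternionic companion.
  set ν : E4 → ℝ := fun z => -(1 / 4 : ℝ) * (covD G m J z * covD G m J z).trace with hν
  have hνs : ∀ z ∈ U, ContDiffAt ℝ ∞ ν z := fun z hz =>
    contDiffAt_const.mul (((h.smooth_covDJ m).mul (h.smooth_covDJ m)).trace hz)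
  have hsq : ∀ z ∈ U, covD G m J z * covD G m J z = (-ν z) • (1 : Mat) := by
    intro z hz
    rw [((h.herm z hz).sq_anti (h.skewAdj hz m) (h.anti hz m)).1]
    congr 1
    simp [hν]
  set V : Set E4 := U ∩ ν ⁻¹' Set.Ioi 0 with hVdef
  have hV : IsOpen V := ContinuousOn.isOpen_inter_preimage
    (fun z hz => (hνs z hz).continuousAt.continuousWithinAt) h.isOpen isOpen_Ioi
  have hVU : V ⊆ U := Set.inter_subset_left
  have hyV : y ∈ V := by
    refine ⟨hy, ?_⟩
    obtain ⟨-, h2, h3⟩ := (h.herm y hy).sq_anti (h.skewAdj hy m) (h.anti hy m)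
    have : (covD G m J y * covD G m J y).trace ≠ 0 := fun h0 => hne (h3 h0)
    have := lt_of_le_of_ne h2 this
    simp only [Set.mem_preimage, Set.mem_Ioi, hν]
    linarith
  set r : E4 → ℝ := fun z => (Real.sqrt (ν z))⁻¹ with hr
  have hr0 : ∀ z ∈ V, 0 < r z := fun z hz => inv_pos.2 (Real.sqrt_pos.2 hz.2)
  have hrr : ∀ z ∈ V, r z * r z * ν z = 1 := by
    intro z hz
    have := Real.mul_self_sqrt (le_of_lt hz.2)
    have h0 := (Real.sqrt_pos.2 hz.2).ne'
    simp only [hr]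
    field_simp
    nlinarith
  have hrs : ∀ z ∈ V, ContDiffAt ℝ ∞ r z := fun z hz =>
    ((hνs z (hVU hz)).sqrt (ne_of_gt hz.2)).inv (Real.sqrt_pos.2 hz.2).ne'
  set N : E4 → Mat := fun z => r z • covD G m J z with hNdef
  have hN : SmoothMat V N := SmoothMat.smul hrs ((h.smooth_covDJ m).mono hVU)
  have hq : ∀ z ∈ V, IsQuat (G z) (J z) (N z) := by
    intro z hz
    refine ⟨?_, ?_, ?_⟩
    · have := h.skewAdj (hVU hz) m
      unfold SkewAdj at this ⊢
      simp only [hNdef, Matrix.transpose_smul, Matrix.smul_mul, Matrix.mul_smul, ← smul_add,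
        this, smul_zero]
    · simp only [hNdef, Matrix.smul_mul, Matrix.mul_smul, h.anti (hVU hz), smul_neg]
    · simp only [hNdef, Matrix.smul_mul, Matrix.mul_smul, hsq z (hVU hz), smul_smul]
      rw [show r z * (r z * -ν z) = -1 by linear_combination -hrr z hz]
      simp
  -- The `JN` component of `∇_i J` is a multiple of `tr (J ∇_i J ∇_m J)`, an entry of `torForm`.
  have hK : ∀ i, ∀ z ∈ V, covD G i J z = (-(1 / 4 : ℝ) * (covD G i J z * N z).trace) • N z := by
    intro i z hz
    have d := (hq z hz).decomp (h.herm z (hVU hz)) (h.skewAdj (hVU hz) i) (h.anti (hVU hz) i)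
    have : (covD G i J z * (J z * N z)).trace = 0 := by
      have e := congrFun (congrFun (hb z (hVU hz)) i) m
      simp only [torForm, Matrix.of_apply, Matrix.zero_apply] at e
      rw [← Matrix.mul_assoc, h.anti (hVU hz), Matrix.neg_mul, Matrix.trace_neg]
      simp only [hNdef, Matrix.mul_smul, Matrix.trace_smul, e, smul_zero, neg_zero]
    rwa [this, mul_zero, zero_smul, add_zero] at d
  refine (h.mono hV hVU).quaternion_contradiction (fun z hz => hs z (hVU hz)) hN hq
    (β := fun z i => -(1 / 4 : ℝ) * (covD G i J z * N z).trace)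
    (fun i z hz => contDiffAt_const.mul ((((h.smooth_covDJ i).mono hVU).mul hN).trace hz)) hK
    (fun z hz h0 => ?_) (fun i z hz => hθ i z (hVU hz)) (fun z hz => hdθ z (hVU hz))
    (fun z hz => hlee z (hVU hz)) hyV
  -- The component `β_m` equals `r ν = √ν`, which is positive on `V`.
  have e := congrFun h0 m
  simp only [hNdef, Matrix.mul_smul, Matrix.trace_smul, hsq z (hVU hz), trace_one_four,
    smul_eq_mul, Pi.zero_apply] at e
  have p := mul_pos (hr0 z hz) hz.2
  linarith

end IsChartAH

/-! ### Change of coordinates -/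

/-- The Jacobian matrix `∂_i φ^a`. -/
def jacMat (φ : E4 → E4) (z : E4) : Mat := Matrix.of fun a i => pderiv i (fun w => φ w a) z

/-- The structures `(G, J)` on `U` and `(G', J')` on `V` are related by the coordinate change
`φ`. -/
structure IsCoordChange (U V : Set E4) (φ : E4 → E4) (G J G' J' : E4 → Mat) : Prop where
  src : IsChartAH U G J
  tgt : IsChartAH V G' J'
  maps : ∀ z ∈ V, φ z ∈ U
  smooth : ∀ z ∈ V, ContDiffAt ℝ ∞ φ z
  metric : ∀ z ∈ V, G' z = (jacMat φ z).transpose * G (φ z) * jacMat φ z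
  acs : ∀ z ∈ V, jacMat φ z * J' z = J (φ z) * jacMat φ z

namespace IsCoordChange

variable {U V : Set E4} {φ : E4 → E4} {G J G' J' : E4 → Mat}

theorem smooth_coord (h : IsCoordChange U V φ G J G' J') {z : E4} (hz : z ∈ V) (a : Fin 4) :
    ContDiffAt ℝ ∞ (fun w => φ w a) z :=
  (EuclideanSpace.proj a : E4 →L[ℝ] ℝ).contDiff.contDiffAt.comp z (h.smooth z hz)

theorem smooth_jacMat (h : IsCoordChange U V φ G J G' J') : SmoothMat V (jacMat φ) :=
  fun a i _ hz => contDiffAt_pderiv (h.smooth_coord hz a) i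

theorem det_ne (h : IsCoordChange U V φ G J G' J') {z : E4} (hz : z ∈ V) :
    (jacMat φ z).det ≠ 0 := by
  intro h0
  have := h.tgt.isMetricOn.det_ne z hz
  rw [h.metric z hz, Matrix.det_mul, h0, mul_zero] at this
  exact this rfl

theorem mpd_jacMat_symm (h : IsCoordChange U V φ G J G' J') {z : E4} (hz : z ∈ V)
    (i j k : Fin 4) : mpd i (jacMat φ) z k j = mpd j (jacMat φ) z k i :=
  pderiv_comm (h.smooth_coord hz k) i j

theorem smooth_comp (h : IsCoordChange U V φ G J G' J') {M : E4 → Mat} (hM : SmoothMat U M) :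
    SmoothMat V fun z => M (φ z) :=
  fun a b z hz => (hM a b (φ z) (h.maps z hz)).comp z (h.smooth z hz)

theorem mpd_comp (h : IsCoordChange U V φ G J G' J') {M : E4 → Mat} (hM : SmoothMat U M)
    {z : E4} (hz : z ∈ V) (i : Fin 4) :
    mpd i (fun w => M (φ w)) z = ∑ a, jacMat φ z a i • mpd a M (φ z) := by
  ext b c
  rw [Matrix.sum_apply]
  exact pderiv_comp (hM.diff (h.maps z hz) b c) (smooth_diff' (h.smooth z hz)) i
where
  smooth_diff' {z : E4} (hz : ContDiffAt ℝ ∞ φ z) : DifferentiableAt ℝ φ z :=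
    hz.differentiableAt (by simp)

/-- The pulled back connection matrices. -/
def pullChr (G : E4 → Mat) (φ : E4 → E4) (i : Fin 4) (z : E4) : Mat :=
  ∑ a, jacMat φ z a i • chrMat G a (φ z)

/-- The candidate obtained by solving the transformation law is symmetric, because second partials
of `φ` commute, and compatible with the pulled-back metric. Uniqueness of the Levi-Civita connection
identifies it. -/
theorem chrMat_change (h : IsCoordChange U V φ G J G' J') {z : E4} (hz : z ∈ V) (i : Fin 4) :
    jacMat φ z * chrMat G' i z = mpd i (jacMat φ) z + pullChr G φ i z * jacMat φ z := by
  set P := jacMat φ z with hP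
  have hu := (h.det_ne hz).isUnit
  set X : Fin 4 → Mat := fun i => mpd i (jacMat φ) z + pullChr G φ i z * P with hX
  have hXs : ∀ i j m, X i m j = X j m i := by
    intro i j m
    simp only [hX, Matrix.add_apply, h.mpd_jacMat_symm hz i j, pullChr, Finset.sum_mul,
      Matrix.sum_apply, Matrix.smul_mul, Matrix.smul_apply, Matrix.mul_apply, smul_eq_mul,
      Finset.mul_sum]
    congr 1
    rw [Finset.sum_comm]
    refine Finset.sum_congr rfl fun a _ => Finset.sum_congr rfl fun b _ => ?_
    rw [h.src.isMetricOn.chrMat_symm (h.maps z hz) b a]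
    ring
  have hPX : ∀ i, P * (P⁻¹ * X i) = X i := fun i => by
    rw [← Matrix.mul_assoc, Matrix.mul_nonsing_inv _ hu, Matrix.one_mul]
  have hc := h.tgt.isMetricOn.chrMat_unique hz (fun i => P⁻¹ * X i) ?_ ?_ i
  · rw [hc, hPX]
  · intro i j k
    simp only [Matrix.mul_apply]
    exact Finset.sum_congr rfl fun m _ => by rw [hXs]
  · intro i
    have hG := h.smooth_comp h.src.smoothG
    have hPs := h.smooth_jacMat
    rw [mpd_congr_of_isOpen h.tgt.isOpen h.metric hz, mpd_mul (hPs.transpose.mul hG) hPs hz,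
      mpd_mul hPs.transpose hG hz, mpd_transpose, h.mpd_comp h.src.smoothG hz, h.metric z hz,
      ← hP]
    have e1 : (P⁻¹ * X i).transpose * (P.transpose * G (φ z) * P) =
        (X i).transpose * G (φ z) * P := by
      calc (P⁻¹ * X i).transpose * (P.transpose * G (φ z) * P)
          = (P * (P⁻¹ * X i)).transpose * G (φ z) * P := by
            rw [Matrix.transpose_mul P]; noncomm_ring
        _ = _ := by rw [hPX]
    have e2 : P.transpose * G (φ z) * P * (P⁻¹ * X i) = P.transpose * G (φ z) * X i := by
      rw [Matrix.mul_assoc, hPX]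
    rw [e1, e2]
    have e3 : ∑ a, P a i • mpd a G (φ z) =
        (pullChr G φ i z).transpose * G (φ z) + G (φ z) * pullChr G φ i z := by
      simp only [pullChr, Matrix.transpose_sum, Finset.sum_mul, Finset.mul_sum,
        Matrix.transpose_smul, Matrix.smul_mul, Matrix.mul_smul, ← Finset.sum_add_distrib,
        ← smul_add]
      exact Finset.sum_congr rfl fun a _ => by
        rw [h.src.isMetricOn.mpd_metric (h.maps z hz)]
    rw [e3]
    simp only [hX, Matrix.transpose_add, Matrix.transpose_mul]
    noncomm_ring

theorem covD_change (h : IsCoordChange U V φ G J G' J') {M M' : E4 → Mat} (hM : SmoothMat U M)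
    (hM' : SmoothMat V M') (hMM : ∀ z ∈ V, jacMat φ z * M' z = M (φ z) * jacMat φ z) {z : E4}
    (hz : z ∈ V) (i : Fin 4) :
    jacMat φ z * covD G' i M' z = (∑ a, jacMat φ z a i • covD G a M (φ z)) * jacMat φ z := by
  have hPs := h.smooth_jacMat
  have e := mpd_congr_of_isOpen h.tgt.isOpen hMM hz i
  rw [mpd_mul hPs hM' hz, mpd_mul (h.smooth_comp hM) hPs hz, h.mpd_comp hM hz] at e
  have c := h.chrMat_change hz i
  have m := hMM z hz
  have s : ∑ a, jacMat φ z a i • covD G a M (φ z) = (∑ a, jacMat φ z a i • mpd a M (φ z)) +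
      pullChr G φ i z * M (φ z) - M (φ z) * pullChr G φ i z := by
    simp only [covD, pullChr, Finset.sum_mul, Finset.mul_sum, Matrix.smul_mul, Matrix.mul_smul,
      ← Finset.sum_add_distrib, ← Finset.sum_sub_distrib, ← smul_add, ← smul_sub]
  rw [s]
  set P := jacMat φ z
  set A := ∑ a, P a i • mpd a M (φ z)
  set B := pullChr G φ i z
  calc P * covD G' i M' z = P * mpd i M' z + (P * chrMat G' i z) * M' z
        - (P * M' z) * chrMat G' i z := by rw [covD]; noncomm_ring
    _ = P * mpd i M' z + (mpd i (jacMat φ) z + B * P) * M' z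
        - (M (φ z) * P) * chrMat G' i z := by rw [c, m]
    _ = (mpd i (jacMat φ) z * M' z + P * mpd i M' z) + B * (P * M' z)
        - M (φ z) * (P * chrMat G' i z) := by noncomm_ring
    _ = _ := by rw [e, c, m]; noncomm_ring

theorem smooth_pullChr (h : IsCoordChange U V φ G J G' J') (i : Fin 4) :
    SmoothMat V (pullChr G φ i) :=
  SmoothMat.sum fun a => SmoothMat.smul (fun z hz => h.smooth_jacMat a i z hz)
    (h.smooth_comp (h.src.isMetricOn.smooth_chrMat a))

theorem mpd_pullChr (h : IsCoordChange U V φ G J G' J') {z : E4} (hz : z ∈ V) (i j : Fin 4) :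
    mpd i (pullChr G φ j) z = ∑ b, mpd i (jacMat φ) z b j • chrMat G b (φ z) +
      ∑ a, ∑ b, (jacMat φ z a i * jacMat φ z b j) • mpd a (chrMat G b) (φ z) := by
  have hc := h.src.isMetricOn.smooth_chrMat
  have hs : ∀ b, SmoothMat V fun w => jacMat φ w b j • chrMat G b (φ w) := fun b =>
    SmoothMat.smul (fun z hz => h.smooth_jacMat b j z hz) (h.smooth_comp (hc b))
  have e := mpd_sum hs hz i
  rw [show pullChr G φ j = fun w => ∑ b, jacMat φ w b j • chrMat G b (φ w) from rfl, e]
  rw [Finset.sum_comm (f := fun a b => (jacMat φ z a i * jacMat φ z b j) • _),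
    ← Finset.sum_add_distrib]
  refine Finset.sum_congr rfl fun b _ => ?_
  rw [mpd_smul (h.smooth_jacMat b j z hz) (h.smooth_comp (hc b)) hz, h.mpd_comp (hc b) hz,
    Finset.smul_sum]
  congr 1
  exact Finset.sum_congr rfl fun a _ => by rw [smul_smul, mul_comm]

/-- Differentiate the law `P Γ' = dP + (φ^* Γ) P` and antisymmetrise: the second derivatives of the
Jacobian matrix `P` cancel, and the first derivatives are absorbed by the same law. -/
theorem curvMat_change (h : IsCoordChange U V φ G J G' J') {z : E4} (hz : z ∈ V) (i j : Fin 4) :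
    jacMat φ z * curvMat G' i j z =
      (∑ a, ∑ b, (jacMat φ z a i * jacMat φ z b j) • curvMat G a b (φ z)) * jacMat φ z := by
  have hPs := h.smooth_jacMat
  have key : ∀ i j, mpd i (jacMat φ) z * chrMat G' j z + jacMat φ z * mpd i (chrMat G' j) z =
      mpd i (mpd j (jacMat φ)) z + (mpd i (pullChr G φ j) z * jacMat φ z +
        pullChr G φ j z * mpd i (jacMat φ) z) := by
    intro i j
    have e := mpd_congr_of_isOpen h.tgt.isOpen (fun w hw => h.chrMat_change hw j) hz i
    rwa [mpd_mul hPs (h.tgt.isMetricOn.smooth_chrMat j) hz,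
      mpd_add (hPs.mpd j) ((h.smooth_pullChr j).mul hPs) hz,
      mpd_mul (h.smooth_pullChr j) hPs hz] at e
  have s : ∑ a, ∑ b, (jacMat φ z a i * jacMat φ z b j) • curvMat G a b (φ z) =
      mpd i (pullChr G φ j) z - mpd j (pullChr G φ i) z +
      (pullChr G φ i z * pullChr G φ j z - pullChr G φ j z * pullChr G φ i z) := by
    have s1 : ∑ a, ∑ b, (jacMat φ z a i * jacMat φ z b j) • mpd b (chrMat G a) (φ z) =
        ∑ a, ∑ b, (jacMat φ z a j * jacMat φ z b i) • mpd a (chrMat G b) (φ z) := by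
      rw [Finset.sum_comm]
      exact Finset.sum_congr rfl fun _ _ => Finset.sum_congr rfl fun _ _ => by rw [mul_comm]
    have s2 : pullChr G φ i z * pullChr G φ j z = ∑ a, ∑ b,
        (jacMat φ z a i * jacMat φ z b j) • (chrMat G a (φ z) * chrMat G b (φ z)) := by
      simp only [pullChr, Finset.sum_mul, Finset.mul_sum, Matrix.smul_mul, Matrix.mul_smul,
        smul_smul]
      rw [Finset.sum_comm]
      exact Finset.sum_congr rfl fun _ _ => Finset.sum_congr rfl fun _ _ => by rw [mul_comm]
    have s3 : pullChr G φ j z * pullChr G φ i z = ∑ a, ∑ b,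
        (jacMat φ z a i * jacMat φ z b j) • (chrMat G b (φ z) * chrMat G a (φ z)) := by
      simp only [pullChr, Finset.sum_mul, Finset.mul_sum, Matrix.smul_mul, Matrix.mul_smul,
        smul_smul]
    have s4 : ∑ b, mpd i (jacMat φ) z b j • chrMat G b (φ z) =
        ∑ b, mpd j (jacMat φ) z b i • chrMat G b (φ z) :=
      Finset.sum_congr rfl fun b _ => by rw [h.mpd_jacMat_symm hz i j b]
    rw [h.mpd_pullChr hz, h.mpd_pullChr hz, s4, ← s1, s2, s3]
    simp only [curvMat_eq, smul_add, smul_sub, Finset.sum_add_distrib, Finset.sum_sub_distrib]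
    abel
  have k1 := key i j
  have k2 := key j i
  rw [mpd_comm hPs hz j i] at k2
  have ci := h.chrMat_change hz i
  have cj := h.chrMat_change hz j
  rw [s]
  set P := jacMat φ z
  set Bi := pullChr G φ i z
  set Bj := pullChr G φ j z
  have k1' : P * mpd i (chrMat G' j) z = mpd i (mpd j (jacMat φ)) z +
      (mpd i (pullChr G φ j) z * P + Bj * mpd i (jacMat φ) z) -
      mpd i (jacMat φ) z * chrMat G' j z := by rw [← k1]; abel
  have k2' : P * mpd j (chrMat G' i) z = mpd i (mpd j (jacMat φ)) z +
      (mpd j (pullChr G φ i) z * P + Bi * mpd j (jacMat φ) z) -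
      mpd j (jacMat φ) z * chrMat G' i z := by rw [← k2]; abel
  calc P * curvMat G' i j z = P * mpd i (chrMat G' j) z - P * mpd j (chrMat G' i) z +
        ((P * chrMat G' i z) * chrMat G' j z - (P * chrMat G' j z) * chrMat G' i z) := by
        rw [curvMat_eq]; noncomm_ring
    _ = mpd i (mpd j (jacMat φ)) z + (mpd i (pullChr G φ j) z * P + Bj * mpd i (jacMat φ) z) -
        mpd i (jacMat φ) z * chrMat G' j z - (mpd i (mpd j (jacMat φ)) z +
        (mpd j (pullChr G φ i) z * P + Bi * mpd j (jacMat φ) z) -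
        mpd j (jacMat φ) z * chrMat G' i z) + ((mpd i (jacMat φ) z + Bi * P) * chrMat G' j z -
        (mpd j (jacMat φ) z + Bj * P) * chrMat G' i z) := by rw [k1', k2', ci, cj]
    _ = (mpd i (pullChr G φ j) z - mpd j (pullChr G φ i) z) * P + Bj * mpd i (jacMat φ) z
        - Bi * mpd j (jacMat φ) z + Bi * (P * chrMat G' j z) - Bj * (P * chrMat G' i z) := by
        noncomm_ring
    _ = _ := by rw [ci, cj]; noncomm_ring

theorem trace_change (h : IsCoordChange U V φ G J G' J') {z : E4} (hz : z ∈ V) {A B : Mat}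
    (hAB : jacMat φ z * A = B * jacMat φ z) : A.trace = B.trace := by
  have hu := (h.det_ne hz).isUnit
  have : A = (jacMat φ z)⁻¹ * (B * jacMat φ z) := by
    rw [← hAB, ← Matrix.mul_assoc, Matrix.nonsing_inv_mul _ hu, Matrix.one_mul]
  rw [this, Matrix.trace_mul_comm, Matrix.mul_assoc, Matrix.mul_nonsing_inv _ hu, Matrix.mul_one]

theorem pull_two (P η : Mat) (i j : Fin 4) :
    (P.transpose * η * P) i j = ∑ a, ∑ b, P a i * P b j * η a b := by
  simp only [Matrix.mul_apply, Matrix.transpose_apply, Finset.sum_mul]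
  rw [Finset.sum_comm]
  exact Finset.sum_congr rfl fun _ _ => Finset.sum_congr rfl fun _ _ => by ring

theorem covDJ_change (h : IsCoordChange U V φ G J G' J') {z : E4} (hz : z ∈ V) (i : Fin 4) :
    jacMat φ z * covD G' i J' z = (∑ a, jacMat φ z a i • covD G a J (φ z)) * jacMat φ z :=
  h.covD_change h.src.smoothJ h.tgt.smoothJ h.acs hz i

theorem torForm_change (h : IsCoordChange U V φ G J G' J') {z : E4} (hz : z ∈ V) :
    torForm G' J' z = (jacMat φ z).transpose * torForm G J (φ z) * jacMat φ z := by
  ext i j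
  rw [pull_two]
  set P := jacMat φ z with hP
  have e : P * (J' z * covD G' i J' z * covD G' j J' z) =
      (J (φ z) * (∑ a, P a i • covD G a J (φ z)) * (∑ b, P b j • covD G b J (φ z))) * P := by
    have a := h.acs z hz
    have b := h.covDJ_change hz i
    have c := h.covDJ_change hz j
    rw [← hP] at a b c
    calc P * (J' z * covD G' i J' z * covD G' j J' z)
        = (P * J' z) * covD G' i J' z * covD G' j J' z := by noncomm_ring
      _ = J (φ z) * (P * covD G' i J' z) * covD G' j J' z := by rw [a]; noncomm_ring
      _ = J (φ z) * (∑ a, P a i • covD G a J (φ z)) * (P * covD G' j J' z) := by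
          rw [b]; noncomm_ring
      _ = _ := by rw [c]; noncomm_ring
  have t := h.trace_change hz e
  simp only [torForm, Matrix.of_apply]
  rw [t]
  simp only [Finset.mul_sum, Finset.sum_mul, Matrix.trace_sum, Matrix.mul_smul, Matrix.smul_mul,
    Matrix.trace_smul, smul_eq_mul]
  rw [Finset.sum_comm]
  exact Finset.sum_congr rfl fun _ _ => Finset.sum_congr rfl fun _ _ => by ring

theorem ricciForm_change (h : IsCoordChange U V φ G J G' J') {z : E4} (hz : z ∈ V) :
    ricciForm G' J' z = (jacMat φ z).transpose * ricciForm G J (φ z) * jacMat φ z := by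
  ext i j
  rw [pull_two]
  set P := jacMat φ z with hP
  have e : P * (J' z * curvMat G' i j z) =
      (J (φ z) * (∑ a, ∑ b, (P a i * P b j) • curvMat G a b (φ z))) * P := by
    rw [← Matrix.mul_assoc, h.acs z hz, Matrix.mul_assoc, h.curvMat_change hz,
      Matrix.mul_assoc]
  have t := h.trace_change hz e
  simp only [ricciForm, ricForm, Matrix.of_apply]
  rw [t]
  simp only [Finset.mul_sum, Matrix.trace_sum, Matrix.mul_smul, Matrix.trace_smul, smul_eq_mul]

theorem fundForm_change (h : IsCoordChange U V φ G J G' J') {z : E4} (hz : z ∈ V) :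
    fundForm G' J' z = (jacMat φ z).transpose * fundForm G J (φ z) * jacMat φ z := by
  rw [fundForm, h.metric z hz]
  calc (J' z).transpose * ((jacMat φ z).transpose * G (φ z) * jacMat φ z)
      = (jacMat φ z * J' z).transpose * G (φ z) * jacMat φ z := by
        rw [Matrix.transpose_mul]; noncomm_ring
    _ = _ := by rw [h.acs z hz, Matrix.transpose_mul, fundForm]; simp only [Matrix.mul_assoc]

theorem twistForm_change (h : IsCoordChange U V φ G J G' J') {z : E4} (hz : z ∈ V) (i : Fin 4) :
    twistForm G' J' i z = ∑ a, jacMat φ z a i •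
      ((jacMat φ z).transpose * twistForm G J a (φ z) * jacMat φ z) := by
  rw [twistForm, h.metric z hz]
  set P := jacMat φ z with hP
  have e : P * (J' z * covD G' i J' z) = ∑ a, P a i • (J (φ z) * covD G a J (φ z) * P) := by
    rw [← Matrix.mul_assoc, h.acs z hz, Matrix.mul_assoc, h.covDJ_change hz]
    simp only [Finset.mul_sum, Finset.sum_mul, Matrix.mul_smul, Matrix.smul_mul,
      Matrix.mul_assoc, ← hP]
  calc (J' z * covD G' i J' z).transpose * (P.transpose * G (φ z) * P)
      = (P * (J' z * covD G' i J' z)).transpose * G (φ z) * P := by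
        rw [Matrix.transpose_mul P]; simp only [Matrix.mul_assoc]
    _ = _ := by
        rw [e]
        simp only [Matrix.transpose_sum, Finset.sum_mul, Matrix.transpose_smul, Matrix.smul_mul,
          twistForm, Matrix.transpose_mul, Matrix.mul_assoc]

theorem torForm3_change (h : IsCoordChange U V φ G J G' J') {z : E4} (hz : z ∈ V) :
    torForm3 G' J' z = pull3 (jacMat φ z) (torForm3 G J (φ z)) := by
  have key : ∀ i j k, twistForm G' J' i z j k = ∑ a, ∑ b, ∑ c,
      jacMat φ z a i * jacMat φ z b j * jacMat φ z c k * twistForm G J a (φ z) b c := by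
    intro i j k
    rw [h.twistForm_change hz, Matrix.sum_apply]
    refine Finset.sum_congr rfl fun a _ => ?_
    rw [Matrix.smul_apply, pull_two, smul_eq_mul, Finset.mul_sum]
    refine Finset.sum_congr rfl fun b _ => ?_
    rw [Finset.mul_sum]
    exact Finset.sum_congr rfl fun c _ => by ring
  funext i j k
  simp only [torForm3, pull3, key, mul_add, Finset.sum_add_distrib]
  congr 1
  · congr 1
    rw [Finset.sum_comm_cycle]
    exact Finset.sum_congr rfl fun _ _ => Finset.sum_congr rfl fun _ _ =>
      Finset.sum_congr rfl fun _ _ => by ring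
  · rw [← Finset.sum_comm_cycle]
    exact Finset.sum_congr rfl fun _ _ => Finset.sum_congr rfl fun _ _ =>
      Finset.sum_congr rfl fun _ _ => by ring

theorem ricciDensity_change (h : IsCoordChange U V φ G J G' J') {z : E4} (hz : z ∈ V) :
    ricciDensity G' J' z = (jacMat φ z).det * ricciDensity G J (φ z) := by
  rw [ricciDensity, h.ricciForm_change hz, h.fundForm_change hz,
    wedge22_pull _ (IsChartAH.ricciForm_skew _) (h.src.fundForm_skew (h.maps z hz))]
  rfl

theorem torRatio_change (h : IsCoordChange U V φ G J G' J') {z : E4} (hz : z ∈ V) :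
    torRatio G' J' z = torRatio G J (φ z) := by
  rw [torRatio, h.ricciDensity_change hz, h.torForm_change hz, h.fundForm_change hz,
    wedge22_pull _ (h.src.torForm_skew (h.maps z hz)) (h.src.fundForm_skew (h.maps z hz)),
    mul_div_mul_left _ _ (h.det_ne hz)]
  rfl

theorem wedge13_change (h : IsCoordChange U V φ G J G' J') {z : E4} (hz : z ∈ V)
    {f : E4 → ℝ} (hf : DifferentiableAt ℝ f (φ z)) :
    wedge13 (fun i => pderiv i (fun w => f (φ w)) z) (torForm3 G' J' z) =
      (jacMat φ z).det * wedge13 (fun i => pderiv i f (φ z)) (torForm3 G J (φ z)) := by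
  rw [h.torForm3_change hz, ← wedge13_pull _ _ (h.src.isAlt3_torForm3 (h.maps z hz))]
  congr 1
  funext i
  exact pderiv_comp hf ((h.smooth z hz).differentiableAt (by simp)) i

end IsCoordChange

/-! ### The structure of a chart -/

/-- The domain of the transition map from the chart `e'` to the chart `e`. -/
def overlap {M : Type*} [TopologicalSpace M] (e e' : OpenPartialHomeomorph M E4) : Set E4 := e'.target ∩ e'.symm ⁻¹' e.source

theorem isOpen_overlap {M : Type*} [TopologicalSpace M] (e e' : OpenPartialHomeomorph M E4) : IsOpen (overlap e e') :=
  e'.symm.isOpen_inter_preimage e.open_source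

theorem fderiv_eq_jacMat {φ : E4 → E4} {z : E4} (hφ : DifferentiableAt ℝ φ z) (c : Fin 4 → ℝ) :
    fderiv ℝ φ z (WithLp.toLp 2 c) = WithLp.toLp 2 ((jacMat φ z).mulVec c) := by
  have hv : (WithLp.toLp 2 c : E4) = ∑ i, c i • (EuclideanSpace.single i (1 : ℝ) : E4) := by
    ext b
    simp [Finset.sum_apply, Pi.single_apply]
  ext a
  have hp : ∀ v, fderiv ℝ (fun w => φ w a) z v = fderiv ℝ φ z v a := by
    intro v
    have := ((EuclideanSpace.proj a : E4 →L[ℝ] ℝ).hasFDerivAt.comp z hφ.hasFDerivAt).fderiv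
    exact DFunLike.congr_fun this v
  rw [hv, map_sum]
  simp only [map_smul, Matrix.mulVec, dotProduct, jacMat, Matrix.of_apply, pderiv, hp]
  simp [Finset.sum_apply, mul_comm]

section ChartFields

variable {M : Type*} [TopologicalSpace M] [ChartedSpace E4 M]

/-- The linear combination of the coordinate vectors with the given coefficients. -/
def combine (e : OpenPartialHomeomorph M E4) (y : E4) (c : Fin 4 → ℝ) :
    TangentSpace 𝓘(ℝ, E4) (e.symm y) := ∑ a, c a • coordVec e a y

theorem mfderiv_symm_eq (e : OpenPartialHomeomorph M E4) (y v : E4) :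
    (mfderiv 𝓘(ℝ, E4) 𝓘(ℝ, E4) e.symm y v : TangentSpace 𝓘(ℝ, E4) (e.symm y))
      = combine e y v := by
  have hv : v = ∑ a, v a • (EuclideanSpace.single a (1 : ℝ) : E4) := by
    ext b
    simp [Finset.sum_apply, Pi.single_apply]
  conv_lhs => rw [hv]
  erw [map_sum]
  rw [combine]
  refine Finset.sum_congr rfl fun a _ => ?_
  erw [map_smul]
  rfl

theorem combine_single (e : OpenPartialHomeomorph M E4) (y : E4) (i : Fin 4) :
    combine e y (Pi.single i 1) = coordVec e i y := by
  simp [combine, Pi.single_apply]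

theorem combine_sum (e : OpenPartialHomeomorph M E4) (y : E4) (c : Fin 4 → ℝ)
    (d : Fin 4 → Fin 4 → ℝ) :
    ∑ i, c i • combine e y (d i) = combine e y fun a => ∑ i, c i * d i a := by
  simp only [combine, Finset.smul_sum, Finset.sum_smul, smul_smul]
  exact Finset.sum_comm

variable [IsManifold 𝓘(ℝ, E4) ∞ M]

theorem contMDiffAt_atlas_symm {e : OpenPartialHomeomorph M E4} (he : e ∈ atlas E4 M) {y : E4}
    (hy : y ∈ e.target) : ContMDiffAt 𝓘(ℝ, E4) 𝓘(ℝ, E4) ∞ e.symm y :=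
  contMDiffAt_symm_of_mem_maximalAtlas (IsManifold.subset_maximalAtlas he) hy

theorem contMDiffAt_atlas {e : OpenPartialHomeomorph M E4} (he : e ∈ atlas E4 M) {x : M}
    (hx : x ∈ e.source) : ContMDiffAt 𝓘(ℝ, E4) 𝓘(ℝ, E4) ∞ e x :=
  contMDiffAt_of_mem_maximalAtlas (IsManifold.subset_maximalAtlas he) hx

/-- The coordinate field is the image of a constant section under the differential of the smooth map
`e.symm`. -/
theorem contMDiffAt_coordVec {e : OpenPartialHomeomorph M E4} (he : e ∈ atlas E4 M) (i : Fin 4)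
    {y : E4} (hy : y ∈ e.target) :
    ContMDiffAt 𝓘(ℝ, E4) (𝓘(ℝ, E4).prod 𝓘(ℝ, E4)) ∞
      (fun z => Bundle.TotalSpace.mk' E4 (E := fun x : M => TangentSpace 𝓘(ℝ, E4) x)
        (e.symm z) (coordVec e i z)) y := by
  have : IsManifold 𝓘(ℝ, E4) 1 M := IsManifold.of_le (n := ∞) (by simp)
  have h1 := ContMDiffAt.mfderiv_const (m := ∞) (contMDiffAt_atlas_symm he hy) (by simp)
  have h2 : ContMDiffAt 𝓘(ℝ, E4) (𝓘(ℝ, E4).prod 𝓘(ℝ, E4)) ∞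
      (fun z : E4 => Bundle.TotalSpace.mk' E4 (E := fun x : E4 => TangentSpace 𝓘(ℝ, E4) x)
        z (EuclideanSpace.single i (1 : ℝ) : E4)) y := by
    rw [Bundle.contMDiffAt_totalSpace]
    refine ⟨contMDiffAt_id, ?_⟩
    simpa using contMDiffAt_const
  exact ContMDiffAt.clm_apply_of_inCoordinates (b₁ := id) (b₂ := e.symm) h1 h2
    (contMDiffAt_atlas_symm he hy)

namespace AlmostHermitianStructure

variable (S : AlmostHermitianStructure M)

theorem contMDiffAt_inner {e : OpenPartialHomeomorph M E4} (he : e ∈ atlas E4 M) {y : E4}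
    (hy : y ∈ e.target) {v w : ∀ z : E4, TangentSpace 𝓘(ℝ, E4) (e.symm z)}
    (hv : ContMDiffAt 𝓘(ℝ, E4) (𝓘(ℝ, E4).prod 𝓘(ℝ, E4)) ∞
      (fun z => Bundle.TotalSpace.mk' E4 (E := fun x : M => TangentSpace 𝓘(ℝ, E4) x)
        (e.symm z) (v z)) y)
    (hw : ContMDiffAt 𝓘(ℝ, E4) (𝓘(ℝ, E4).prod 𝓘(ℝ, E4)) ∞
      (fun z => Bundle.TotalSpace.mk' E4 (E := fun x : M => TangentSpace 𝓘(ℝ, E4) x)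
        (e.symm z) (w z)) y) :
    ContDiffAt ℝ ∞ (fun z => S.g.inner (e.symm z) (v z) (w z)) y := by
  have h : ContMDiffAt 𝓘(ℝ, E4) (𝓘(ℝ, E4).prod 𝓘(ℝ)) ∞
      (fun z => Bundle.TotalSpace.mk' ℝ (E := Bundle.Trivial M ℝ) (e.symm z)
        (S.g.inner (e.symm z) (v z) (w z))) y := by
    apply ContMDiffAt.clm_bundle_apply₂ (F₁ := E4) (F₂ := E4)
    · exact ContMDiffAt.comp y S.g.contMDiff.contMDiffAt (contMDiffAt_atlas_symm he hy)
    · exact hv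
    · exact hw
  rw [Bundle.contMDiffAt_totalSpace] at h
  exact h.2.contDiffAt

theorem contMDiffAt_acs {e : OpenPartialHomeomorph M E4} (he : e ∈ atlas E4 M) (i : Fin 4)
    {y : E4} (hy : y ∈ e.target) :
    ContMDiffAt 𝓘(ℝ, E4) (𝓘(ℝ, E4).prod 𝓘(ℝ, E4)) ∞
      (fun z => Bundle.TotalSpace.mk' E4 (E := fun x : M => TangentSpace 𝓘(ℝ, E4) x)
        (e.symm z) (S.J (e.symm z) (coordVec e i z))) y := by
  apply ContMDiffAt.clm_bundle_apply (F₁ := E4)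
  · exact ContMDiffAt.comp y S.smooth_J.contMDiffAt (contMDiffAt_atlas_symm he hy)
  · exact contMDiffAt_coordVec he i hy

theorem smoothMat_metricCoef {e : OpenPartialHomeomorph M E4} (he : e ∈ atlas E4 M) :
    SmoothMat e.target (S.metricCoef e) :=
  fun i j _ hy => S.contMDiffAt_inner he hy (contMDiffAt_coordVec he i hy)
    (contMDiffAt_coordVec he j hy)

theorem smoothMat_omegaCoef {e : OpenPartialHomeomorph M E4} (he : e ∈ atlas E4 M) :
    SmoothMat e.target (S.omegaCoef e) :=
  fun i j _ hy => S.contMDiffAt_inner he hy (S.contMDiffAt_acs he i hy)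
    (contMDiffAt_coordVec he j hy)

end AlmostHermitianStructure

theorem eq_combine {e : OpenPartialHomeomorph M E4} (he : e ∈ atlas E4 M) {y : E4}
    (hy : y ∈ e.target) (v : TangentSpace 𝓘(ℝ, E4) (e.symm y)) :
    v = combine e y fun a => vecCoord e a (e.symm y) v := by
  have : IsManifold 𝓘(ℝ, E4) 1 M := IsManifold.of_le (n := ∞) (by simp)
  have h := (mdifferentiable_of_mem_atlas (I := 𝓘(ℝ, E4)) he).symm_comp_deriv
    (e.map_target hy)
  rw [e.right_inv hy] at h
  have := DFunLike.congr_fun h v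
  refine this.symm.trans ?_
  exact mfderiv_symm_eq e y _

theorem vecCoord_combine {e : OpenPartialHomeomorph M E4} (he : e ∈ atlas E4 M) {y : E4}
    (hy : y ∈ e.target) (a : Fin 4) (c : Fin 4 → ℝ) :
    vecCoord e a (e.symm y) (combine e y c) = c a := by
  have : IsManifold 𝓘(ℝ, E4) 1 M := IsManifold.of_le (n := ∞) (by simp)
  have h := DFunLike.congr_fun
    ((mdifferentiable_of_mem_atlas (I := 𝓘(ℝ, E4)) he).comp_symm_deriv hy) (WithLp.toLp 2 c : E4)
  have h2 := mfderiv_symm_eq e y (WithLp.toLp 2 c)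
  rw [vecCoord, ← show _ = combine e y c from h2]
  exact congrArg (fun v : E4 => v a) h

theorem combine_injective {e : OpenPartialHomeomorph M E4} (he : e ∈ atlas E4 M) {y : E4}
    (hy : y ∈ e.target) : Function.Injective (combine e y) := by
  intro c d h
  funext a
  rw [← vecCoord_combine he hy a c, h, vecCoord_combine he hy]

namespace AlmostHermitianStructure

variable (S : AlmostHermitianStructure M)

theorem acs_combine {e : OpenPartialHomeomorph M E4} (he : e ∈ atlas E4 M) {y : E4}
    (hy : y ∈ e.target) (c : Fin 4 → ℝ) :
    S.J (e.symm y) (combine e y c) = combine e y ((S.acsCoef e y).mulVec c) := by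
  have h1 : S.J (e.symm y) (combine e y c)
      = ∑ i, c i • combine e y (fun a => S.acsCoef e y a i) := by
    rw [combine, map_sum]
    refine Finset.sum_congr rfl fun i _ => ?_
    rw [map_smul, eq_combine he hy (S.J (e.symm y) (coordVec e i y))]
    rfl
  rw [h1, combine_sum]
  congr 1
  funext a
  simp [Matrix.mulVec, dotProduct, mul_comm]

theorem inner_combine (e : OpenPartialHomeomorph M E4) (y : E4) (c d : Fin 4 → ℝ) :
    S.g.inner (e.symm y) (combine e y c) (combine e y d) = c ⬝ᵥ (S.metricCoef e y).mulVec d := by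
  simp only [combine, map_sum, map_smul, sum_apply, smul_apply,
    smul_eq_mul, dotProduct, Matrix.mulVec, metricCoef, Matrix.of_apply, Finset.mul_sum]
  rw [Finset.sum_comm]
  refine Finset.sum_congr rfl fun i _ => Finset.sum_congr rfl fun j _ => by ring

theorem _root_.AlmostHermitian.mat_ext_mulVec {A B : Mat} (h : ∀ c, A.mulVec c = B.mulVec c) :
    A = B := by
  ext a i
  simpa using congrFun (h (Pi.single i 1)) a

theorem isHerm {e : OpenPartialHomeomorph M E4} (he : e ∈ atlas E4 M) {y : E4}
    (hy : y ∈ e.target) : IsHerm (S.metricCoef e y) (S.acsCoef e y) where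
  symm := by
    ext i j
    exact S.g.symm _ _ _
  pos v hv := by
    rw [← S.inner_combine]
    refine S.g.pos _ _ fun h => hv ?_
    refine combine_injective he hy (h.trans ?_)
    simp [combine]
  sq := by
    refine mat_ext_mulVec fun c => combine_injective he hy ?_
    rw [← Matrix.mulVec_mulVec, ← S.acs_combine he hy, ← S.acs_combine he hy, S.J_sq]
    simp [combine, Matrix.neg_mulVec]
  orth := by
    ext i j
    have h := S.J_orthogonal (e.symm y) (combine e y (Pi.single i 1)) (combine e y (Pi.single j 1))
    rw [S.acs_combine he hy, S.acs_combine he hy, S.inner_combine, S.inner_combine] at h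
    rw [Matrix.mul_assoc, Matrix.mul_apply]
    simpa [dotProduct, Matrix.mulVec, Matrix.mul_apply, Pi.single_apply] using h

theorem omegaCoef_eq {e : OpenPartialHomeomorph M E4} (he : e ∈ atlas E4 M) {y : E4}
    (hy : y ∈ e.target) : S.omegaCoef e y = fundForm (S.metricCoef e) (S.acsCoef e) y := by
  ext i j
  have h : S.omegaCoef e y i j = S.g.inner (e.symm y)
    (S.J (e.symm y) (combine e y (Pi.single i 1))) (combine e y (Pi.single j 1)) := by
    rw [combine_single, combine_single]; rfl
  rw [h, S.acs_combine he hy, S.inner_combine, fundForm, Matrix.mul_apply]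
  simp [dotProduct]

/-- Smoothness is inferred from `J = G⁻¹ Ωᵀ`, where `Ω` is the matrix of `ω`, rather than from the
components of vectors along the chart. -/
theorem smoothMat_acsCoef {e : OpenPartialHomeomorph M E4} (he : e ∈ atlas E4 M) :
    SmoothMat e.target (S.acsCoef e) := by
  have hG := S.smoothMat_metricCoef he
  have hd : ∀ y ∈ e.target, (S.metricCoef e y).det ≠ 0 := fun y hy => (S.isHerm he hy).det_ne
  refine ((hG.inv hd).mul (S.smoothMat_omegaCoef he).transpose).congr e.open_target
    fun y hy => ?_
  rw [S.omegaCoef_eq he hy, fundForm, Matrix.transpose_mul, Matrix.transpose_transpose,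
    (S.isHerm he hy).symm, ← Matrix.mul_assoc, Matrix.nonsing_inv_mul _ (hd y hy).isUnit,
    Matrix.one_mul]

theorem isChartAH (hS : S.IsAH1) {e : OpenPartialHomeomorph M E4} (he : e ∈ atlas E4 M) :
    IsChartAH e.target (S.metricCoef e) (S.acsCoef e) where
  isOpen := e.open_target
  smoothG := S.smoothMat_metricCoef he
  smoothJ := S.smoothMat_acsCoef he
  herm y hy := S.isHerm he hy
  comm y hy i j := by
    have hH := S.isHerm he hy
    set R := curvMat (S.metricCoef e) i j y with hR
    set g := S.metricCoef e y with hg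
    set A := S.acsCoef e y with hA
    have hr : ∀ k l, riemann (S.metricCoef e) i j k l y = (R.transpose * g) k l := by
      intro k l
      simp [riemann, Matrix.mul_apply, hR, curvMat, hg]
    -- The `AH₁` condition in matrix form. Moving `A` across `g` by skewness gives `R = -A R A`, and
    -- `A² = -1` turns this into commutation.
    have h1 : R.transpose * g = A.transpose * (R.transpose * g) * A := by
      ext k l
      rw [← hr, hS e he y hy i j k l, Matrix.mul_apply]
      rw [Finset.sum_comm]
      refine Finset.sum_congr rfl fun b _ => ?_
      rw [Matrix.mul_apply, Finset.sum_mul]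
      refine Finset.sum_congr rfl fun a _ => ?_
      rw [hr, Matrix.transpose_apply]
      ring
    have h2 : g * A = -(A.transpose * g) := eq_neg_of_add_eq_zero_right hH.skew
    have h3 : R.transpose * g = -(A.transpose * R.transpose * A.transpose) * g := by
      rw [h1, Matrix.mul_assoc, Matrix.mul_assoc R.transpose, h2]
      noncomm_ring
    have h4 : R.transpose = -(A.transpose * R.transpose * A.transpose) := by
      have := congrArg (· * g⁻¹) h3
      simpa only [Matrix.mul_assoc, Matrix.mul_nonsing_inv _ hH.det_ne.isUnit, Matrix.mul_one]
        using this
    have h5 : R = -(A * R * A) := by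
      have := congrArg Matrix.transpose h4
      simpa [Matrix.mul_assoc] using this
    conv_lhs => rw [h5]
    rw [neg_mul, Matrix.mul_assoc (A * R), hH.sq]
    noncomm_ring

end AlmostHermitianStructure

/-! ### Transition maps -/

theorem contDiffAt_transition {e e' : OpenPartialHomeomorph M E4} (he : e ∈ atlas E4 M)
    (he' : e' ∈ atlas E4 M) {z : E4} (hz : z ∈ overlap e e') :
    ContDiffAt ℝ ∞ (fun w => e (e'.symm w)) z :=
  ((contMDiffAt_atlas he hz.2).comp z (contMDiffAt_atlas_symm he' hz.1)).contDiffAt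

/-- The chain rule for `e'.symm = e.symm ∘ (e ∘ e'.symm)`. The base points of the two vectors agree
only propositionally, so the equation is stated in the model space `E4`, which every tangent space
is by definition. -/
theorem combine_transition {e e' : OpenPartialHomeomorph M E4} (he : e ∈ atlas E4 M)
    (he' : e' ∈ atlas E4 M) {z : E4} (hz : z ∈ overlap e e') (c : Fin 4 → ℝ) :
    @Eq E4 (combine e' z c)
      (combine e (e (e'.symm z)) ((jacMat (fun w => e (e'.symm w)) z).mulVec c)) := by
  have : IsManifold 𝓘(ℝ, E4) 1 M := IsManifold.of_le (n := ∞) (by simp)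
  have hφ := contDiffAt_transition he he' hz
  have hd := hφ.differentiableAt (by simp)
  have ht : e (e'.symm z) ∈ e.target := e.map_source hz.2
  have h1 : e'.symm =ᶠ[nhds z] e.symm ∘ fun w => e (e'.symm w) := by
    filter_upwards [(isOpen_overlap e e').mem_nhds hz] with w hw
    exact (e.left_inv hw.2).symm
  have h2 := mfderiv_comp_apply (I := 𝓘(ℝ, E4)) (I' := 𝓘(ℝ, E4)) (I'' := 𝓘(ℝ, E4)) z
    (mdifferentiableAt_atlas_symm (I := 𝓘(ℝ, E4)) he ht) hd.mdifferentiableAt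
    (WithLp.toLp 2 c : E4)
  have h3 : @Eq E4 (mfderiv 𝓘(ℝ, E4) 𝓘(ℝ, E4) (fun w => e (e'.symm w)) z (WithLp.toLp 2 c : E4))
      (WithLp.toLp 2 ((jacMat (fun w => e (e'.symm w)) z).mulVec c)) := by
    rw [mfderiv_eq_fderiv]
    exact fderiv_eq_jacMat hd c
  have h4 : @Eq E4 (mfderiv 𝓘(ℝ, E4) 𝓘(ℝ, E4) e'.symm z (WithLp.toLp 2 c : E4))
      (mfderiv 𝓘(ℝ, E4) 𝓘(ℝ, E4) (e.symm ∘ fun w => e (e'.symm w)) z (WithLp.toLp 2 c : E4)) := by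
    rw [h1.mfderiv_eq]
    rfl
  refine Eq.trans (mfderiv_symm_eq e' z _).symm (h4.trans (h2.trans ?_))
  refine Eq.trans ?_ (mfderiv_symm_eq e (e (e'.symm z))
    (WithLp.toLp 2 ((jacMat (fun w => e (e'.symm w)) z).mulVec c)))
  exact congrArg (mfderiv 𝓘(ℝ, E4) 𝓘(ℝ, E4) e.symm (e (e'.symm z))) h3

namespace AlmostHermitianStructure

variable (S : AlmostHermitianStructure M)

theorem inner_congr {x x' : M} (h : x = x') {u v : TangentSpace 𝓘(ℝ, E4) x}
    {u' v' : TangentSpace 𝓘(ℝ, E4) x'} (hu : @Eq E4 u u') (hv : @Eq E4 v v') :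
    S.g.inner x u v = S.g.inner x' u' v' := by
  subst h
  obtain rfl : u = u' := hu
  obtain rfl : v = v' := hv
  rfl

theorem acs_congr {x x' : M} (h : x = x') {u : TangentSpace 𝓘(ℝ, E4) x}
    {u' : TangentSpace 𝓘(ℝ, E4) x'} (hu : @Eq E4 u u') : @Eq E4 (S.J x u) (S.J x' u') := by
  subst h
  obtain rfl : u = u' := hu
  rfl

theorem isCoordChange (hS : S.IsAH1) {e e' : OpenPartialHomeomorph M E4} (he : e ∈ atlas E4 M)
    (he' : e' ∈ atlas E4 M) :
    IsCoordChange e.target (overlap e e') (fun w => e (e'.symm w)) (S.metricCoef e) (S.acsCoef e)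
      (S.metricCoef e') (S.acsCoef e') where
  src := S.isChartAH hS he
  tgt := (S.isChartAH hS he').mono (isOpen_overlap e e') fun _ hz => hz.1
  maps z hz := e.map_source hz.2
  smooth z hz := contDiffAt_transition he he' hz
  metric z hz := by
    have hx : e'.symm z = e.symm (e (e'.symm z)) := (e.left_inv hz.2).symm
    ext i j
    have h := S.inner_congr hx (combine_transition he he' hz (Pi.single i 1))
      (combine_transition he he' hz (Pi.single j 1))
    rw [S.inner_combine, S.inner_combine] at h
    rw [Matrix.mul_assoc, Matrix.mul_apply]
    simpa [dotProduct, Matrix.mulVec, Matrix.mul_apply, Pi.single_apply] using h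
  acs z hz := by
    have hx : e'.symm z = e.symm (e (e'.symm z)) := (e.left_inv hz.2).symm
    have ht : e (e'.symm z) ∈ e.target := e.map_source hz.2
    refine mat_ext_mulVec fun c => combine_injective he ht ?_
    have h := S.acs_congr hx (combine_transition he he' hz c)
    rw [S.acs_combine he' hz.1, S.acs_combine he ht] at h
    rw [← Matrix.mulVec_mulVec, ← Matrix.mulVec_mulVec]
    exact (combine_transition he he' hz _).symm.trans h

end AlmostHermitianStructure

end ChartFields

/-! ### Integration on open subsets of `ℝ⁴` -/

open MeasureTheory

section Euclidean

variable {U K : Set E4} {f : E4 → ℝ}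

theorem integrableOn_of_compact (hU : IsOpen U) (hK : IsCompact K) (hKU : K ⊆ U)
    (hf : ContinuousOn f U) (h0 : ∀ y ∈ U, y ∉ K → f y = 0) : IntegrableOn f U :=
  ((hf.mono hKU).integrableOn_compact hK).of_forall_sdiff_eq_zero hU.measurableSet
    fun y hy => h0 y hy.1 hy.2

theorem pderiv_eq_zero_of_notMem (hU : IsOpen U) (hK : IsCompact K)
    (h0 : ∀ y ∈ U, y ∉ K → f y = 0) {y : E4} (hy : y ∈ U) (hyK : y ∉ K) (i : Fin 4) :
    pderiv i f y = 0 := by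
  have h : f =ᶠ[nhds y] fun _ => 0 := by
    filter_upwards [hU.mem_nhds hy, hK.isClosed.isOpen_compl.mem_nhds hyK] with z hz hzK
    exact h0 z hz hzK
  rw [pderiv, h.fderiv_eq]
  simp

theorem integral_pderiv_eq_zero {F : E4 → ℝ} (hF : ContDiff ℝ ∞ F) (hc : HasCompactSupport F)
    (i : Fin 4) : ∫ y, pderiv i F y = 0 := by
  have h1 : Continuous fun y => fderiv ℝ F y (EuclideanSpace.single i (1 : ℝ)) :=
    (hF.continuous_fderiv (by simp)).clm_apply continuous_const
  have h2 : HasCompactSupport fun y => fderiv ℝ F y (EuclideanSpace.single i (1 : ℝ)) :=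
    hc.fderiv_apply (𝕜 := ℝ) _
  -- Integration by parts against the constant function 1.
  have := integral_mul_fderiv_eq_neg_fderiv_mul_of_integrable (μ := volume) (𝕜 := ℝ)
    (f := fun _ : E4 => (1 : ℝ)) (g := F) (v := EuclideanSpace.single i 1) (by simp)
    (by simpa using h1.integrable_of_hasCompactSupport h2)
    (by simpa using hF.continuous.integrable_of_hasCompactSupport hc)
    (by simp) (fun y _ => hF.differentiable (by simp) y)
  simpa [pderiv] using this

/-- Extended by zero, `f` is smooth on all of `ℝ⁴` with compact support in `K`, since the open sets
`U` and the complement of `K` cover the space. -/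
theorem setIntegral_pderiv_eq_zero (hU : IsOpen U) (hK : IsCompact K) (hKU : K ⊆ U)
    (hf : ∀ y ∈ U, ContDiffAt ℝ ∞ f y) (h0 : ∀ y ∈ U, y ∉ K → f y = 0) (i : Fin 4) :
    ∫ y in U, pderiv i f y = 0 := by
  have hz : ∀ y, y ∉ K → U.indicator f y = 0 := fun y hy => by
    by_cases hyU : y ∈ U
    · rw [Set.indicator_of_mem hyU, h0 y hyU hy]
    · exact Set.indicator_of_notMem hyU f
  have hUe : ∀ y ∈ U, U.indicator f =ᶠ[nhds y] f := fun y hy => by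
    filter_upwards [hU.mem_nhds hy] with z hz
    exact Set.indicator_of_mem hz f
  have hKe : ∀ y, y ∉ K → U.indicator f =ᶠ[nhds y] fun _ => 0 := fun y hy => by
    filter_upwards [hK.isClosed.isOpen_compl.mem_nhds hy] with z hzK
    exact hz z hzK
  have hF : ContDiff ℝ ∞ (U.indicator f) := contDiff_iff_contDiffAt.2 fun y => by
    by_cases hy : y ∈ U
    · exact (hf y hy).congr_of_eventuallyEq (hUe y hy)
    · exact contDiffAt_const.congr_of_eventuallyEq (hKe y fun h => hy (hKU h))
  rw [← integral_pderiv_eq_zero hF (HasCompactSupport.intro hK hz) i,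
    ← setIntegral_eq_integral_of_forall_compl_eq_zero (s := U)
      (f := pderiv i (U.indicator f))]
  · refine setIntegral_congr_fun hU.measurableSet fun y hy => ?_
    simp only [pderiv, (hUe y hy).fderiv_eq]
  · intro y hy
    simp only [pderiv, (hKe y fun h => hy (hKU h)).fderiv_eq]
    simp

end Euclidean

/-! ### The flux of `torForm3` -/

/-- The sign of `ricciDensity`. -/
def ricciSign (G J : E4 → Mat) (y : E4) : ℝ := ricciDensity G J y / |ricciDensity G J y|

/-- The density `± h dc ∧ ψ`, where `h` is `torRatio` and `ψ` is `torForm3`. -/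
def flux (G J : E4 → Mat) (c : E4 → ℝ) (y : E4) : ℝ :=
  ricciSign G J y * torRatio G J y * wedge13 (fun i => pderiv i c y) (torForm3 G J y)

/-- The density `h² |ρ ∧ ω|`, where `h` is `torRatio`. -/
def torEnergy (G J : E4 → Mat) (y : E4) : ℝ := torRatio G J y ^ 2 * |ricciDensity G J y|

namespace IsChartAH

variable {U K : Set E4} {G J : E4 → Mat} {c : E4 → ℝ}

theorem ricciSign_eventuallyEq (h : IsChartAH U G J) {y : E4} (hy : y ∈ U)
    (hs : ricciDensity G J y ≠ 0) : ricciSign G J =ᶠ[nhds y] fun _ => ricciSign G J y := by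
  have hc := (h.smooth_ricciDensity hy).continuousAt
  rcases lt_or_gt_of_ne hs with h0 | h0
  · filter_upwards [hc.eventually (gt_mem_nhds h0)] with z hz
    rw [ricciSign, ricciSign, abs_of_neg hz, abs_of_neg h0, div_neg, div_neg, div_self hz.ne,
      div_self h0.ne]
  · filter_upwards [hc.eventually (lt_mem_nhds h0)] with z hz
    rw [ricciSign, ricciSign, abs_of_pos hz, abs_of_pos h0, div_self hz.ne', div_self h0.ne']

theorem smooth_ricciSign (h : IsChartAH U G J) {y : E4} (hy : y ∈ U)
    (hs : ricciDensity G J y ≠ 0) : ContDiffAt ℝ ∞ (ricciSign G J) y :=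
  contDiffAt_const.congr_of_eventuallyEq (h.ricciSign_eventuallyEq hy hs)

theorem smooth_flux (h : IsChartAH U G J) (hs : ∀ z ∈ U, ricciDensity G J z ≠ 0)
    (hc : ∀ y ∈ U, ContDiffAt ℝ ∞ c y) {y : E4} (hy : y ∈ U) :
    ContDiffAt ℝ ∞ (flux G J c) y := by
  have a := fun i => contDiffAt_pderiv (hc y hy) i
  have b := fun i j k => h.smooth_torForm3 hy i j k
  refine ((h.smooth_ricciSign hy (hs y hy)).mul (h.smooth_torRatio hy (hs y hy))).mul ?_
  exact ((((a 0).mul (b 1 2 3)).sub ((a 1).mul (b 0 2 3))).add ((a 2).mul (b 0 1 3))).sub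
    ((a 3).mul (b 0 1 2))

theorem continuousOn_torEnergy (h : IsChartAH U G J) (hs : ∀ z ∈ U, ricciDensity G J z ≠ 0) :
    ContinuousOn (torEnergy G J) U := fun _ hy =>
  (((h.smooth_torRatio hy (hs _ hy)).continuousAt.pow 2).mul
    (h.smooth_ricciDensity hy).continuousAt.abs).continuousWithinAt

/-- Leibniz rule for `d(c σ h ψ)`: the sign `σ` is locally constant, `dh ∧ ψ = 0`, and `h dψ = -½ h²
ρ ∧ ω`. -/
theorem div_flux (h : IsChartAH U G J) (hs : ∀ z ∈ U, ricciDensity G J z ≠ 0) {y : E4}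
    (hy : y ∈ U) (hc : ContDiffAt ℝ ∞ c y) :
    extDerivThree (fun z i j k => c z * (ricciSign G J z * torRatio G J z) * torForm3 G J z i j k) y
      = flux G J c y - (1 / 2 : ℝ) * (c y * torEnergy G J y) := by
  have hr := h.smooth_torRatio hy (hs y hy)
  have hσ := h.smooth_ricciSign hy (hs y hy)
  have key : ∀ l i j k, pderiv l (fun z => c z * (ricciSign G J z * torRatio G J z)
      * torForm3 G J z i j k) y =
      (pderiv l c y * (ricciSign G J y * torRatio G J y)
        + c y * (ricciSign G J y * pderiv l (torRatio G J) y)) * torForm3 G J y i j k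
      + c y * (ricciSign G J y * torRatio G J y) * pderiv l (fun z => torForm3 G J z i j k) y := by
    intro l i j k
    have h0 : pderiv l (ricciSign G J) y = 0 := by
      rw [pderiv, (h.ricciSign_eventuallyEq hy (hs y hy)).fderiv_eq]
      simp
    rw [pderiv_mul (smooth_diff (hc.mul (hσ.mul hr))) (smooth_diff (h.smooth_torForm3 hy i j k)),
      pderiv_mul (smooth_diff hc) (smooth_diff (hσ.mul hr)),
      pderiv_mul (smooth_diff hσ) (smooth_diff hr), h0]
    ring
  have e1 := h.wedge13_dRatio hs hy
  have e2 := h.extDerivThree_eq hs hy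
  have e3 : ricciSign G J y * ricciDensity G J y = |ricciDensity G J y| := by
    rw [ricciSign, div_mul_eq_mul_div, ← abs_mul_abs_self, mul_div_assoc,
      div_self (abs_ne_zero.2 (hs y hy)), mul_one]
  rw [extDerivThree] at e2 ⊢
  simp only [key]
  rw [wedge13] at e1
  simp only [flux, torEnergy, ← e3, wedge13]
  linear_combination c y * ricciSign G J y * e1 + c y * ricciSign G J y * torRatio G J y * e2

theorem integral_flux (h : IsChartAH U G J) (hs : ∀ z ∈ U, ricciDensity G J z ≠ 0)
    (hK : IsCompact K) (hKU : K ⊆ U) (hc : ∀ y ∈ U, ContDiffAt ℝ ∞ c y)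
    (h0 : ∀ y ∈ U, y ∉ K → c y = 0) :
    ∫ y in U, flux G J c y = (1 / 2 : ℝ) * ∫ y in U, c y * torEnergy G J y := by
  have hsm : ∀ i j k, ∀ y ∈ U, ContDiffAt ℝ ∞
      (fun z => c z * (ricciSign G J z * torRatio G J z) * torForm3 G J z i j k) y :=
    fun i j k y hy => ((hc y hy).mul ((h.smooth_ricciSign hy (hs y hy)).mul
      (h.smooth_torRatio hy (hs y hy)))).mul (h.smooth_torForm3 hy i j k)
  have hv : ∀ i j k, ∀ y ∈ U, y ∉ K →
      c y * (ricciSign G J y * torRatio G J y) * torForm3 G J y i j k = 0 :=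
    fun i j k y hy hyK => by rw [h0 y hy hyK]; ring
  have hI : ∀ l i j k, IntegrableOn (pderiv l (fun z => c z * (ricciSign G J z * torRatio G J z)
      * torForm3 G J z i j k)) U := fun l i j k =>
    integrableOn_of_compact h.isOpen hK hKU
      (fun y hy => (contDiffAt_pderiv (hsm i j k y hy) l).continuousAt.continuousWithinAt)
      fun y hy hyK => pderiv_eq_zero_of_notMem h.isOpen hK (hv i j k) hy hyK l
  have hZ := fun l i j k => setIntegral_pderiv_eq_zero h.isOpen hK hKU (hsm i j k) (hv i j k) l
  have hD : ∫ y in U, extDerivThree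
      (fun z i j k => c z * (ricciSign G J z * torRatio G J z) * torForm3 G J z i j k) y = 0 := by
    simp only [extDerivThree]
    have i1 := (hI 0 1 2 3).sub (hI 1 0 2 3)
    have i2 := i1.add (hI 2 0 1 3)
    refine (integral_sub i2 (hI 3 0 1 2)).trans ?_
    rw [hZ, sub_zero]
    refine (integral_add i1 (hI 2 0 1 3)).trans ?_
    rw [hZ, add_zero]
    refine (integral_sub (hI 0 1 2 3) (hI 1 0 2 3)).trans ?_
    rw [hZ, hZ, sub_zero]
  rw [setIntegral_congr_fun h.isOpen.measurableSet fun y hy => h.div_flux hs hy (hc y hy),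
    integral_sub, integral_const_mul] at hD
  · linarith
  · exact integrableOn_of_compact h.isOpen hK hKU
      (fun y hy => (h.smooth_flux hs hc hy).continuousAt.continuousWithinAt)
      fun y hy hyK => by
        simp [flux, wedge13, pderiv_eq_zero_of_notMem h.isOpen hK h0 hy hyK]
  · refine (integrableOn_of_compact h.isOpen hK hKU ?_ fun y hy hyK => ?_).const_mul _
    · exact ContinuousOn.mul (fun y hy => (hc y hy).continuousAt.continuousWithinAt)
        (h.continuousOn_torEnergy hs)
    · rw [h0 y hy hyK, zero_mul]

end IsChartAH

namespace IsCoordChange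

variable {U V : Set E4} {φ : E4 → E4} {G J G' J' : E4 → Mat}

/-- The 4-form `dc ∧ ψ` acquires the factor `det` and the sign of `ρ ∧ ω` acquires `det / |det|`.
The flux is therefore a density and integrates without an orientation. -/
theorem flux_change (h : IsCoordChange U V φ G J G' J') {z : E4} (hz : z ∈ V) {f : E4 → ℝ}
    (hf : DifferentiableAt ℝ f (φ z)) :
    flux G' J' (fun w => f (φ w)) z = |(jacMat φ z).det| * flux G J f (φ z) := by
  have hd := h.det_ne hz
  rw [flux, h.wedge13_change hz hf, h.torRatio_change hz, ricciSign, h.ricciDensity_change hz,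
    flux, ricciSign, abs_mul, mul_div_mul_comm]
  have key : (jacMat φ z).det / |(jacMat φ z).det| * (jacMat φ z).det = |(jacMat φ z).det| := by
    rw [div_mul_eq_mul_div, ← abs_mul_abs_self, mul_div_assoc, div_self (abs_ne_zero.2 hd),
      mul_one]
  linear_combination (ricciDensity G J (φ z) / |ricciDensity G J (φ z)| * torRatio G J (φ z) *
    wedge13 (fun i => pderiv i f (φ z)) (torForm3 G J (φ z))) * key

theorem det_fderiv (h : IsCoordChange U V φ G J G' J') {z : E4} (hz : z ∈ V) :
    (fderiv ℝ φ z).det = (jacMat φ z).det := by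
  rw [ContinuousLinearMap.det,
    ← LinearMap.det_toMatrix (EuclideanSpace.basisFun (Fin 4) ℝ).toBasis]
  congr 1
  ext a i
  have hd := (h.smooth z hz).differentiableAt (by simp)
  have h1 := fderiv_eq_jacMat hd (Pi.single i 1)
  rw [LinearMap.toMatrix_apply]
  have h2 := congrArg (fun v : E4 => v a) h1
  simp only [Matrix.mulVec_single_one, Matrix.col_apply] at h2
  simpa using h2

theorem setIntegral_change (h : IsCoordChange U V φ G J G' J') (hinj : Set.InjOn φ V)
    {g g' : E4 → ℝ} (hg : ∀ z ∈ V, g' z = |(jacMat φ z).det| * g (φ z)) :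
    ∫ y in φ '' V, g y = ∫ z in V, g' z := by
  have hd : ∀ z ∈ V, HasFDerivWithinAt φ (fderiv ℝ φ z) V z := fun z hz =>
    ((h.smooth z hz).differentiableAt (by simp)).hasFDerivAt.hasFDerivWithinAt
  rw [integral_image_eq_integral_abs_det_fderiv_smul _ h.tgt.isOpen.measurableSet hd hinj]
  refine setIntegral_congr_fun h.tgt.isOpen.measurableSet fun z hz => ?_
  simp only [h.det_fderiv hz, hg z hz, smul_eq_mul]

end IsCoordChange

/-! ### The vanishing of `torRatio` on compact manifolds -/

open MeasureTheory

section Global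

variable {M : Type*} [TopologicalSpace M] [ChartedSpace E4 M]

theorem exists_chart_partition [T2Space M] [CompactSpace M] [IsManifold 𝓘(ℝ, E4) ∞ M] :
    ∃ (t : Finset M) (χ : t → M → ℝ), (∀ i, ContMDiff 𝓘(ℝ, E4) 𝓘(ℝ, ℝ) ∞ (χ i)) ∧
      (∀ i x, 0 ≤ χ i x) ∧ (∀ i, tsupport (χ i) ⊆ (chartAt E4 (i : M)).source) ∧
      ∀ x, ∑ i, χ i x = 1 := by
  obtain ⟨t, ht⟩ := CompactSpace.elim_nhds_subcover (fun x : M => (chartAt E4 x).source)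
    fun x => (chartAt E4 x).open_source.mem_nhds (mem_chart_source E4 x)
  obtain ⟨f, hf⟩ := SmoothPartitionOfUnity.exists_isSubordinate 𝓘(ℝ, E4) (s := Set.univ (α := M))
    isClosed_univ (fun i : t => (chartAt E4 (i : M)).source)
    (fun i => (chartAt E4 (i : M)).open_source) (by
      intro x _
      have hx : x ∈ ⋃ i ∈ t, (chartAt E4 i).source := by rw [ht]; trivial
      simp only [Set.mem_iUnion] at hx ⊢
      obtain ⟨i, hi, hxi⟩ := hx
      exact ⟨⟨i, hi⟩, hxi⟩)
  refine ⟨t, fun i => f i, fun i => (f i).contMDiff, fun i x => f.nonneg i x, hf, fun x => ?_⟩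
  rw [← finsum_eq_sum_of_fintype]
  exact f.sum_eq_one (Set.mem_univ x)

theorem flux_congr {G J : E4 → Mat} {c d : E4 → ℝ} {y : E4} (h : c =ᶠ[nhds y] d) :
    flux G J c y = flux G J d y := by
  simp only [flux, pderiv, h.fderiv_eq]

theorem flux_const (G J : E4 → Mat) (r : ℝ) (y : E4) : flux G J (fun _ => r) y = 0 := by
  simp [flux, pderiv, wedge13]

theorem flux_sum {ι : Type*} [Fintype ι] (G J : E4 → Mat) {c : ι → E4 → ℝ} {y : E4}
    (hc : ∀ i, DifferentiableAt ℝ (c i) y) :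
    ∑ i, flux G J (c i) y = flux G J (fun z => ∑ i, c i z) y := by
  have h : ∀ l, pderiv l (fun z => ∑ i, c i z) y = ∑ i, pderiv l (c i) y := fun l => by
    simp only [pderiv]
    rw [fderiv_fun_sum fun i _ => hc i, sum_apply]
  simp only [flux, h, wedge13, Finset.sum_mul, ← Finset.sum_sub_distrib, ← Finset.sum_add_distrib,
    Finset.mul_sum]

variable [IsManifold 𝓘(ℝ, E4) ∞ M]

theorem contDiffAt_comp_symm {e : OpenPartialHomeomorph M E4} (he : e ∈ atlas E4 M) {f : M → ℝ}
    (hf : ContMDiff 𝓘(ℝ, E4) 𝓘(ℝ, ℝ) ∞ f) {y : E4} (hy : y ∈ e.target) :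
    ContDiffAt ℝ ∞ (fun z => f (e.symm z)) y :=
  (hf.contMDiffAt.comp y (contMDiffAt_atlas_symm he hy)).contDiffAt

namespace AlmostHermitianStructure

variable (S : AlmostHermitianStructure M)

theorem ricciDensity_ne (hS : S.IsAH1) (hs : S.ScalarCurvatureNowhereZero)
    {e : OpenPartialHomeomorph M E4} (he : e ∈ atlas E4 M) :
    ∀ y ∈ e.target, ricciDensity (S.metricCoef e) (S.acsCoef e) y ≠ 0 :=
  fun y hy => (S.isChartAH hS he).ricciDensity_ne hy (hs e he y hy)

/-- The flux density of a function on `M` in a chart. -/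
def chartFlux (e : OpenPartialHomeomorph M E4) (f : M → ℝ) (y : E4) : ℝ :=
  flux (S.metricCoef e) (S.acsCoef e) (fun z => f (e.symm z)) y

theorem chartFlux_eq_zero {e : OpenPartialHomeomorph M E4} {f : M → ℝ} {y : E4}
    (hy : y ∈ e.target) (hf : e.symm y ∉ tsupport f) : S.chartFlux e f y = 0 := by
  have h : (fun z => f (e.symm z)) =ᶠ[nhds y] fun _ => 0 := by
    filter_upwards [(e.continuousAt_symm hy).eventually
      ((isClosed_tsupport f).isOpen_compl.mem_nhds hf)] with z hz
    exact image_eq_zero_of_notMem_tsupport hz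
  rw [chartFlux, flux_congr h, flux_const]

/-- Because `f` is supported in one chart and `k` in the other, both integrals live on the overlap,
where the change of variables formula compares them. -/
theorem setIntegral_chartFlux_change (hS : S.IsAH1) {e e' : OpenPartialHomeomorph M E4}
    (he : e ∈ atlas E4 M) (he' : e' ∈ atlas E4 M) {f k : M → ℝ}
    (hf : ContMDiff 𝓘(ℝ, E4) 𝓘(ℝ, ℝ) ∞ f) (hfe : tsupport f ⊆ e.source)
    (hke : tsupport k ⊆ e'.source) :
    ∫ y in e.target, k (e.symm y) * S.chartFlux e f y =
      ∫ z in e'.target, k (e'.symm z) * S.chartFlux e' f z := by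
  have h1 : ∫ y in e.target, k (e.symm y) * S.chartFlux e f y =
      ∫ y in overlap e' e, k (e.symm y) * S.chartFlux e f y := by
    refine setIntegral_eq_of_subset_of_forall_sdiff_eq_zero e.open_target.measurableSet
      (fun y hy => hy.1) fun y hy => ?_
    rw [image_eq_zero_of_notMem_tsupport fun h => hy.2 ⟨hy.1, hke h⟩, zero_mul]
  have h2 : ∫ z in e'.target, k (e'.symm z) * S.chartFlux e' f z =
      ∫ z in overlap e e', k (e'.symm z) * S.chartFlux e' f z := by
    refine setIntegral_eq_of_subset_of_forall_sdiff_eq_zero e'.open_target.measurableSet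
      (fun y hy => hy.1) fun y hy => ?_
    rw [S.chartFlux_eq_zero hy.1 fun h => hy.2 ⟨hy.1, hfe h⟩, mul_zero]
  have hinj : Set.InjOn (fun w => e (e'.symm w)) (overlap e e') := fun a ha b hb hab =>
    e'.symm.injOn ha.1 hb.1 (e.injOn ha.2 hb.2 hab)
  have himg : (fun w => e (e'.symm w)) '' overlap e e' = overlap e' e := by
    ext y
    constructor
    · rintro ⟨z, hz, rfl⟩
      refine ⟨e.map_source hz.2, ?_⟩
      simp only [Set.mem_preimage, e.left_inv hz.2]
      exact e'.map_target hz.1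
    · intro hy
      refine ⟨e' (e.symm y), ⟨e'.map_source hy.2, ?_⟩, ?_⟩
      · simp only [Set.mem_preimage, e'.left_inv hy.2]
        exact e.map_target hy.1
      · simp only [e'.left_inv hy.2, e.right_inv hy.1]
  rw [h1, h2, ← himg]
  refine (S.isCoordChange hS he he').setIntegral_change hinj fun z hz => ?_
  have hc : (fun w => f (e'.symm w)) =ᶠ[nhds z] fun w => f (e.symm (e (e'.symm w))) := by
    filter_upwards [(isOpen_overlap e e').mem_nhds hz] with w hw
    rw [e.left_inv hw.2]
  rw [chartFlux, flux_congr hc, (S.isCoordChange hS he he').flux_change hz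
    (f := fun y => f (e.symm y)) (smooth_diff (contDiffAt_comp_symm he hf (e.map_source hz.2))),
    e.left_inv hz.2, chartFlux]
  ring

/-! ### Stokes' theorem through a partition of unity -/

section Partition

variable {ι : Type*} [Fintype ι] {e : ι → OpenPartialHomeomorph M E4} {χ : ι → M → ℝ}

theorem integrable_chartFlux [CompactSpace M] (hS : S.IsAH1) (hs : S.ScalarCurvatureNowhereZero)
    {e : OpenPartialHomeomorph M E4} (he : e ∈ atlas E4 M) {f k : M → ℝ}
    (hf : ContMDiff 𝓘(ℝ, E4) 𝓘(ℝ, ℝ) ∞ f) (hk : ContMDiff 𝓘(ℝ, E4) 𝓘(ℝ, ℝ) ∞ k)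
    (h : tsupport f ⊆ e.source ∨ tsupport k ⊆ e.source) :
    IntegrableOn (fun y => k (e.symm y) * S.chartFlux e f y) e.target := by
  have hcont : ContinuousOn (fun y => k (e.symm y) * S.chartFlux e f y) e.target := fun y hy =>
    ((contDiffAt_comp_symm he hk hy).continuousAt.mul ((S.isChartAH hS he).smooth_flux
      (S.ricciDensity_ne hS hs he) (fun z hz => contDiffAt_comp_symm he hf hz)
      hy).continuousAt).continuousWithinAt
  have hcpt : ∀ {r : M → ℝ}, tsupport r ⊆ e.source → IsCompact (e '' tsupport r) ∧
      e '' tsupport r ⊆ e.target := fun {r} hr =>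
    ⟨(isClosed_tsupport r).isCompact.image_of_continuousOn (e.continuousOn.mono hr),
      (Set.image_mono hr).trans e.image_source_eq_target.subset⟩
  have hmem : ∀ {r : M → ℝ} {y : E4}, y ∈ e.target → y ∉ e '' tsupport r →
      e.symm y ∉ tsupport r := fun {r y} hy hn hm => hn ⟨_, hm, e.right_inv hy⟩
  rcases h with h | h
  · refine integrableOn_of_compact e.open_target (hcpt h).1 (hcpt h).2 hcont fun y hy hn => ?_
    rw [S.chartFlux_eq_zero hy (hmem hy hn), mul_zero]
  · refine integrableOn_of_compact e.open_target (hcpt h).1 (hcpt h).2 hcont fun y hy hn => ?_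
    rw [image_eq_zero_of_notMem_tsupport (hmem hy hn), zero_mul]

/-- Insert `1 = ∑ j, χ j` under each integral and move the `j`-th piece to the `j`-th chart. Summing
over `i` there gives the flux of the constant function 1, which is zero. -/
theorem sum_integral_chartFlux [CompactSpace M] (hS : S.IsAH1)
    (hs : S.ScalarCurvatureNowhereZero) (he : ∀ i, e i ∈ atlas E4 M)
    (hχ : ∀ i, ContMDiff 𝓘(ℝ, E4) 𝓘(ℝ, ℝ) ∞ (χ i)) (hsub : ∀ i, tsupport (χ i) ⊆ (e i).source)
    (h1 : ∀ x, ∑ i, χ i x = 1) :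
    ∑ i, ∫ y in (e i).target, S.chartFlux (e i) (χ i) y = 0 := by
  have a : ∀ i, ∫ y in (e i).target, S.chartFlux (e i) (χ i) y =
      ∑ j, ∫ y in (e j).target, χ j ((e j).symm y) * S.chartFlux (e j) (χ i) y := by
    intro i
    have : ∀ j, ∫ y in (e j).target, χ j ((e j).symm y) * S.chartFlux (e j) (χ i) y =
        ∫ y in (e i).target, χ j ((e i).symm y) * S.chartFlux (e i) (χ i) y := fun j =>
      (S.setIntegral_chartFlux_change hS (he i) (he j) (hχ i) (hsub i) (hsub j)).symm
    simp only [this]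
    rw [← integral_finsetSum _ fun j _ =>
      S.integrable_chartFlux hS hs (he i) (hχ i) (hχ j) (Or.inl (hsub i))]
    simp only [← Finset.sum_mul, h1, one_mul]
  simp only [a]
  rw [Finset.sum_comm]
  refine Finset.sum_eq_zero fun j _ => ?_
  rw [← integral_finsetSum _ fun i _ =>
    S.integrable_chartFlux hS hs (he j) (hχ i) (hχ j) (Or.inr (hsub j))]
  refine setIntegral_eq_zero_of_forall_eq_zero fun y hy => ?_
  rw [← Finset.mul_sum]
  simp only [chartFlux]
  rw [flux_sum _ _ fun i => smooth_diff (contDiffAt_comp_symm (he j) (hχ i) hy)]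
  simp only [h1, flux_const, mul_zero]

/-- The total flux is half the sum of the integrals of the nonnegative functions `χ i h² |ρ ∧ ω|`.
As it is zero, each integrand vanishes almost everywhere, hence everywhere by continuity. -/
theorem partition_mul_torEnergy [CompactSpace M] (hS : S.IsAH1)
    (hs : S.ScalarCurvatureNowhereZero) (he : ∀ i, e i ∈ atlas E4 M)
    (hχ : ∀ i, ContMDiff 𝓘(ℝ, E4) 𝓘(ℝ, ℝ) ∞ (χ i)) (h0 : ∀ i x, 0 ≤ χ i x)
    (hsub : ∀ i, tsupport (χ i) ⊆ (e i).source) (h1 : ∀ x, ∑ i, χ i x = 1) (i : ι) {y : E4}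
    (hy : y ∈ (e i).target) :
    χ i ((e i).symm y) * torEnergy (S.metricCoef (e i)) (S.acsCoef (e i)) y = 0 := by
  have hcpt : ∀ i, IsCompact (e i '' tsupport (χ i)) := fun i =>
    (isClosed_tsupport _).isCompact.image_of_continuousOn ((e i).continuousOn.mono (hsub i))
  have hK : ∀ i, e i '' tsupport (χ i) ⊆ (e i).target := fun i =>
    (Set.image_mono (hsub i)).trans (e i).image_source_eq_target.subset
  have hz : ∀ i, ∀ y ∈ (e i).target, y ∉ e i '' tsupport (χ i) → χ i ((e i).symm y) = 0 :=
    fun i y hy hn => image_eq_zero_of_notMem_tsupport fun h => hn ⟨_, h, (e i).right_inv hy⟩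
  have hcont : ∀ i, ContinuousOn (fun y => χ i ((e i).symm y) *
      torEnergy (S.metricCoef (e i)) (S.acsCoef (e i)) y) (e i).target := fun i =>
    ContinuousOn.mul
      (fun y hy => (contDiffAt_comp_symm (he i) (hχ i) hy).continuousAt.continuousWithinAt)
      ((S.isChartAH hS (he i)).continuousOn_torEnergy (S.ricciDensity_ne hS hs (he i)))
  have hint : ∀ i, IntegrableOn (fun y => χ i ((e i).symm y) *
      torEnergy (S.metricCoef (e i)) (S.acsCoef (e i)) y) (e i).target := fun i =>
    integrableOn_of_compact (e i).open_target (hcpt i) (hK i) (hcont i) fun y hy hn => by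
      rw [hz i y hy hn, zero_mul]
  have hnn : ∀ i y, 0 ≤ χ i ((e i).symm y) *
      torEnergy (S.metricCoef (e i)) (S.acsCoef (e i)) y := fun i y =>
    mul_nonneg (h0 i _) (mul_nonneg (sq_nonneg _) (abs_nonneg _))
  have hsum := S.sum_integral_chartFlux hS hs he hχ hsub h1
  have hflux : ∀ i, ∫ y in (e i).target, S.chartFlux (e i) (χ i) y = (1 / 2 : ℝ) *
      ∫ y in (e i).target, χ i ((e i).symm y) *
        torEnergy (S.metricCoef (e i)) (S.acsCoef (e i)) y := fun i =>
    (S.isChartAH hS (he i)).integral_flux (S.ricciDensity_ne hS hs (he i)) (hcpt i) (hK i)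
      (fun y hy => contDiffAt_comp_symm (he i) (hχ i) hy) (hz i)
  simp only [hflux, ← Finset.mul_sum] at hsum
  have hsum0 := (mul_eq_zero.1 hsum).resolve_left (by norm_num)
  have hi := (Finset.sum_eq_zero_iff_of_nonneg fun j _ =>
    integral_nonneg fun y => hnn j y).1 hsum0 i (Finset.mem_univ i)
  have hae := (integral_eq_zero_iff_of_nonneg (hnn i) (hint i)).1 hi
  exact Measure.eqOn_open_of_ae_eq hae (e i).open_target (hcont i) continuousOn_const hy

end Partition

/-- Some `χ i` is nonzero at the given point, so `h` vanishes there in the `i`-th chart of the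
partition. Since `h` is a scalar, it vanishes in the given chart too. -/
theorem torRatio_eq_zero [T2Space M] [CompactSpace M] (hS : S.IsAH1)
    (hs : S.ScalarCurvatureNowhereZero) {e : OpenPartialHomeomorph M E4} (he : e ∈ atlas E4 M)
    {y : E4} (hy : y ∈ e.target) : torRatio (S.metricCoef e) (S.acsCoef e) y = 0 := by
  obtain ⟨t, χ, hχ, h0, hsub, h1⟩ := exists_chart_partition (M := M)
  obtain ⟨i, hi⟩ : ∃ i, χ i (e.symm y) ≠ 0 := by
    by_contra! h
    simpa [h] using h1 (e.symm y)
  set e' := chartAt E4 (i : M) with he'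
  have hxs : e.symm y ∈ e'.source := hsub i (subset_tsupport _ hi)
  have hov : y ∈ overlap e' e := ⟨hy, hxs⟩
  have hyt : e' (e.symm y) ∈ e'.target := e'.map_source hxs
  have hm : e' ∈ atlas E4 M := chart_mem_atlas E4 _
  have hE := S.partition_mul_torEnergy hS hs (e := fun i : t => chartAt E4 (i : M))
    (fun i => chart_mem_atlas E4 _) hχ h0 hsub h1 i hyt
  rw [(S.isCoordChange hS hm he).torRatio_change hov]
  simp only [← he', e'.left_inv hxs] at hE
  have hE' := (mul_eq_zero.1 hE).resolve_left hi
  exact pow_eq_zero_iff (two_ne_zero) |>.1 <| (mul_eq_zero.1 hE').resolve_right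
    (abs_ne_zero.2 (S.ricciDensity_ne hS hs hm _ hyt))

theorem torForm_eq_zero [T2Space M] [CompactSpace M] (hS : S.IsAH1)
    (hs : S.ScalarCurvatureNowhereZero) {e : OpenPartialHomeomorph M E4} (he : e ∈ atlas E4 M)
    {y : E4} (hy : y ∈ e.target) : torForm (S.metricCoef e) (S.acsCoef e) y = 0 := by
  ext i j
  rw [(S.isChartAH hS he).torForm_eq hy (S.ricciDensity_ne hS hs he y hy),
    S.torRatio_eq_zero hS hs he hy, zero_mul, Matrix.zero_apply]

end AlmostHermitianStructure

end Global

/-! ### Parallel almost complex structures are Kähler -/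

namespace IsChartAH

variable {U : Set E4} {G J : E4 → Mat}

theorem extDerivTwo_fundForm_of_parallel (h : IsChartAH U G J) {y : E4} (hy : y ∈ U)
    (hp : ∀ m, covD G m J y = 0) (i j k : Fin 4) : extDerivTwo (fundForm G J) i j k y = 0 := by
  have := h.extDerivTwo_form h.smoothJ (fun w hw => (h.herm w hw).skew) hy i j k
  simp only [hp, Matrix.transpose_zero, Matrix.zero_mul, Matrix.zero_apply, add_zero] at this
  exact this

/-- When `∇J = 0` each `∂_l J` is the commutator `[J, Γ_l]`; after this substitution all terms
cancel by the symmetry of the Christoffel symbols and `J² = -1`. -/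
theorem nijenhuis_of_parallel (h : IsChartAH U G J) {y : E4} (hy : y ∈ U)
    (hp : ∀ m, covD G m J y = 0) (k i j : Fin 4) : nijenhuis J k i j y = 0 := by
  have hE : ∀ l, mpd l J y = J y * chrMat G l y - chrMat G l y * J y := fun l => by
    have := hp l
    rw [covD, add_sub_assoc] at this
    rw [eq_neg_of_add_eq_zero_left this, neg_sub]
  have hΓ := h.isMetricOn.chrMat_symm hy
  have hJ := (h.herm y hy).sq
  have a : ∀ i j, ∑ l, J y l i * mpd l J y k j = (J y * chrMat G j y * J y) k i
      - ∑ l, J y l i * (chrMat G l y * J y) k j := by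
    intro i j
    simp only [hE, Matrix.sub_apply, mul_sub, Finset.sum_sub_distrib]
    congr 1
    rw [Matrix.mul_apply]
    refine Finset.sum_congr rfl fun l _ => ?_
    rw [mul_comm, Matrix.mul_apply, Matrix.mul_apply]
    congr 1
    exact Finset.sum_congr rfl fun m _ => by rw [hΓ]
  have b : ∀ i j, ∑ l, J y k l * mpd j J y l i = -chrMat G j y k i
      - (J y * chrMat G j y * J y) k i := by
    intro i j
    rw [← Matrix.mul_apply, hE, Matrix.mul_sub, ← Matrix.mul_assoc, hJ, ← Matrix.mul_assoc]
    simp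
  have c : ∑ l, J y l i * (chrMat G l y * J y) k j = ∑ l, J y l j * (chrMat G l y * J y) k i := by
    simp only [Matrix.mul_apply, Finset.mul_sum]
    rw [Finset.sum_comm]
    exact Finset.sum_congr rfl fun l _ => Finset.sum_congr rfl fun m _ => by rw [hΓ m l]; ring
  have n : nijenhuis J k i j y = ∑ l, J y l i * mpd l J y k j - ∑ l, J y l j * mpd l J y k i
      + ∑ l, J y k l * mpd j J y l i - ∑ l, J y k l * mpd i J y l j := by
    rw [nijenhuis, Finset.sum_sub_distrib]
    rfl
  rw [n, a, a, b, b, c, hΓ i j k]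
  ring

end IsChartAH

namespace AlmostHermitianStructure

variable {M : Type*} [TopologicalSpace M] [ChartedSpace E4 M] [IsManifold 𝓘(ℝ, E4) ∞ M]
  (S : AlmostHermitianStructure M)

theorem extDerivTwo_omegaCoef {e : OpenPartialHomeomorph M E4} (he : e ∈ atlas E4 M) {y : E4}
    (hy : y ∈ e.target) (i j k : Fin 4) : extDerivTwo (S.omegaCoef e) i j k y =
      extDerivTwo (fundForm (S.metricCoef e) (S.acsCoef e)) i j k y := by
  have h : ∀ i j k, pderiv i (fun z => S.omegaCoef e z j k) y =
      pderiv i (fun z => fundForm (S.metricCoef e) (S.acsCoef e) z j k) y := fun i j k =>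
    pderiv_congr_of_isOpen e.open_target (fun w hw => by rw [S.omegaCoef_eq he hw]) hy i
  rw [extDerivTwo, h, h, h, extDerivTwo]

theorem parallel_acsCoef [T2Space M] [CompactSpace M] (hS : S.IsAH1)
    (hθ : S.IsLocallyConformallyAlmostKahler) (hs : S.ScalarCurvatureNowhereZero)
    {e : OpenPartialHomeomorph M E4} (he : e ∈ atlas E4 M) {y : E4} (hy : y ∈ e.target)
    (m : Fin 4) : covD (S.metricCoef e) m (S.acsCoef e) y = 0 := by
  obtain ⟨θ, ⟨hsm, hlee⟩, hd⟩ := hθ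
  have h := S.isChartAH hS he
  refine h.parallel (S.ricciDensity_ne hS hs he) (fun z hz => S.torForm_eq_zero hS hs he hz)
    (θ := formCoef θ e)
    (fun i z hz => (hsm e he i).contDiffAt (e.open_target.mem_nhds hz))
    (hd e he) (fun z hz i j k => ?_) hy m
  have := hlee e he z hz i j k
  rwa [S.extDerivTwo_omegaCoef he hz, wedgeOneTwo, S.omegaCoef_eq he hz] at this

end AlmostHermitianStructure

end AlmostHermitian

end

theorem mainTheorem7 {M : Type*} [TopologicalSpace M] [T2Space M] [CompactSpace M]
    [ChartedSpace AlmostHermitian.E4 M] [IsManifold 𝓘(ℝ, AlmostHermitian.E4) ∞ M]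
    (S : AlmostHermitian.AlmostHermitianStructure M)
    (hAH1 : S.IsAH1)
    (hθ : S.IsLocallyConformallyAlmostKahler)
    (hs : S.ScalarCurvatureNowhereZero) :
    S.IsKahler := by
  refine ⟨fun e he y hy k i j => (S.isChartAH hAH1 he).nijenhuis_of_parallel hy
    (fun m => S.parallel_acsCoef hAH1 hθ hs he hy m) k i j, fun e he y hy i j k => ?_⟩
  rw [S.extDerivTwo_omegaCoef he hy]
  exact (S.isChartAH hAH1 he).extDerivTwo_fundForm_of_parallel hy
    (fun m => S.parallel_acsCoef hAH1 hθ hs he hy m) i j k
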